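/- **Setting.** Let $\ell(\cdot,\cdot)$ be a known measurable log-density function (with respect to a $\sigma$-finite measure $\nu$ on $\mathbb R$) and $g$ a known link function, mapping the mean-parameter space bijectively onto $\mathbb R$. For each $n$ let $(U_i,X_i,y_i)$, $i=1,\dots,n$, with $X_i=(x_{i1},\dots,x_{id_n})^{T}\in\mathbb R^{d_n}$, be i.i.d. observations (whose law may depend on $n$) such that the conditional density of $y_i$ given $(X_i,U_i)$ with respect to $\nu$ is $\exp\{\ell(m(U_i,X_i),\cdot)\}$, where $m(U,X)=E(y\mid U,X)$ and $g(m(U,X))=r(X,U):=\sum_{j=1}^{d_n}a_j(U)x_j$. The index variable $U_i$ has support $[0,1]$ and a density $f_U$ not depending on $n$. The functional coefficients $a_j=a_{n,j}$ may depend on $n$, and there is $1\le s_n\le d_n$ with $a_j\equiv0$ for $j>s_n$ (in particular, $s_n$ may be the number of nonzero coefficients). Let $\ell[g^{-1}(s),y]$ be twice differentiable in $s\in\mathbb R$ for $y$ in the range of the response, $q_1(s,y)=\partial_s\,\ell[g^{-1}(s),y]$, $q_2(s,y)=\partial_s^2\,\ell[g^{-1}(s),y]$, $Q_{i1}=q_1[r(X_i,U_i),y_i]$,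 $Q_{i2}=q_2[r(X_i,U_i),y_i]$. Let $K$ be a kernel, $h=h_n>0$ a bandwidth, $K_h(\cdot)=h^{-1}K(\cdot/h)$, and $\lambda_1,\lambda_2>0$ tuning parameters depending on $n$. For $k=1,\dots,n$ let $(\tilde{\mathbf a}_k,\tilde{\mathbf b}_k)$ be a maximiser over $\mathbb R^{d_n}\times\mathbb R^{d_n}$ (any one, if there are several; an arbitrary value, if there is none) of $$\mathcal Q_{nk}(\alpha,\beta)=\frac1n\sum_{i=1}^n\ell\Bigl(g^{-1}\Bigl\{\sum_{j=1}^{d_n}[\alpha_j+\beta_j(U_i-U_k)]x_{ij}\Bigr\},y_i\Bigr)K_h(U_i-U_k)-\lambda_1\sum_{j=1}^{d_n}|\alpha_j|-\lambda_2\sum_{j=1}^{d_n}h|\beta_j| .$$ Put $\mathbf a_{k0}=(a_1(U_k),\dots,a_{d_n}(U_k))^T$ and $\mathbf b_{k0}=(\dot a_1(U_k),\dots,\dot a_{d_n}(U_k))^T$; $\|\cdot\|$ is the Euclidean norm. Write $\alpha_n\propto\beta_n$ if $c_1\beta_n\le\alpha_n\le c_2\beta_n$ for all large $n$ and some constants $0<c_1\le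 c_2<\infty$. All constants below are independent of $n$. **Assumptions.** 1. $K$ is a continuous symmetric probability density with compact support. 2. (a) $E(Q_{i1}\mid X_i,U_i)=0$ a.s., and $E(Q_{i1}^2\mid U_i=u)$ is continuous in $u\in[0,1]$. (b) $q_2(s,y)<0$ for all $s\in\mathbb R$ and all $y$ in the range of the response. (c) With $b=\max\{\lambda_1/\lambda_2,\lambda_2/\lambda_1\}+\delta$ for some $\delta>0$, there are $0<\rho_1\le\rho_2<\infty$ such that, with probability approaching one, $\rho_1\le\mathbf v^T[-\ddot{\mathcal L}_n(u)]\mathbf v\le\rho_2$ for all $u\in[0,1]$ and all $\mathbf v=(v_{11},\dots,v_{1d_n},v_{21},\dots,v_{2d_n})^T$ with $\|\mathbf v\|=1$ and $\sum_{j=1}^{d_n}(|v_{1j}|+|v_{2j}|)\le2(1+b)\sum_{j=1}^{s_n}(|v_{1j}|+|v_{2j}|)$. Here $\ddot{\mathcal L}_n(u)$ is the $2\times2$ block matrix with $(p,q)$ block $\ddot{\mathcal L}_n(u,p+q-2)$, $p,q\in\{1,2\}$, and $\ddot{\mathcal L}_n(u,l)=\frac1n\sum_{i=1}^nQ_{i2}X_iX_i^T\bigl(\frac{U_i-u}{h}\bigr)^lK_h(U_i-u)$.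 3. $f_U$ has a continuous second derivative and is bounded away from zero and infinity on $[0,1]$. 4. Each $a_j$ has a continuous second derivative on $[0,1]$, and $\sup_{n}\max_{j\le d_n}\sup_{u\in[0,1]}|\ddot a_j(u)|<\infty$. *Moment conditions.* $M=M_n(X,U,y)$ denotes some positive function with, almost surely, $|q_2[r(X_i,U_i)+t,y_i]-q_2[r(X_i,U_i),y_i]|\le M(X_i,U_i,y_i)|t|$ for all $t\in\mathbb R$. Set $$A_m=\max_{j}E[|Q_{i1}x_{ij}|^{m}\mid U_i]+\max_{j,k}E[|Q_{i2}x_{ij}x_{ik}|^{m}\mid U_i],\qquad B_m=\max_{j,k,l}E[|x_{ij}x_{ik}x_{il}M(X_i,U_i,y_i)|^{m}\mid U_i].$$ - Polynomial, of order $m_0>2$: for some such $M$ and constant $C<\infty$, $A_{m_0}\le C$ and $B_{m_0}\le C$ a.s. for all $n$. - Bernstein: for some such $M$ and constants $0<M_0,M_1<\infty$, $A_m\le M_0\,m!/2$ and $B_m\le M_1\,m!/2$ a.s. for all integers $m\ge2$ and all $n$. *Tuning condition* $T(\kappa)$: $h\propto n^{-\delta_1}$ for some $0<\delta_1<1$;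 $s_nh^2+\bigl(\frac{\log h^{-1}}{nh}\bigr)^{\kappa}=o(\lambda_1)$; $\lambda_1\propto\lambda_2$; $s_n\lambda_1^2h^{-2}+s_n^2\lambda_1=o(1)$. **Proposition.** Suppose that Assumptions 1–4 hold. Then $$\max_{1\le k\le n}\|\tilde{\mathbf a}_k-\mathbf a_{k0}\|+\max_{1\le k\le n}\|h(\tilde{\mathbf b}_k-\mathbf b_{k0})\|=O_P(\sqrt{s_n}\,\lambda_1)$$ in each of the following two cases. (i) The polynomial moment condition of order $m_0>2$ holds, $d_n\propto n^{\tau_1}$ with $0\le\tau_1<\infty$, $\dfrac{nh}{(nd_n^3)^{2/m_0}\log h^{-1}}\to\infty$, and $T(1/2)$ holds. (ii) The Bernstein moment condition holds, $d_n\propto\exp\{(nh)^{\tau_2}\}$ with $0<\tau_3<1$ and $0\le\tau_2<1-\tau_3$, and $T(\tau_3/2)$ holds. -/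

import Mathlib

open MeasureTheory ProbabilityTheory Filter Topology Set

namespace GSVCM

/-- The individual log-likelihood `ℓ(g⁻¹(s), y)` as a function of the linear predictor `s`. The link
`g` is a bijection from the mean-parameter space `g.source` onto `g.target`, with inverse `g.symm`. -/
noncomputable def logLik (ℓ : ℝ → ℝ → ℝ) (g : PartialEquiv ℝ ℝ) (s y : ℝ) : ℝ := ℓ (g.symm s) y

/-- `q₁(s, y) = ∂ ℓ(g⁻¹(s), y) / ∂ s`. -/
noncomputable def q1 (ℓ : ℝ → ℝ → ℝ) (g : PartialEquiv ℝ ℝ) (s y : ℝ) : ℝ :=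
  deriv (fun t => logLik ℓ g t y) s

/-- `q₂(s, y) = ∂² ℓ(g⁻¹(s), y) / ∂ s²`. -/
noncomputable def q2 (ℓ : ℝ → ℝ → ℝ) (g : PartialEquiv ℝ ℝ) (s y : ℝ) : ℝ :=
  deriv (fun t => q1 ℓ g t y) s

/-- `α ∝ β`: `c₁ β_n ≤ α_n ≤ c₂ β_n` for all large `n`, for some constants `0 < c₁ ≤ c₂ < ∞`. -/
def Propto (α β : ℕ → ℝ) : Prop :=
  ∃ c₁ c₂ : ℝ, 0 < c₁ ∧ c₁ ≤ c₂ ∧ ∀ᶠ n in atTop, c₁ * β n ≤ α n ∧ α n ≤ c₂ * β n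

/-- `T_n = O_P(r_n)`, where `T_n` lives on the `n`-th probability space. -/
def IsBigOP {Ω : ℕ → Type*} [∀ n, MeasurableSpace (Ω n)] (P : ∀ n, Measure (Ω n))
    (T : ∀ n, Ω n → ℝ) (r : ℕ → ℝ) : Prop :=
  ∀ ε : ℝ, 0 < ε → ∃ C : ℝ, 0 < C ∧
    ∀ᶠ n in atTop, P n {ω | C * r n < |T n ω|} ≤ ENNReal.ofReal ε

/-- A sequence of generalised semi-varying coefficient models with, for each `n`, an i.i.d. sample
`(U_i, X_i, y_i)`, `i = 1, …, n`, from the `n`-th model. The log-density function, the link and the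
density of the index variable are fixed; the number of covariates, the functional coefficients and
the law of the covariates may vary with `n`. -/
structure Model {Ω : ℕ → Type*} [∀ n, MeasurableSpace (Ω n)] (P : ∀ n, Measure (Ω n)) where
  /-- the log conditional density `ℓ(m, y)` of the response at mean `m` -/
  ℓ : ℝ → ℝ → ℝ
  /-- the link function -/
  g : PartialEquiv ℝ ℝ
  g_target : g.target = univ
  logLik_measurable : Measurable fun p : ℝ × ℝ => logLik ℓ g p.1 p.2
  /-- the dominating measure for the conditional densities of the response
  (e.g. Lebesgue measure, or a counting measure for a discrete response) -/
  ν : Measure ℝ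
  ν_sigmaFinite : SigmaFinite ν
  /-- the range of the response -/
  yRange : Set ℝ
  /-- the log-likelihood is twice differentiable in the linear predictor,
  so that `q₁` and `q₂` are genuine derivatives -/
  logLik_differentiable : ∀ y ∈ yRange, Differentiable ℝ fun s => logLik ℓ g s y
  q1_differentiable : ∀ y ∈ yRange, Differentiable ℝ fun s => q1 ℓ g s y
  /-- the density of the index variable on `[0, 1]` -/
  fU : ℝ → ℝ
  /-- the number of covariates -/
  d : ℕ → ℕ
  /-- the number of nonzero coefficients; the nonzero ones come first -/
  s : ℕ → ℕ
  s_pos : ∀ n, 1 ≤ s n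
  s_le : ∀ n, s n ≤ d n
  /-- the functional coefficients -/
  a : ∀ n, Fin (d n) → ℝ → ℝ
  a_sparse : ∀ n (j : Fin (d n)), s n ≤ (j : ℕ) → ∀ u ∈ Icc (0 : ℝ) 1, a n j u = 0
  /-- the sample -/
  U : ∀ n, Fin n → Ω n → ℝ
  X : ∀ n, Fin n → Ω n → (Fin (d n) → ℝ)
  Y : ∀ n, Fin n → Ω n → ℝ
  U_measurable : ∀ n i, Measurable (U n i)
  X_measurable : ∀ n i, Measurable (X n i)
  Y_measurable : ∀ n i, Measurable (Y n i)
  indep : ∀ n, iIndepFun (fun i ω => (U n i ω, X n i ω, Y n i ω)) (P n)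
  identDistrib : ∀ n i i', IdentDistrib (fun ω => (U n i ω, X n i ω, Y n i ω))
    (fun ω => (U n i' ω, X n i' ω, Y n i' ω)) (P n) (P n)
  Y_mem : ∀ n i, ∀ᵐ ω ∂(P n), Y n i ω ∈ yRange
  /-- `U_i` has density `fU` on its support `[0, 1]` -/
  U_law : ∀ n i, (P n).map (U n i) =
    (volume.restrict (Icc (0 : ℝ) 1)).withDensity fun u => ENNReal.ofReal (fU u)
  /-- `E(y | U, X) = m(U, X)` with `g(m(U, X)) = ∑ⱼ aⱼ(U) xⱼ` -/
  Y_integrable : ∀ n i, Integrable (Y n i) (P n)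
  Y_mean : ∀ n i,
    (P n)[Y n i | MeasurableSpace.comap (fun ω => (X n i ω, U n i ω)) inferInstance] =ᵐ[P n]
      fun ω => g.symm (∑ j, a n j (U n i ω) * X n i ω j)
  /-- the conditional density of `y` given `(X, U)` with respect to `ν` is `exp ℓ(m(U, X), ·)` -/
  Y_density : ∀ n i, ∀ A : Set ℝ, MeasurableSet A →
    ∀ B : Set ((Fin (d n) → ℝ) × ℝ), MeasurableSet B →
    P n {ω | Y n i ω ∈ A ∧ (X n i ω, U n i ω) ∈ B} =
      ∫⁻ ω in {ω | (X n i ω, U n i ω) ∈ B},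
        (∫⁻ y in A, ENNReal.ofReal
          (Real.exp (ℓ (g.symm (∑ j, a n j (U n i ω) * X n i ω j)) y)) ∂ν) ∂(P n)

namespace Model

variable {Ω : ℕ → Type*} [∀ n, MeasurableSpace (Ω n)] {P : ∀ n, Measure (Ω n)} (S : Model P)

/-- The linear predictor `r(X_i, U_i) = ∑ⱼ aⱼ(U_i) x_{ij}` at the true coefficients. -/
noncomputable def linPred (n : ℕ) (i : Fin n) (ω : Ω n) : ℝ :=
  ∑ j, S.a n j (S.U n i ω) * S.X n i ω j

/-- `Q_{i1}`. -/
noncomputable def Q1 (n : ℕ) (i : Fin n) (ω : Ω n) : ℝ := q1 S.ℓ S.g (S.linPred n i ω) (S.Y n i ω)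

/-- `Q_{i2}`. -/
noncomputable def Q2 (n : ℕ) (i : Fin n) (ω : Ω n) : ℝ := q2 S.ℓ S.g (S.linPred n i ω) (S.Y n i ω)

/-- Conditional expectation given `U_i`. -/
noncomputable def condU (n : ℕ) (i : Fin n) (Z : Ω n → ℝ) : Ω n → ℝ :=
  (P n)[Z | MeasurableSpace.comap (S.U n i) inferInstance]

/-- The true value `(a_1(U_k), …, a_{d_n}(U_k))`. -/
noncomputable def a0 (n : ℕ) (k : Fin n) (ω : Ω n) : EuclideanSpace ℝ (Fin (S.d n)) :=
  WithLp.toLp 2 fun j => S.a n j (S.U n k ω)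

/-- The true value `(ȧ_1(U_k), …, ȧ_{d_n}(U_k))`; derivatives are taken on `[0, 1]`. -/
noncomputable def b0 (n : ℕ) (k : Fin n) (ω : Ω n) : EuclideanSpace ℝ (Fin (S.d n)) :=
  WithLp.toLp 2 fun j => derivWithin (S.a n j) (Icc 0 1) (S.U n k ω)

/-- The local log-likelihood `𝓛_{nk}(α, β)` with kernel `K` and bandwidth `h`. -/
noncomputable def localLogLik (K : ℝ → ℝ) (h : ℝ) (n : ℕ) (k : Fin n) (ω : Ω n)
    (α β : EuclideanSpace ℝ (Fin (S.d n))) : ℝ :=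
  (1 / (n : ℝ)) * ∑ i,
    S.ℓ (S.g.symm (∑ j, (α j + β j * (S.U n i ω - S.U n k ω)) * S.X n i ω j)) (S.Y n i ω) *
      ((1 / h) * K ((S.U n i ω - S.U n k ω) / h))

/-- The LASSO-penalised local log-likelihood `𝓠_{nk}(α, β)`. -/
noncomputable def penLogLik (K : ℝ → ℝ) (h lam1 lam2 : ℝ) (n : ℕ) (k : Fin n) (ω : Ω n)
    (α β : EuclideanSpace ℝ (Fin (S.d n))) : ℝ :=
  S.localLogLik K h n k ω α β - lam1 * ∑ j, |α j| - lam2 * ∑ j, h * |β j|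

/-- `(α, β)` maximises `𝓠_{nk}`. -/
def IsMaximiser (K : ℝ → ℝ) (h lam1 lam2 : ℝ) (n : ℕ) (k : Fin n) (ω : Ω n)
    (α β : EuclideanSpace ℝ (Fin (S.d n))) : Prop :=
  ∀ α' β', S.penLogLik K h lam1 lam2 n k ω α' β' ≤ S.penLogLik K h lam1 lam2 n k ω α β

/-- `(at_k, bt_k)` are preliminary estimators: a maximiser of `𝓠_{nk}` whenever one exists.
Nothing is required of the values where there is no maximiser. -/
def IsPrelimEstimator (K : ℝ → ℝ) (h lam1 lam2 : ℕ → ℝ)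
    (atil btil : ∀ n, Fin n → Ω n → EuclideanSpace ℝ (Fin (S.d n))) : Prop :=
  ∀ n k ω, (∃ α β, S.IsMaximiser K (h n) (lam1 n) (lam2 n) n k ω α β) →
    S.IsMaximiser K (h n) (lam1 n) (lam2 n) n k ω (atil n k ω) (btil n k ω)

/-- The `d_n × d_n` matrix `𝓛̈_n(u, l)`. -/
noncomputable def hessBlock (K : ℝ → ℝ) (h : ℝ) (n : ℕ) (ω : Ω n) (u : ℝ) (l : ℕ) :
    Matrix (Fin (S.d n)) (Fin (S.d n)) ℝ :=
  (1 / (n : ℝ)) • ∑ i,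
    (S.Q2 n i ω * ((S.U n i ω - u) / h) ^ l * ((1 / h) * K ((S.U n i ω - u) / h))) •
      Matrix.vecMulVec (S.X n i ω) (S.X n i ω)

/-- The `2 d_n × 2 d_n` matrix `𝓛̈_n(u)`. -/
noncomputable def hess (K : ℝ → ℝ) (h : ℝ) (n : ℕ) (ω : Ω n) (u : ℝ) :
    Matrix (Fin (S.d n) ⊕ Fin (S.d n)) (Fin (S.d n) ⊕ Fin (S.d n)) ℝ :=
  Matrix.fromBlocks (S.hessBlock K h n ω u 0) (S.hessBlock K h n ω u 1)
    (S.hessBlock K h n ω u 1) (S.hessBlock K h n ω u 2)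

/-- The set `Ω₀(b)` of unit vectors `(v₁, v₂)` in a cone. -/
def cone (n : ℕ) (b : ℝ) : Set (Fin (S.d n) ⊕ Fin (S.d n) → ℝ) :=
  {v | ∑ j, v j ^ 2 = 1 ∧
    ∑ j : Fin (S.d n), (|v (Sum.inl j)| + |v (Sum.inr j)|) ≤
      2 * (1 + b) * ∑ j ∈ Finset.univ.filter (fun j : Fin (S.d n) => (j : ℕ) < S.s n),
        (|v (Sum.inl j)| + |v (Sum.inr j)|)}

/-- The score has conditional mean zero, and `E(Q_{i1}² | U_i = u)` is continuous in `u ∈ [0, 1]`. -/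
def ScoreCondition : Prop :=
  ∀ n i, Integrable (S.Q1 n i) (P n) ∧
    (P n)[S.Q1 n i | MeasurableSpace.comap (fun ω => (S.X n i ω, S.U n i ω)) inferInstance]
      =ᵐ[P n] 0 ∧
    Integrable (fun ω => S.Q1 n i ω ^ 2) (P n) ∧
    ∃ φ : ℝ → ℝ, ContinuousOn φ (Icc 0 1) ∧
      S.condU n i (fun ω => S.Q1 n i ω ^ 2) =ᵐ[P n] fun ω => φ (S.U n i ω)

/-- `q₂(s, y) < 0` for all real `s` and all `y` in the range of the response. -/
def NegCurvature : Prop := ∀ t : ℝ, ∀ y ∈ S.yRange, q2 S.ℓ S.g t y < 0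

/-- `M` is a positive Lipschitz modulus of `q₂(·, y)` at the true linear predictor. -/
def IsLipModulus (M : ∀ n, (Fin (S.d n) → ℝ) × ℝ × ℝ → ℝ) : Prop :=
  ∀ n, Measurable (M n) ∧ (∀ z, 0 < M n z) ∧
    ∀ i, ∀ᵐ ω ∂(P n), ∀ t : ℝ,
      |q2 S.ℓ S.g (S.linPred n i ω + t) (S.Y n i ω) - q2 S.ℓ S.g (S.linPred n i ω) (S.Y n i ω)| ≤
        M n (S.X n i ω, S.U n i ω, S.Y n i ω) * |t|

/-- The `m`-th conditional moments of `Q_{i1} x_{ij}` and of `Q_{i2} x_{ik} x_{il}` given `U_i`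
satisfy `max_j E[·| U_i] + max_{k,l} E[·| U_i] ≤ C` almost surely, for all `n`. -/
def ScoreMomentBound (m C : ℝ) : Prop :=
  ∀ n i (j k l : Fin (S.d n)),
    Integrable (fun ω => |S.Q1 n i ω * S.X n i ω j| ^ m) (P n) ∧
    Integrable (fun ω => |S.Q2 n i ω * S.X n i ω k * S.X n i ω l| ^ m) (P n) ∧
    ∀ᵐ ω ∂(P n),
      S.condU n i (fun ω => |S.Q1 n i ω * S.X n i ω j| ^ m) ω +
        S.condU n i (fun ω => |S.Q2 n i ω * S.X n i ω k * S.X n i ω l| ^ m) ω ≤ C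

/-- The `m`-th conditional moments of `x_{ij} x_{ik} x_{il} M(X_i, U_i, y_i)` given `U_i` are at most
`C` almost surely, for all `j, k, l` and all `n`. -/
def LipMomentBound (M : ∀ n, (Fin (S.d n) → ℝ) × ℝ × ℝ → ℝ) (m C : ℝ) : Prop :=
  ∀ n i (j k l : Fin (S.d n)),
    Integrable (fun ω => |S.X n i ω j * S.X n i ω k * S.X n i ω l *
      M n (S.X n i ω, S.U n i ω, S.Y n i ω)| ^ m) (P n) ∧
    ∀ᵐ ω ∂(P n), S.condU n i (fun ω => |S.X n i ω j * S.X n i ω k * S.X n i ω l *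
      M n (S.X n i ω, S.U n i ω, S.Y n i ω)| ^ m) ω ≤ C

/-- Polynomial moment conditions of order `m₀`. -/
def PolyMoments (m0 : ℝ) : Prop :=
  (∃ C : ℝ, S.ScoreMomentBound m0 C) ∧
  ∃ M, S.IsLipModulus M ∧ ∃ C : ℝ, S.LipMomentBound M m0 C

/-- Bernstein-type moment conditions. -/
def BernsteinMoments : Prop :=
  (∃ M0 : ℝ, 0 < M0 ∧ ∀ m : ℕ, 2 ≤ m → S.ScoreMomentBound m (M0 * m.factorial / 2)) ∧
  ∃ M, S.IsLipModulus M ∧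
    ∃ M1 : ℝ, 0 < M1 ∧ ∀ m : ℕ, 2 ≤ m → S.LipMomentBound M m (M1 * m.factorial / 2)

/-- Restricted eigenvalue condition: with probability approaching one,
`ρ₁ ≤ vᵀ(-𝓛̈_n(u))v ≤ ρ₂` for all `u ∈ [0, 1]` and `v ∈ Ω₀(b)`,
where `b = max(λ₁/λ₂, λ₂/λ₁) + δ`. -/
def RestrictedEigenvalue (K : ℝ → ℝ) (h lam1 lam2 : ℕ → ℝ) : Prop :=
  ∃ ρ₁ ρ₂ δ : ℝ, 0 < ρ₁ ∧ ρ₁ ≤ ρ₂ ∧ 0 < δ ∧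
    Tendsto (fun n => P n {ω | ¬ ∀ u ∈ Icc (0 : ℝ) 1,
      ∀ v ∈ S.cone n (max (lam1 n / lam2 n) (lam2 n / lam1 n) + δ),
        ρ₁ ≤ v ⬝ᵥ (-(S.hess K (h n) n ω u)).mulVec v ∧
          v ⬝ᵥ (-(S.hess K (h n) n ω u)).mulVec v ≤ ρ₂}) atTop (𝓝 0)

/-- The density of the index variable is `C²` and bounded away from zero and infinity on `[0, 1]`. -/
def DensityCondition : Prop :=
  ContDiffOn ℝ 2 S.fU (Icc 0 1) ∧
    ∃ c C : ℝ, 0 < c ∧ ∀ u ∈ Icc (0 : ℝ) 1, c ≤ S.fU u ∧ S.fU u ≤ C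

/-- The functional coefficients are `C²` on `[0, 1]`, with second derivatives bounded uniformly in
`u`, `j` and `n`. -/
def CoefficientCondition : Prop :=
  (∀ n j, ContDiffOn ℝ 2 (S.a n j) (Icc 0 1)) ∧
    ∃ C : ℝ, ∀ n j, ∀ u ∈ Icc (0 : ℝ) 1, |iteratedDerivWithin 2 (S.a n j) (Icc 0 1) u| ≤ C

/-- Bandwidth and tuning parameters: `h ∝ n^{-δ₁}` with `0 < δ₁ < 1`,
`s h² + (log h⁻¹ / (nh))^κ = o(λ₁)`, `λ₁ ∝ λ₂` and `s λ₁² h⁻² + s² λ₁ = o(1)`. -/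
def TuningCondition (h lam1 lam2 : ℕ → ℝ) (κ : ℝ) : Prop :=
  (∃ δ₁ : ℝ, 0 < δ₁ ∧ δ₁ < 1 ∧ Propto h fun n => (n : ℝ) ^ (-δ₁)) ∧
  (fun n => (S.s n : ℝ) * h n ^ 2 + (Real.log (h n)⁻¹ / (n * h n)) ^ κ) =o[atTop] lam1 ∧
  Propto lam1 lam2 ∧
  Tendsto (fun n => (S.s n : ℝ) * lam1 n ^ 2 * (h n ^ 2)⁻¹ + (S.s n : ℝ) ^ 2 * lam1 n)
    atTop (𝓝 0)

/-- Rate conditions when the number of covariates is of polynomial order `n^{τ₁}`. -/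
def PolyRegime (h lam1 lam2 : ℕ → ℝ) (m0 τ₁ : ℝ) : Prop :=
  Propto (fun n => (S.d n : ℝ)) (fun n => (n : ℝ) ^ τ₁) ∧
  Tendsto (fun n => (n * h n) / (((n : ℝ) * (S.d n : ℝ) ^ 3) ^ (2 / m0) * Real.log (h n)⁻¹))
    atTop atTop ∧
  S.TuningCondition h lam1 lam2 (1 / 2)

/-- Rate conditions when the number of covariates is of exponential order `exp((nh)^{τ₂})`. -/
def ExpRegime (h lam1 lam2 : ℕ → ℝ) (τ₂ τ₃ : ℝ) : Prop :=
  Propto (fun n => (S.d n : ℝ)) (fun n => Real.exp ((n * h n) ^ τ₂)) ∧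
  S.TuningCondition h lam1 lam2 (τ₃ / 2)

/-- `max_k ‖ã_k - a_{k0}‖ + max_k ‖h (b̃_k - b_{k0})‖`. -/
noncomputable def maxError (h : ℕ → ℝ)
    (atil btil : ∀ n, Fin n → Ω n → EuclideanSpace ℝ (Fin (S.d n))) (n : ℕ) (ω : Ω n) : ℝ :=
  (⨆ k : Fin n, ‖atil n k ω - S.a0 n k ω‖) + ⨆ k : Fin n, ‖h n • (btil n k ω - S.b0 n k ω)‖

end Model

/-- `K` is a continuous symmetric probability density with compact support. -/
def IsKernel (K : ℝ → ℝ) : Prop :=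
  Continuous K ∧ (∀ x, K (-x) = K x) ∧ (∀ x, 0 ≤ K x) ∧ ∫ x, K x = 1 ∧ HasCompactSupport K

end GSVCM

/-! Fix a localisation point `U_k` and rescale to θ = (α − a_{k0}, h(β − b_{k0})). The criterion
becomes a concave weighted likelihood minus an ℓ¹ penalty, and its maximisers must be shown to lie
in a ball of radius R of order √s λ₁. By concavity it is enough that the criterion is smaller
everywhere on the sphere of radius R than at its centre; this also yields a maximiser
(`exists_maximiser_of_concave`).

On the sphere (`penalised_lt_center`) there are two cases, given that the gradient at the centre is
at most half the smaller tuning parameter. Outside the cone of vectors dominated by their active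
coordinates, the penalty outweighs the linear gain. Inside it, the restricted eigenvalue condition
supplies curvature −ρR²/2 and ‖θ‖₁ is at most a multiple of √s R. The linear and penalty terms are
then O(√s λ₁ R) and lose once R is a large multiple of √s λ₁. The Taylor remainder, relative to R²,
is of order s²λ₁ and vanishes. The gradient consists of a kernel mean of scores plus a local linear
bias of order s h² = o(λ₁).

What remains is probabilistic: uniformly in `k` and the coordinates, kernel means of the scores must
be O(t) for some t = o(λ₁), and those of |Q₂xx| and |xxxM| bounded. The means are centred at the
random point `U_k`, so `lintegral_prod_distinguished_le` integrates out the other observations with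
the `k`-th one held fixed. Conditional moments given `U` and the bounded density control each
factor's moment generating function, and Chernoff with a union bound over at most n d³ events
finishes (`kernel_sum_tail`, `IsKernelArray.tendsto_measure_kernelMean`). Bernstein moments give
conditional exponential moments directly, and nh·t² ≥ (nh)^{1−τ₃} beats log d. Polynomial moments
are handled by truncation at 1/ρ with ρ² = log h⁻¹/(nh); the rate condition says that n d³ ρ^m tends
to zero. -/

namespace GSVCM

/-! ### Taylor expansions in one variable -/

/-- Rolle's theorem twice, with `c` chosen so that the auxiliary function agrees at 0 and 1.
Continuity of the second derivative is not needed, and bounding |ξ − s| by |δ| covers both signs of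
δ at once. -/
theorem exists_taylor_second {f : ℝ → ℝ} (hf : Differentiable ℝ f)
    (hf' : Differentiable ℝ (deriv f)) (s δ : ℝ) :
    ∃ ξ, |ξ - s| ≤ |δ| ∧ f (s + δ) = f s + deriv f s * δ + deriv (deriv f) ξ * δ ^ 2 / 2 := by
  rcases eq_or_ne δ 0 with rfl | hδ
  · exact ⟨s, by simp, by simp⟩
  set c : ℝ := (f (s + δ) - f s - deriv f s * δ) / δ ^ 2 with hc
  -- Rolle for `F t = f (s + tδ) - f s - f'(s) t δ - c t² δ²` and then for `F'`.
  let F : ℝ → ℝ := fun t => f (s + t * δ) - deriv f s * (t * δ) - c * (t * δ) ^ 2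
  let F' : ℝ → ℝ := fun t => deriv f (s + t * δ) * δ - deriv f s * δ - c * (2 * t * δ ^ 2)
  have hin : ∀ t, HasDerivAt (fun t : ℝ => s + t * δ) δ t := fun t => by
    simpa using ((hasDerivAt_id t).mul_const δ).const_add s
  have hF : ∀ t, HasDerivAt F (F' t) t := fun t => by
    have h1 := (hf (s + t * δ)).hasDerivAt.comp t (hin t)
    have h2 : HasDerivAt (fun t : ℝ => deriv f s * (t * δ)) (deriv f s * δ) t := by
      simpa using ((hasDerivAt_id t).mul_const δ).const_mul (deriv f s)
    have h3 : HasDerivAt (fun t : ℝ => c * (t * δ) ^ 2) (c * (2 * t * δ ^ 2)) t := by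
      have := ((((hasDerivAt_id t).mul_const δ).pow 2).const_mul c)
      refine this.congr_deriv ?_
      simp; left; ring
    exact (h1.sub h2).sub h3
  have hF2 : ∀ t, HasDerivAt F' (deriv (deriv f) (s + t * δ) * δ * δ - c * (2 * δ ^ 2)) t :=
    fun t => by
    have h1 := ((hf' (s + t * δ)).hasDerivAt.comp t (hin t)).mul_const δ
    have h3 : HasDerivAt (fun t : ℝ => c * (2 * t * δ ^ 2)) (c * (2 * δ ^ 2)) t := by
      have := ((((hasDerivAt_id t).const_mul 2).mul_const (δ ^ 2)).const_mul c)
      simpa using this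
    exact (h1.sub_const (deriv f s * δ)).sub h3
  have hF01 : F 0 = F 1 := by
    simp only [F, hc]; field_simp; simp
  obtain ⟨t₁, ht₁, h1⟩ := exists_hasDerivAt_eq_zero (f := F) (f' := F') zero_lt_one
    (fun t _ => (hF t).continuousAt.continuousWithinAt) hF01 (fun t _ => hF t)
  have hF'0 : F' 0 = 0 := by simp [F']
  obtain ⟨t₂, ht₂, h2⟩ := exists_hasDerivAt_eq_zero (f := F') ht₁.1
    (fun t _ => (hF2 t).continuousAt.continuousWithinAt) (hF'0.trans h1.symm) (fun t _ => hF2 t)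
  refine ⟨s + t₂ * δ, ?_, ?_⟩
  · have : |t₂| ≤ 1 := by rw [abs_le]; constructor <;> linarith [ht₂.1, ht₂.2, ht₁.2]
    simpa [abs_mul] using mul_le_mul_of_nonneg_right this (abs_nonneg δ)
  · have hδ2 : δ ^ 2 ≠ 0 := pow_ne_zero 2 hδ
    have h3 : deriv (deriv f) (s + t₂ * δ) = 2 * c := by
      have : (deriv (deriv f) (s + t₂ * δ) - 2 * c) * δ ^ 2 = 0 := by linarith
      rcases mul_eq_zero.1 this with h | h
      · linarith
      · exact absurd h hδ2
    rw [h3, hc]; field_simp; ring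

theorem exists_mvt {f : ℝ → ℝ} (hf : Differentiable ℝ f) (s t : ℝ) :
    ∃ ξ, |ξ - s| ≤ |t - s| ∧ f t - f s = deriv f ξ * (t - s) := by
  rcases lt_trichotomy s t with h | rfl | h
  · obtain ⟨c, hc, e⟩ := exists_deriv_eq_slope f h hf.continuous.continuousOn hf.differentiableOn
    refine ⟨c, ?_, ?_⟩
    · rw [abs_of_pos (by linarith [hc.1]), abs_of_pos (by linarith)]; linarith [hc.2]
    · rw [e]; field_simp [(sub_pos.2 h).ne']
  · exact ⟨s, by simp, by simp⟩
  · obtain ⟨c, hc, e⟩ := exists_deriv_eq_slope f h hf.continuous.continuousOn hf.differentiableOn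
    refine ⟨c, ?_, ?_⟩
    · rw [abs_of_neg (by linarith [hc.2]), abs_of_neg (by linarith)]; linarith [hc.1]
    · rw [e]; have := (sub_pos.2 h).ne'; field_simp; ring

/-- A `C²` function on `[0, 1]` deviates from its tangent quadratically. -/
theorem abs_sub_tangent_le {f : ℝ → ℝ} {C : ℝ} (hf : ContDiffOn ℝ 2 f (Icc 0 1))
    (hC : ∀ u ∈ Icc (0 : ℝ) 1, |iteratedDerivWithin 2 f (Icc 0 1) u| ≤ C)
    {u v : ℝ} (hu : u ∈ Icc (0 : ℝ) 1) (hv : v ∈ Icc (0 : ℝ) 1) :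
    |f v - (f u + derivWithin f (Icc 0 1) u * (v - u))| ≤ C * (v - u) ^ 2 := by
  have hU : UniqueDiffOn ℝ (Icc (0 : ℝ) 1) := uniqueDiffOn_Icc zero_lt_one
  have hd : ∀ x ∈ Icc (0 : ℝ) 1, HasDerivWithinAt f (derivWithin f (Icc 0 1) x) (Icc 0 1) x :=
    fun x hx => ((hf.differentiableOn two_ne_zero) x hx).hasDerivWithinAt
  have hdd : ∀ x ∈ Icc (0 : ℝ) 1, HasDerivWithinAt (derivWithin f (Icc 0 1))
      (iteratedDerivWithin 2 f (Icc 0 1) x) (Icc 0 1) x := fun x hx => by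
    have h1 : ContDiffOn ℝ 1 (derivWithin f (Icc 0 1)) (Icc 0 1) := hf.derivWithin hU (by norm_num)
    have h2 := ((h1.differentiableOn one_ne_zero) x hx).hasDerivWithinAt
    have h3 : iteratedDerivWithin 2 f (Icc 0 1) x =
        derivWithin (derivWithin f (Icc 0 1)) (Icc 0 1) x := by
      rw [show (2 : ℕ) = 1 + 1 from rfl, iteratedDerivWithin_succ]
      refine derivWithin_congr ?_ ?_
      · intro y _; exact congrFun iteratedDerivWithin_one y
      · exact congrFun iteratedDerivWithin_one x
    rwa [h3]
  have hC0 : 0 ≤ C := (abs_nonneg _).trans (hC u hu)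
  have hsub : uIcc u v ⊆ Icc (0 : ℝ) 1 := uIcc_subset_Icc hu hv
  -- The mean value inequality is used twice: first for the derivative, then for `f` minus its
  -- tangent, whose derivative is now at most C|v − u| on the whole segment.
  have hlip : ∀ x ∈ uIcc u v,
      ‖derivWithin f (Icc 0 1) x - derivWithin f (Icc 0 1) u‖ ≤ C * |v - u| := fun x hx => by
    have h1 := Convex.norm_image_sub_le_of_norm_hasDerivWithin_le hdd hC (convex_Icc 0 1) hu
      (hsub hx)
    refine h1.trans (mul_le_mul_of_nonneg_left ?_ hC0)
    exact abs_sub_left_of_mem_uIcc hx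
  have h2 : ∀ x ∈ uIcc u v, HasDerivWithinAt (fun y => f y - derivWithin f (Icc 0 1) u * y)
      (derivWithin f (Icc 0 1) x - derivWithin f (Icc 0 1) u) (uIcc u v) x := fun x hx => by
    have := ((hasDerivWithinAt_id x (uIcc u v)).const_mul (derivWithin f (Icc 0 1) u))
    rw [mul_one] at this
    exact ((hd x (hsub hx)).mono hsub).sub this
  have h3 := Convex.norm_image_sub_le_of_norm_hasDerivWithin_le h2 hlip (convex_uIcc u v)
    left_mem_uIcc right_mem_uIcc
  rw [Real.norm_eq_abs, Real.norm_eq_abs] at h3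
  calc _ = |f v - derivWithin f (Icc 0 1) u * v - (f u - derivWithin f (Icc 0 1) u * u)| := by
        congr 1; ring
    _ ≤ _ := h3
    _ = _ := by rw [mul_assoc, ← sq, sq_abs]

/-! ### Deterministic bounds for a weighted concave likelihood -/

section Lasso

variable {I J : Type*} [Fintype I] [Fintype J]

/-- Concave local likelihood with design vectors `z i`, base predictors `rb i` and weights `w i`. -/
noncomputable def wLik (w : I → ℝ) (φ : I → ℝ → ℝ) (rb : I → ℝ) (z : I → J → ℝ) (θ : J → ℝ) : ℝ :=
  ∑ i, w i * φ i (rb i + ∑ p, θ p * z i p)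

theorem abs_sum_mul_le (θ x : J → ℝ) : |∑ p, θ p * x p| ≤ ∑ p, |θ p| * |x p| := by
  refine (Finset.abs_sum_le_sum_abs _ _).trans (le_of_eq ?_)
  simp [abs_mul]

/-- Exchanging the sums turns coordinatewise bounds on design moments into ℓ¹ bounds in the
coefficients. The quadratic and cubic versions follow by absorbing one linear factor at a time into
the weight. -/
theorem sum_weight_linear_le {ζ : J → ℝ} {w : I → ℝ} {z : I → J → ℝ} {C : ℝ}
    (hζ : ∀ p, 0 ≤ ζ p) (h : ∀ p, ∑ i, w i * |z i p| ≤ C) :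
    ∑ i, w i * ∑ p, ζ p * |z i p| ≤ C * ∑ p, ζ p := by
  calc ∑ i, w i * ∑ p, ζ p * |z i p| = ∑ p, ζ p * ∑ i, w i * |z i p| := by
        simp only [Finset.mul_sum]; rw [Finset.sum_comm]
        exact Finset.sum_congr rfl fun _ _ => Finset.sum_congr rfl fun _ _ => by ring
    _ ≤ ∑ p, ζ p * C := Finset.sum_le_sum fun p _ => mul_le_mul_of_nonneg_left (h p) (hζ p)
    _ = _ := by rw [← Finset.sum_mul, mul_comm]

theorem sum_weight_quadratic_le {ζ₁ ζ₂ : J → ℝ} {w : I → ℝ} {z : I → J → ℝ} {C : ℝ}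
    (h₁ : ∀ p, 0 ≤ ζ₁ p) (h₂ : ∀ p, 0 ≤ ζ₂ p) (h : ∀ p q, ∑ i, w i * |z i p| * |z i q| ≤ C) :
    ∑ i, w i * (∑ p, ζ₁ p * |z i p|) * (∑ p, ζ₂ p * |z i p|) ≤ C * (∑ p, ζ₁ p) * ∑ p, ζ₂ p := by
  refine sum_weight_linear_le (w := fun i => w i * ∑ p, ζ₁ p * |z i p|) h₂ fun q => ?_
  have := sum_weight_linear_le (w := fun i => w i * |z i q|) (z := z) (C := C) h₁ fun p => by
    refine le_trans (le_of_eq ?_) (h p q); exact Finset.sum_congr rfl fun _ _ => by ring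
  refine le_trans (le_of_eq ?_) this
  exact Finset.sum_congr rfl fun _ _ => by ring

theorem sum_weight_cubic_le {ζ₁ ζ₂ ζ₃ : J → ℝ} {w : I → ℝ} {z : I → J → ℝ} {C : ℝ}
    (h₁ : ∀ p, 0 ≤ ζ₁ p) (h₂ : ∀ p, 0 ≤ ζ₂ p) (h₃ : ∀ p, 0 ≤ ζ₃ p)
    (h : ∀ p q r, ∑ i, w i * |z i p| * |z i q| * |z i r| ≤ C) :
    ∑ i, w i * (∑ p, ζ₁ p * |z i p|) * (∑ p, ζ₂ p * |z i p|) * (∑ p, ζ₃ p * |z i p|) ≤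
      C * (∑ p, ζ₁ p) * (∑ p, ζ₂ p) * ∑ p, ζ₃ p := by
  refine sum_weight_linear_le
    (w := fun i => w i * (∑ p, ζ₁ p * |z i p|) * ∑ p, ζ₂ p * |z i p|) h₃ fun q => ?_
  have := sum_weight_quadratic_le (w := fun i => w i * |z i q|) (z := z) (C := C) h₁ h₂
    fun p r => by
      refine le_trans (le_of_eq ?_) (h p r q); exact Finset.sum_congr rfl fun _ _ => by ring
  refine le_trans (le_of_eq ?_) this
  exact Finset.sum_congr rfl fun _ _ => by ring

variable {w : I → ℝ} {φ : I → ℝ → ℝ} {rb r : I → ℝ} {z : I → J → ℝ} {m : I → ℝ} {η : J → ℝ}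

/-- The gradient at the base predictors is the score plus a bias of the size of `η`. -/
theorem abs_gradient_le {g C₂ C₃ : ℝ} (hw : ∀ i, 0 ≤ w i)
    (hφ' : ∀ i, Differentiable ℝ (deriv (φ i)))
    (hm0 : ∀ i, 0 ≤ m i)
    (hm : ∀ i t, |deriv (deriv (φ i)) (r i + t) - deriv (deriv (φ i)) (r i)| ≤ m i * |t|)
    (hη0 : ∀ p, 0 ≤ η p) (hη : ∀ i, w i ≠ 0 → |rb i - r i| ≤ ∑ p, η p * |z i p|)
    (hscore : ∀ p, |∑ i, w i * deriv (φ i) (r i) * z i p| ≤ g)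
    (hC₂ : ∀ p q, ∑ i, w i * |deriv (deriv (φ i)) (r i)| * |z i p| * |z i q| ≤ C₂)
    (hC₃ : ∀ p q l, ∑ i, w i * m i * |z i p| * |z i q| * |z i l| ≤ C₃) (q : J) :
    |∑ i, w i * deriv (φ i) (rb i) * z i q| ≤
      g + C₂ * ∑ p, η p + C₃ * (∑ p, η p) * ∑ p, η p := by
  -- Mean value theorem for the first derivative between the true and the base predictor; the
  -- curvature in between differs from the true one by at most m·E. Terms of weight zero are split
  -- off because the bias bound is assumed only where the weight is nonzero.
  have key : ∀ i, |w i * deriv (φ i) (rb i) * z i q - w i * deriv (φ i) (r i) * z i q| ≤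
      (w i * |deriv (deriv (φ i)) (r i)| * |z i q|) * (∑ p, η p * |z i p|) +
      (w i * m i * |z i q|) * (∑ p, η p * |z i p|) * (∑ p, η p * |z i p|) := fun i => by
    rcases eq_or_ne (w i) 0 with h0 | h0
    · simp [h0]
    obtain ⟨ξ, hξ, e⟩ := exists_mvt (hφ' i) (r i) (rb i)
    have hb := hη i h0
    set E := ∑ p, η p * |z i p|
    have h1 : |deriv (deriv (φ i)) ξ| ≤ |deriv (deriv (φ i)) (r i)| + m i * E := by
      have h2 := hm i (ξ - r i)
      rw [add_sub_cancel] at h2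
      have h3 : m i * |ξ - r i| ≤ m i * E := mul_le_mul_of_nonneg_left (hξ.trans hb) (hm0 i)
      have h4 := abs_sub_abs_le_abs_sub (deriv (deriv (φ i)) ξ) (deriv (deriv (φ i)) (r i))
      linarith
    have h5 : |deriv (φ i) (rb i) - deriv (φ i) (r i)| ≤
        (|deriv (deriv (φ i)) (r i)| + m i * E) * E := by
      rw [e, abs_mul]
      exact mul_le_mul h1 hb (abs_nonneg _) ((abs_nonneg _).trans h1)
    rw [← sub_mul, ← mul_sub, abs_mul, abs_mul, abs_of_nonneg (hw i)]
    calc _ ≤ w i * ((|deriv (deriv (φ i)) (r i)| + m i * E) * E) * |z i q| :=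
          mul_le_mul_of_nonneg_right (mul_le_mul_of_nonneg_left h5 (hw i)) (abs_nonneg _)
      _ = _ := by ring
  have h1 : |∑ i, w i * deriv (φ i) (rb i) * z i q - ∑ i, w i * deriv (φ i) (r i) * z i q| ≤
      C₂ * ∑ p, η p + C₃ * (∑ p, η p) * ∑ p, η p := by
    rw [← Finset.sum_sub_distrib]
    refine (Finset.abs_sum_le_sum_abs _ _).trans ((Finset.sum_le_sum fun i _ => key i).trans ?_)
    rw [Finset.sum_add_distrib]
    refine add_le_add (sum_weight_linear_le hη0 fun p => hC₂ q p)
      (sum_weight_quadratic_le hη0 hη0 fun p l => hC₃ q p l)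
  have h2 := abs_sub_abs_le_abs_sub (∑ i, w i * deriv (φ i) (rb i) * z i q)
    (∑ i, w i * deriv (φ i) (r i) * z i q)
  linarith [hscore q]

theorem sum_gradient_le {G : ℝ} {θ : J → ℝ}
    (hG : ∀ q, |∑ i, w i * deriv (φ i) (rb i) * z i q| ≤ G) :
    ∑ i, w i * (deriv (φ i) (rb i) * ∑ p, θ p * z i p) ≤ G * ∑ p, |θ p| := by
  calc _ = ∑ p, θ p * ∑ i, w i * deriv (φ i) (rb i) * z i p := by
        simp only [Finset.mul_sum]; rw [Finset.sum_comm]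
        exact Finset.sum_congr rfl fun _ _ => Finset.sum_congr rfl fun _ _ => by ring
    _ ≤ ∑ p, |θ p| * G := Finset.sum_le_sum fun p _ => by
        refine (le_abs_self _).trans ?_
        rw [abs_mul]; exact mul_le_mul_of_nonneg_left (hG p) (abs_nonneg _)
    _ = _ := by rw [← Finset.sum_mul, mul_comm]

/-- By concavity the second-order Taylor term is nonpositive and can be dropped. This serves the
directions outside the cone, where no curvature is available. -/
theorem wLik_sub_le_gradient {G : ℝ} {θ : J → ℝ} (hw : ∀ i, 0 ≤ w i)
    (hφ : ∀ i, Differentiable ℝ (φ i)) (hφ' : ∀ i, Differentiable ℝ (deriv (φ i)))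
    (hneg : ∀ i t, deriv (deriv (φ i)) t ≤ 0)
    (hG : ∀ q, |∑ i, w i * deriv (φ i) (rb i) * z i q| ≤ G) :
    wLik w φ rb z θ - wLik w φ rb z 0 ≤ G * ∑ p, |θ p| := by
  refine le_trans ?_ (sum_gradient_le (θ := θ) hG)
  unfold wLik
  rw [← Finset.sum_sub_distrib]
  refine Finset.sum_le_sum fun i _ => ?_
  obtain ⟨ξ, -, e⟩ := exists_taylor_second (hφ i) (hφ' i) (rb i) (∑ p, θ p * z i p)
  rw [← mul_sub]
  refine mul_le_mul_of_nonneg_left ?_ (hw i)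
  simp only [Pi.zero_apply, zero_mul, Finset.sum_const_zero, add_zero]
  rw [e]
  nlinarith [mul_nonneg (neg_nonneg.2 (hneg i ξ)) (sq_nonneg (∑ p, θ p * z i p))]

/-- A second-order expansion at the base predictor `rb`, with the curvature transferred to the true
predictor `r`, where the Hessian is controlled. The intermediate point is within E + A of `r`, so
the Lipschitz modulus of the second derivative costs a cubic term. -/
theorem wLik_sub_le_quadratic {G ρ C₃ : ℝ} {θ : J → ℝ} (hw : ∀ i, 0 ≤ w i)
    (hφ : ∀ i, Differentiable ℝ (φ i)) (hφ' : ∀ i, Differentiable ℝ (deriv (φ i)))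
    (hm0 : ∀ i, 0 ≤ m i)
    (hm : ∀ i t, |deriv (deriv (φ i)) (r i + t) - deriv (deriv (φ i)) (r i)| ≤ m i * |t|)
    (hη0 : ∀ p, 0 ≤ η p) (hη : ∀ i, w i ≠ 0 → |rb i - r i| ≤ ∑ p, η p * |z i p|)
    (hC₃ : ∀ p q l, ∑ i, w i * m i * |z i p| * |z i q| * |z i l| ≤ C₃)
    (hG : ∀ q, |∑ i, w i * deriv (φ i) (rb i) * z i q| ≤ G)
    (hquad : ∑ i, w i * (deriv (deriv (φ i)) (r i) * (∑ p, θ p * z i p) ^ 2) ≤ -ρ) :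
    wLik w φ rb z θ - wLik w φ rb z 0 ≤ G * ∑ p, |θ p| +
      (-ρ + C₃ * (∑ p, η p + ∑ p, |θ p|) * (∑ p, |θ p|) * ∑ p, |θ p|) / 2 := by
  have key : ∀ i, w i * φ i (rb i + ∑ p, θ p * z i p) -
      w i * φ i (rb i + ∑ p, (0 : J → ℝ) p * z i p) ≤
      w i * (deriv (φ i) (rb i) * ∑ p, θ p * z i p) +
      (w i * (deriv (deriv (φ i)) (r i) * (∑ p, θ p * z i p) ^ 2) +
        (w i * m i) * (∑ p, (η p + |θ p|) * |z i p|) * (∑ p, |θ p| * |z i p|) *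
          (∑ p, |θ p| * |z i p|)) / 2 := fun i => by
    rcases eq_or_ne (w i) 0 with h0 | h0
    · simp [h0]
    obtain ⟨ξ, hξ, e⟩ := exists_taylor_second (hφ i) (hφ' i) (rb i) (∑ p, θ p * z i p)
    simp only [Pi.zero_apply, zero_mul, Finset.sum_const_zero, add_zero]
    have hb := hη i h0
    have ht := abs_sum_mul_le θ (z i)
    set T := ∑ p, θ p * z i p
    have hsplit : ∑ p, (η p + |θ p|) * |z i p| = ∑ p, η p * |z i p| + ∑ p, |θ p| * |z i p| := by
      simp [add_mul, Finset.sum_add_distrib]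
    rw [hsplit]
    set E := ∑ p, η p * |z i p|
    set A := ∑ p, |θ p| * |z i p|
    have hA : 0 ≤ A := (abs_nonneg _).trans ht
    have h1 : deriv (deriv (φ i)) ξ ≤ deriv (deriv (φ i)) (r i) + m i * (E + A) := by
      have h2 := hm i (ξ - r i)
      rw [add_sub_cancel] at h2
      have h3 : |ξ - r i| ≤ E + A := by
        have := abs_sub_le ξ (rb i) (r i); linarith
      have h4 := mul_le_mul_of_nonneg_left h3 (hm0 i)
      linarith [le_abs_self (deriv (deriv (φ i)) ξ - deriv (deriv (φ i)) (r i))]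
    have hT : T ^ 2 ≤ A * A := by rw [← sq_abs, sq]; exact mul_self_le_mul_self (abs_nonneg _) ht
    have hE : 0 ≤ E := (abs_nonneg _).trans hb
    have h6 : deriv (deriv (φ i)) ξ * T ^ 2 ≤
        deriv (deriv (φ i)) (r i) * T ^ 2 + m i * (E + A) * (A * A) := by
      have h7 := mul_le_mul_of_nonneg_right h1 (sq_nonneg T)
      have h8 := mul_le_mul_of_nonneg_left hT (mul_nonneg (hm0 i) (add_nonneg hE hA))
      linarith
    rw [← mul_sub, e]
    have h9 := mul_le_mul_of_nonneg_left h6 (hw i)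
    nlinarith [h9]
  unfold wLik
  rw [← Finset.sum_sub_distrib]
  refine (Finset.sum_le_sum fun i _ => key i).trans ?_
  rw [Finset.sum_add_distrib, ← Finset.sum_div, Finset.sum_add_distrib]
  have h1 := sum_gradient_le (θ := θ) hG
  have h2 := sum_weight_cubic_le (ζ₁ := fun p => η p + |θ p|) (ζ₂ := fun p => |θ p|)
    (ζ₃ := fun p => |θ p|) (fun p => add_nonneg (hη0 p) (abs_nonneg _)) (fun p => abs_nonneg _)
    (fun p => abs_nonneg _) hC₃
  rw [Finset.sum_add_distrib] at h2
  linarith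

end Lasso

/-! ### The penalty, the cone and the location of maximisers -/

section Lasso

variable {I J : Type*} [Fintype I] [Fintype J]

/-- On `T` the triangle inequality loses at most Λ|θ|; off `T` the centre vanishes, so the penalty
rises by the full Λ|θ|. The extra `l₁` on `T` compensates for subtracting `l₁` times the whole ℓ¹
norm. -/
theorem sum_penalty_diff_le {Λ β θ : J → ℝ} {T : Finset J} {l₁ l₂ : ℝ}
    (hΛ₀ : 0 ≤ l₁) (hΛ₁ : ∀ p, l₁ ≤ Λ p) (hΛ₂ : ∀ p, Λ p ≤ l₂) (hβ : ∀ p, p ∉ T → β p = 0) :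
    ∑ p, Λ p * |β p| - ∑ p, Λ p * |β p + θ p| ≤
      (l₁ + l₂) * ∑ p ∈ T, |θ p| - l₁ * ∑ p, |θ p| := by
  classical
  have h : ∀ p, Λ p * |β p| - Λ p * |β p + θ p| ≤
      (if p ∈ T then (l₁ + l₂) * |θ p| else 0) - l₁ * |θ p| := fun p => by
    by_cases hp : p ∈ T
    · simp only [hp, if_true]
      have h1 : |β p| - |β p + θ p| ≤ |θ p| := by
        have := abs_sub_abs_le_abs_sub (β p) (β p + θ p); simpa using this
      have h2 := mul_le_mul_of_nonneg_left h1 (hΛ₀.trans (hΛ₁ p))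
      have h3 := mul_le_mul_of_nonneg_right (hΛ₂ p) (abs_nonneg (θ p))
      linarith
    · simp only [hp, if_false, hβ p hp, abs_zero, zero_add, mul_zero]
      have h3 := mul_le_mul_of_nonneg_right (hΛ₁ p) (abs_nonneg (θ p))
      linarith
  rw [← Finset.sum_sub_distrib]
  refine (Finset.sum_le_sum fun p _ => h p).trans (le_of_eq ?_)
  rw [Finset.sum_sub_distrib, ← Finset.mul_sum, Finset.sum_ite_mem, Finset.univ_inter,
    Finset.mul_sum, Finset.mul_sum]

theorem sum_abs_le_sqrt_card_mul {θ : J → ℝ} {T : Finset J} {R : ℝ} (hR : 0 ≤ R)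
    (hθ : ∑ p, θ p ^ 2 = R ^ 2) : ∑ p ∈ T, |θ p| ≤ √(T.card) * R := by
  rw [← Real.sqrt_sq hR, ← Real.sqrt_mul (Nat.cast_nonneg _)]
  refine Real.le_sqrt_of_sq_le ?_
  refine (sq_sum_le_card_mul_sum_sq).trans ?_
  refine mul_le_mul_of_nonneg_left ?_ (Nat.cast_nonneg _)
  rw [← hθ]
  simp only [sq_abs]
  exact Finset.sum_le_sum_of_subset_of_nonneg (Finset.subset_univ _) fun _ _ _ => sq_nonneg _

/-- On a sphere of radius `R`, the penalised likelihood is smaller than at the centre. -/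
theorem penalised_lt_center {w : I → ℝ} {φ : I → ℝ → ℝ} {rb r : I → ℝ} {z : I → J → ℝ}
    {m : I → ℝ} {η : J → ℝ} {Λ β θ : J → ℝ} {T : Finset J} {l₁ l₂ b G ρ C₃ R : ℝ}
    (hw : ∀ i, 0 ≤ w i)
    (hφ : ∀ i, Differentiable ℝ (φ i)) (hφ' : ∀ i, Differentiable ℝ (deriv (φ i)))
    (hneg : ∀ i t, deriv (deriv (φ i)) t ≤ 0)
    (hm0 : ∀ i, 0 ≤ m i)
    (hm : ∀ i t, |deriv (deriv (φ i)) (r i + t) - deriv (deriv (φ i)) (r i)| ≤ m i * |t|)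
    (hη0 : ∀ p, 0 ≤ η p) (hη : ∀ i, w i ≠ 0 → |rb i - r i| ≤ ∑ p, η p * |z i p|)
    (hC₃0 : 0 ≤ C₃)
    (hC₃ : ∀ p q l, ∑ i, w i * m i * |z i p| * |z i q| * |z i l| ≤ C₃)
    (hG : ∀ q, |∑ i, w i * deriv (φ i) (rb i) * z i q| ≤ G)
    (hl₁ : 0 < l₁) (hΛ₁ : ∀ p, l₁ ≤ Λ p) (hΛ₂ : ∀ p, Λ p ≤ l₂) (hb : 0 ≤ b) (hl₂ : l₂ ≤ b * l₁)
    (hβ : ∀ p, p ∉ T → β p = 0)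
    (hGl : G ≤ l₁ / 2) (hR : 0 < R) (hθ : ∑ p, θ p ^ 2 = R ^ 2)
    (hcone : ∑ p, |θ p| ≤ 2 * (1 + b) * ∑ p ∈ T, |θ p| →
      ∑ i, w i * (deriv (deriv (φ i)) (r i) * (∑ p, θ p * z i p) ^ 2) ≤ -(ρ * R ^ 2))
    (hRl : (1 + 2 * b) * l₁ * √(T.card) < ρ * R / 4)
    (hrem : C₃ * (∑ p, η p + 2 * (1 + b) * (√(T.card) * R)) * (2 * (1 + b)) ^ 2 * T.card ≤ ρ / 2) :
    wLik w φ rb z θ - ∑ p, Λ p * |β p + θ p| < wLik w φ rb z 0 - ∑ p, Λ p * |β p| := by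
  have hpen := sum_penalty_diff_le (θ := θ) hl₁.le hΛ₁ hΛ₂ hβ
  have hT := sum_abs_le_sqrt_card_mul (T := T) hR.le hθ
  have hT0 : 0 ≤ ∑ p ∈ T, |θ p| := Finset.sum_nonneg fun _ _ => abs_nonneg _
  have hN0 : 0 ≤ ∑ p, |θ p| := Finset.sum_nonneg fun _ _ => abs_nonneg _
  have hE0 : 0 ≤ ∑ p, η p := Finset.sum_nonneg fun p _ => hη0 p
  -- The cone constant is where the linear gain stops mattering: gradient and penalty together
  -- contribute at most −(l₁/2)‖θ‖₁ + (1 + b) l₁ ‖θ_T‖₁, which is negative exactly outside the cone.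
  -- Inside, half of the curvature term −ρR²/2 absorbs the cubic remainder and the other half beats
  -- (1 + b) l₁ √|T| R.
  by_cases hc : ∑ p, |θ p| ≤ 2 * (1 + b) * ∑ p ∈ T, |θ p|
  · have h1 := wLik_sub_le_quadratic (θ := θ) hw hφ hφ' hm0 hm hη0 hη hC₃ hG (hcone hc)
    set N := ∑ p, |θ p|
    set NT := ∑ p ∈ T, |θ p|
    set E := ∑ p, η p
    set q := √(T.card : ℝ) with hq
    have hq0 : 0 ≤ q := Real.sqrt_nonneg _
    have hqq : q ^ 2 = T.card := Real.sq_sqrt (Nat.cast_nonneg _)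
    have hN : N ≤ 2 * (1 + b) * (q * R) := hc.trans (mul_le_mul_of_nonneg_left hT (by positivity))
    have hr : C₃ * (E + N) * N * N ≤ ρ / 2 * R ^ 2 := by
      have e1 : C₃ * (E + N) ≤ C₃ * (E + 2 * (1 + b) * (q * R)) :=
        mul_le_mul_of_nonneg_left (by linarith) hC₃0
      have e2 : N * N ≤ (2 * (1 + b) * (q * R)) * (2 * (1 + b) * (q * R)) :=
        mul_self_le_mul_self hN0 hN
      calc C₃ * (E + N) * N * N = C₃ * (E + N) * (N * N) := by ring
        _ ≤ C₃ * (E + 2 * (1 + b) * (q * R)) * ((2 * (1 + b) * (q * R)) * (2 * (1 + b) * (q * R))) :=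
          mul_le_mul e1 e2 (by positivity) (by positivity)
        _ = C₃ * (E + 2 * (1 + b) * (q * R)) * (2 * (1 + b)) ^ 2 * q ^ 2 * R ^ 2 := by ring
        _ ≤ ρ / 2 * R ^ 2 := by
          rw [hqq]; exact mul_le_mul_of_nonneg_right hrem (sq_nonneg R)
    have hGN : G * N ≤ l₁ / 2 * N := mul_le_mul_of_nonneg_right hGl hN0
    have h2 : (l₁ + l₂) * NT ≤ (l₁ + b * l₁) * NT := mul_le_mul_of_nonneg_right (by linarith) hT0
    have h3 : (l₁ + b * l₁) * NT ≤ (l₁ + b * l₁) * (q * R) :=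
      mul_le_mul_of_nonneg_left hT (by positivity)
    have h4 : l₁ * q * R * (1 + 2 * b) < ρ * R / 4 * R := by
      have := mul_lt_mul_of_pos_right hRl hR; linarith
    have h5 : 0 ≤ l₁ * b * (q * R) := by positivity
    have h6 : 0 ≤ l₁ * N := by positivity
    nlinarith
  · have h1 := wLik_sub_le_gradient (θ := θ) hw hφ hφ' hneg hG
    rw [not_le] at hc
    have hGN : G * ∑ p, |θ p| ≤ l₁ / 2 * ∑ p, |θ p| := mul_le_mul_of_nonneg_right hGl hN0
    have h2 : (l₁ + l₂) * ∑ p ∈ T, |θ p| ≤ (l₁ + b * l₁) * ∑ p ∈ T, |θ p| :=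
      mul_le_mul_of_nonneg_right (by linarith) hT0
    have h3 := mul_lt_mul_of_pos_left hc hl₁
    linarith

/-- A continuous concave function that is smaller on a sphere than at its centre has a maximiser,
and all its maximisers lie in the ball. -/
theorem exists_maximiser_of_concave {E : Type*} [NormedAddCommGroup E] [NormedSpace ℝ E]
    [FiniteDimensional ℝ E] {G : E → ℝ} (hG : ConcaveOn ℝ univ G) (hc : Continuous G) {R : ℝ}
    (hR : 0 < R) (h : ∀ x, ‖x‖ = R → G x < G 0) :
    (∃ x, ∀ y, G y ≤ G x) ∧ ∀ x, (∀ y, G y ≤ G x) → ‖x‖ ≤ R := by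
  -- The segment from 0 to `x` crosses the sphere at `t • x`, and concavity along it transfers the
  -- strict inequality outward.
  have hout : ∀ x, R < ‖x‖ → G x < G 0 := fun x hx => by
    have hx0 : 0 < ‖x‖ := hR.trans hx
    set t := R / ‖x‖
    have ht0 : 0 < t := div_pos hR hx0
    have ht1 : t ≤ 1 := (div_le_one hx0).2 hx.le
    have h1 := h (t • x) (by rw [norm_smul, Real.norm_of_nonneg ht0.le, div_mul_cancel₀ _ hx0.ne'])
    have h2 := hG.2 (mem_univ x) (mem_univ 0) ht0.le (sub_nonneg.2 ht1) (by ring)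
    rw [smul_zero, add_zero, smul_eq_mul, smul_eq_mul] at h2
    have : t * (G x - G 0) < 0 := by linarith
    by_contra hcon
    have := mul_nonneg ht0.le (sub_nonneg.2 (not_lt.1 hcon))
    linarith
  constructor
  · obtain ⟨x, hx, hmax⟩ := (isCompact_closedBall (0 : E) R).exists_isMaxOn
      ⟨0, by simp [hR.le]⟩ hc.continuousOn
    refine ⟨x, fun y => ?_⟩
    by_cases hy : ‖y‖ ≤ R
    · exact hmax (by simpa using hy)
    · exact (hout y (not_le.1 hy)).le.trans (hmax (by simp [hR.le]))
  · intro x hx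
    by_contra hcon
    exact absurd (hx 0) (not_le.2 (hout x (not_le.1 hcon)))

theorem concaveOn_wLik {w : I → ℝ} {φ : I → ℝ → ℝ} {rb : I → ℝ} {z : I → J → ℝ}
    (hw : ∀ i, 0 ≤ w i) (hφ : ∀ i, ConcaveOn ℝ univ (φ i)) :
    ConcaveOn ℝ univ (wLik w φ rb z) := by
  refine ⟨convex_univ, fun x _ y _ a b ha hb hab => ?_⟩
  simp only [wLik, smul_eq_mul, Finset.mul_sum]
  rw [← Finset.sum_add_distrib]
  refine Finset.sum_le_sum fun i _ => ?_
  have h := (hφ i).2 (mem_univ (rb i + ∑ p, x p * z i p)) (mem_univ (rb i + ∑ p, y p * z i p))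
    ha hb hab
  have e : a • (rb i + ∑ p, x p * z i p) + b • (rb i + ∑ p, y p * z i p) =
      rb i + ∑ p, (a • x + b • y) p * z i p := by
    simp only [smul_eq_mul, Pi.add_apply, Pi.smul_apply, add_mul, Finset.sum_add_distrib, mul_add,
      Finset.mul_sum]
    have : rb i = a * rb i + b * rb i := by rw [← add_mul, hab, one_mul]
    simp only [mul_assoc]
    linarith
  rw [e, smul_eq_mul, smul_eq_mul] at h
  have := mul_le_mul_of_nonneg_left h (hw i)
  linarith

theorem continuous_wLik {w : I → ℝ} {φ : I → ℝ → ℝ} {rb : I → ℝ} {z : I → J → ℝ}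
    (hφ : ∀ i, Continuous (φ i)) : Continuous (wLik w φ rb z) := by
  unfold wLik
  refine continuous_finsetSum _ fun i _ => continuous_const.mul ((hφ i).comp ?_)
  fun_prop

theorem convexOn_penalty {Λ β : J → ℝ} (hΛ : ∀ p, 0 ≤ Λ p) :
    ConvexOn ℝ univ fun θ : J → ℝ => ∑ p, Λ p * |β p + θ p| := by
  refine ⟨convex_univ, fun x _ y _ a b ha hb hab => ?_⟩
  simp only [smul_eq_mul, Finset.mul_sum]
  rw [← Finset.sum_add_distrib]
  refine Finset.sum_le_sum fun p _ => ?_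
  have e : β p + (a • x + b • y) p = a * (β p + x p) + b * (β p + y p) := by
    simp only [Pi.add_apply, Pi.smul_apply, smul_eq_mul]
    linear_combination (-β p) * hab
  rw [e]
  have := (abs_add_le (a * (β p + x p)) (b * (β p + y p)))
  rw [abs_mul, abs_mul, abs_of_nonneg ha, abs_of_nonneg hb] at this
  have := mul_le_mul_of_nonneg_left this (hΛ p)
  linarith

end Lasso

/-! ### The local linear criterion in Lasso form -/

namespace Model

variable {Ω : ℕ → Type*} [∀ n, MeasurableSpace (Ω n)] {P : ∀ n, Measure (Ω n)} (S : Model P)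

/-- The weight `n⁻¹ K_h(U_i - U_k)`. -/
noncomputable def kw (K : ℝ → ℝ) (h : ℝ) (n : ℕ) (k : Fin n) (ω : Ω n) (i : Fin n) : ℝ :=
  (1 / (n : ℝ)) * ((1 / h) * K ((S.U n i ω - S.U n k ω) / h))

/-- The local linear design vector `(X_i, X_i (U_i - U_k) / h)`. -/
noncomputable def design (h : ℝ) (n : ℕ) (k : Fin n) (ω : Ω n) (i : Fin n) :
    Fin (S.d n) ⊕ Fin (S.d n) → ℝ :=
  Sum.elim (fun j => S.X n i ω j) fun j => S.X n i ω j * ((S.U n i ω - S.U n k ω) / h)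

/-- The linear predictor of the local linear approximation at `U_k` to the true coefficients. -/
noncomputable def basePred (n : ℕ) (k : Fin n) (ω : Ω n) (i : Fin n) : ℝ :=
  ∑ j, (S.a0 n k ω j + S.b0 n k ω j * (S.U n i ω - S.U n k ω)) * S.X n i ω j

/-- The true parameter `(a_{k0}, h b_{k0})`. -/
noncomputable def trueParam (h : ℝ) (n : ℕ) (k : Fin n) (ω : Ω n) :
    Fin (S.d n) ⊕ Fin (S.d n) → ℝ :=
  Sum.elim (fun j => S.a0 n k ω j) fun j => h * S.b0 n k ω j

/-- The support of the nonzero coefficients. -/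
def active (n : ℕ) : Finset (Fin (S.d n)) := Finset.univ.filter fun j => (j : ℕ) < S.s n

theorem card_active (n : ℕ) : (S.active n).card = S.s n := by
  have := Fin.card_filter_val_lt (n := S.d n) (m := S.s n)
  simpa [active, S.s_le n] using this

/-- Change of variables to errors from the truth, with the slopes multiplied by `h`. The factor `h`
in the second penalty is thereby absorbed, leaving a plain weighted ℓ¹ penalty, and the slope design
becomes (U_i − U_k)/h. -/
theorem penLogLik_eq {K : ℝ → ℝ} {h l₁ l₂ : ℝ} (hh : 0 < h) {n : ℕ} (k : Fin n) (ω : Ω n)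
    (α β : EuclideanSpace ℝ (Fin (S.d n))) :
    S.penLogLik K h l₁ l₂ n k ω α β =
      wLik (S.kw K h n k ω) (fun i s => logLik S.ℓ S.g s (S.Y n i ω)) (S.basePred n k ω)
        (S.design h n k ω)
        (Sum.elim (fun j => α j - S.a0 n k ω j) fun j => h * (β j - S.b0 n k ω j)) -
      ∑ p, (Sum.elim (fun _ => l₁) (fun _ => l₂) : Fin (S.d n) ⊕ Fin (S.d n) → ℝ) p *
        |S.trueParam h n k ω p +
          (Sum.elim (fun j => α j - S.a0 n k ω j) (fun j => h * (β j - S.b0 n k ω j)) :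
            Fin (S.d n) ⊕ Fin (S.d n) → ℝ) p| := by
  have h1 : S.localLogLik K h n k ω α β =
      wLik (S.kw K h n k ω) (fun i s => logLik S.ℓ S.g s (S.Y n i ω)) (S.basePred n k ω)
        (S.design h n k ω)
        (Sum.elim (fun j => α j - S.a0 n k ω j) fun j => h * (β j - S.b0 n k ω j)) := by
    unfold localLogLik wLik
    rw [Finset.mul_sum]
    refine Finset.sum_congr rfl fun i _ => ?_
    have e : S.basePred n k ω i + ∑ p, (Sum.elim (fun j => α j - S.a0 n k ω j)
        (fun j => h * (β j - S.b0 n k ω j)) : Fin (S.d n) ⊕ Fin (S.d n) → ℝ) p *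
          S.design h n k ω i p =
        ∑ j, (α j + β j * (S.U n i ω - S.U n k ω)) * S.X n i ω j := by
      simp only [Fintype.sum_sum_type, basePred, design, Sum.elim_inl, Sum.elim_inr]
      rw [← Finset.sum_add_distrib, ← Finset.sum_add_distrib]
      refine Finset.sum_congr rfl fun j _ => ?_
      field_simp
      ring
    rw [e, kw]
    simp only [logLik]
    ring
  rw [penLogLik, h1, sub_sub]
  congr 1
  simp only [Fintype.sum_sum_type, trueParam, Sum.elim_inl, Sum.elim_inr, Finset.mul_sum]
  congr 1
  · simp
  · refine Finset.sum_congr rfl fun j _ => ?_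
    rw [← mul_add, add_sub_cancel, abs_mul, abs_of_pos hh]

/-- An inactive coefficient vanishes on all of [0, 1], hence so does its derivative within that
interval: both blocks have the same support. -/
theorem trueParam_eq_zero {h : ℝ} {n : ℕ} {k : Fin n} {ω : Ω n}
    (hU : S.U n k ω ∈ Icc (0 : ℝ) 1) (p : Fin (S.d n) ⊕ Fin (S.d n))
    (hp : p ∉ (S.active n).disjSum (S.active n)) : S.trueParam h n k ω p = 0 := by
  rcases p with j | j
  · have hj : S.s n ≤ (j : ℕ) := by simpa [active] using hp
    exact S.a_sparse n j hj _ hU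
  · have hj : S.s n ≤ (j : ℕ) := by simpa [active] using hp
    have : derivWithin (S.a n j) (Icc 0 1) (S.U n k ω) = derivWithin (fun _ => 0) (Icc 0 1) (S.U n k ω) :=
      derivWithin_congr (fun u hu => S.a_sparse n j hj u hu) (S.a_sparse n j hj _ hU)
    simp [trueParam, b0, this]

/-- The quadratic form of the local Hessian. -/
theorem quad_hess {K : ℝ → ℝ} {h : ℝ} {n : ℕ} (k : Fin n) (ω : Ω n)
    (θ : Fin (S.d n) ⊕ Fin (S.d n) → ℝ) :
    θ ⬝ᵥ (S.hess K h n ω (S.U n k ω)).mulVec θ =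
      ∑ i, S.kw K h n k ω i * (S.Q2 n i ω * (∑ p, θ p * S.design h n k ω i p) ^ 2) := by
  have hblock : ∀ (l : ℕ) (x y : Fin (S.d n) → ℝ),
      x ⬝ᵥ (S.hessBlock K h n ω (S.U n k ω) l).mulVec y =
        ∑ i, S.kw K h n k ω i * (S.Q2 n i ω * ((S.U n i ω - S.U n k ω) / h) ^ l *
          (x ⬝ᵥ S.X n i ω) * (y ⬝ᵥ S.X n i ω)) := fun l x y => by
    unfold hessBlock
    rw [Matrix.smul_mulVec, Matrix.sum_mulVec, dotProduct_smul, dotProduct_sum, smul_eq_mul,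
      Finset.mul_sum]
    refine Finset.sum_congr rfl fun i _ => ?_
    rw [Matrix.smul_mulVec, dotProduct_smul, Matrix.vecMulVec_mulVec, dotProduct_smul, smul_eq_mul,
      kw]
    rw [dotProduct_comm (S.X n i ω) y]
    simp
    ring
  have hθ : θ = Sum.elim (fun j => θ (Sum.inl j)) fun j => θ (Sum.inr j) := by
    ext p; rcases p with j | j <;> rfl
  have hd : ∀ i, ∑ p, θ p * S.design h n k ω i p = (fun j => θ (Sum.inl j)) ⬝ᵥ S.X n i ω +
      ((fun j => θ (Sum.inr j)) ⬝ᵥ S.X n i ω) * ((S.U n i ω - S.U n k ω) / h) := fun i => by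
    simp only [Fintype.sum_sum_type, design, Sum.elim_inl, Sum.elim_inr, dotProduct, Finset.sum_mul,
      mul_assoc]
  simp only [hd]
  generalize (fun j => θ (Sum.inl j)) = x at *
  generalize (fun j => θ (Sum.inr j)) = y at *
  rw [hθ, hess, Matrix.fromBlocks_mulVec, sumElim_dotProduct_sumElim]
  simp only [Sum.elim_comp_inl, Sum.elim_comp_inr, dotProduct_add, hblock]
  rw [← Finset.sum_add_distrib, ← Finset.sum_add_distrib, ← Finset.sum_add_distrib]
  refine Finset.sum_congr rfl fun i _ => ?_
  ring

/-- The error of the local linear approximation to the linear predictor. -/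
theorem abs_basePred_sub_le {C : ℝ} {n : ℕ} {k i : Fin n} {ω : Ω n} {A h : ℝ} (hC0 : 0 ≤ C)
    (hcoef : ∀ j, ContDiffOn ℝ 2 (S.a n j) (Icc 0 1))
    (hC : ∀ j, ∀ u ∈ Icc (0 : ℝ) 1, |iteratedDerivWithin 2 (S.a n j) (Icc 0 1) u| ≤ C)
    (hUi : S.U n i ω ∈ Icc (0 : ℝ) 1) (hUk : S.U n k ω ∈ Icc (0 : ℝ) 1)
    (hd : |S.U n i ω - S.U n k ω| ≤ A * h) :
    |S.basePred n k ω i - S.linPred n i ω| ≤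
      ∑ j ∈ S.active n, C * (A * h) ^ 2 * |S.X n i ω j| := by
  unfold basePred linPred
  rw [← Finset.sum_sub_distrib, ← Finset.sum_filter_add_sum_filter_not Finset.univ
    (fun j : Fin (S.d n) => (j : ℕ) < S.s n)]
  have h0 : ∀ j ∈ Finset.univ.filter (fun j : Fin (S.d n) => ¬ (j : ℕ) < S.s n),
      (S.a0 n k ω j + S.b0 n k ω j * (S.U n i ω - S.U n k ω)) * S.X n i ω j -
        S.a n j (S.U n i ω) * S.X n i ω j = 0 := fun j hj => by
    have hj' : S.s n ≤ (j : ℕ) := by simpa using hj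
    have h1 := S.trueParam_eq_zero (h := 1) hUk (Sum.inl j) (by simp [active, hj'])
    have h2 := S.trueParam_eq_zero (h := 1) hUk (Sum.inr j) (by simp [active, hj'])
    simp only [trueParam, Sum.elim_inl, Sum.elim_inr, one_mul] at h1 h2
    rw [h1, h2, S.a_sparse n j hj' _ hUi]; ring
  rw [Finset.sum_eq_zero h0, add_zero]
  refine (Finset.abs_sum_le_sum_abs _ _).trans (Finset.sum_le_sum fun j _ => ?_)
  rw [← sub_mul, abs_mul, abs_sub_comm]
  refine mul_le_mul_of_nonneg_right ?_ (abs_nonneg _)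
  refine (abs_sub_tangent_le (hcoef j) (hC j) hUk hUi).trans ?_
  refine mul_le_mul_of_nonneg_left ?_ hC0
  rw [← sq_abs]
  exact pow_le_pow_left₀ (abs_nonneg _) hd 2

theorem concaveOn_logLik {y : ℝ} (hcurv : S.NegCurvature) (hy : y ∈ S.yRange) :
    ConcaveOn ℝ univ fun s => logLik S.ℓ S.g s y := by
  refine concaveOn_of_deriv2_nonpos convex_univ
    (S.logLik_differentiable y hy).continuous.continuousOn
    (S.logLik_differentiable y hy).differentiableOn
    (S.q1_differentiable y hy).differentiableOn fun x _ => (hcurv x y hy).le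

/-- The basic error bound for one localisation point, under deterministic conditions. -/
theorem norm_error_le {K : ℝ → ℝ} {h l₁ l₂ : ℝ} {n : ℕ} {k : Fin n} {ω : Ω n} {m : Fin n → ℝ}
    {A Ca b l δ ρ g C R : ℝ}
    (hh : 0 < h) (hl : 0 < l) (hl₁ : l ≤ l₁) (hl₂ : l ≤ l₂) (hlb₁ : l₁ ≤ b * l) (hlb₂ : l₂ ≤ b * l)
    (hcurv : S.NegCurvature) (hY : ∀ i, S.Y n i ω ∈ S.yRange)
    (hU : ∀ i, S.U n i ω ∈ Icc (0 : ℝ) 1) (hm0 : ∀ i, 0 ≤ m i)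
    (hm : ∀ i t, |q2 S.ℓ S.g (S.linPred n i ω + t) (S.Y n i ω) -
      q2 S.ℓ S.g (S.linPred n i ω) (S.Y n i ω)| ≤ m i * |t|)
    (hK0 : ∀ x, 0 ≤ K x) (hA : 1 ≤ A) (hKA : ∀ x, A < |x| → K x = 0)
    (hCa : 0 ≤ Ca) (hcoef : ∀ j, ContDiffOn ℝ 2 (S.a n j) (Icc 0 1))
    (hcoefC : ∀ j, ∀ u ∈ Icc (0 : ℝ) 1, |iteratedDerivWithin 2 (S.a n j) (Icc 0 1) u| ≤ Ca)
    (hscore₀ : ∀ j, |∑ i, S.kw K h n k ω i * (S.Q1 n i ω * S.X n i ω j)| ≤ g)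
    (hscore₁ : ∀ j, |∑ i, S.kw K h n k ω i * ((S.U n i ω - S.U n k ω) / h) *
      (S.Q1 n i ω * S.X n i ω j)| ≤ g)
    (hC0 : 0 ≤ C)
    (hC₂ : ∀ j j', ∑ i, S.kw K h n k ω i * |S.Q2 n i ω * S.X n i ω j * S.X n i ω j'| ≤ C)
    (hC₃ : ∀ j j' j'', ∑ i, S.kw K h n k ω i *
      |S.X n i ω j * S.X n i ω j' * S.X n i ω j'' * m i| ≤ C)
    (hb : 0 ≤ b)
    (hRE : ∀ v ∈ S.cone n (b + δ),
      ρ ≤ v ⬝ᵥ (-(S.hess K h n ω (S.U n k ω))).mulVec v) (hδ : 0 ≤ δ)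
    (hR : 0 < R)
    (hgl : g + C * A ^ 2 * (S.s n * (Ca * (A * h) ^ 2)) +
      C * A ^ 3 * (S.s n * (Ca * (A * h) ^ 2)) * (S.s n * (Ca * (A * h) ^ 2)) ≤ l / 2)
    (hRl : (1 + 2 * b) * l * √(2 * S.s n) < ρ * R / 4)
    (hrem : C * A ^ 3 * (S.s n * (Ca * (A * h) ^ 2) + 2 * (1 + b) * (√(2 * S.s n) * R)) *
      (2 * (1 + b)) ^ 2 * (2 * S.s n) ≤ ρ / 2) :
    (∃ α β, S.IsMaximiser K h l₁ l₂ n k ω α β) ∧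
    ∀ α β, S.IsMaximiser K h l₁ l₂ n k ω α β →
      ‖α - S.a0 n k ω‖ ≤ R ∧ ‖h • (β - S.b0 n k ω)‖ ≤ R := by
  set w := S.kw K h n k ω with hw_def
  set φ : Fin n → ℝ → ℝ := fun i s => logLik S.ℓ S.g s (S.Y n i ω)
  set rb := S.basePred n k ω
  set z := S.design h n k ω with hz_def
  set Λ : Fin (S.d n) ⊕ Fin (S.d n) → ℝ := Sum.elim (fun _ => l₁) (fun _ => l₂)
  set β₀ := S.trueParam h n k ω
  set T := (S.active n).disjSum (S.active n)
  -- Active intercepts and active slopes each contribute `s` coordinates.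
  have hcard : ((T.card : ℕ) : ℝ) = 2 * S.s n := by
    simp [T, Finset.card_disjSum, card_active]; ring
  have hw : ∀ i, 0 ≤ w i := fun i => by
    simp only [hw_def, kw]; have := hK0 ((S.U n i ω - S.U n k ω) / h); positivity
  have hφ : ∀ i, Differentiable ℝ (φ i) := fun i => S.logLik_differentiable _ (hY i)
  have hφ' : ∀ i, Differentiable ℝ (deriv (φ i)) := fun i => S.q1_differentiable _ (hY i)
  have hneg : ∀ i t, deriv (deriv (φ i)) t ≤ 0 := fun i t => (hcurv t _ (hY i)).le
  have hA0 : 0 ≤ A := zero_le_one.trans hA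
  -- A nonzero weight forces U_i to lie within the kernel radius A·h of U_k; only such observations
  -- enter the estimates below.
  have hwA : ∀ i, w i ≠ 0 → |(S.U n i ω - S.U n k ω) / h| ≤ A := fun i hi => by
    by_contra hcon
    exact hi (by simp [hw_def, kw, hKA _ (not_le.1 hcon)])
  let idx : Fin (S.d n) ⊕ Fin (S.d n) → Fin (S.d n) := Sum.elim id id
  -- Taking A ≥ 1 lets one bound serve both the intercept and the slope block of the design.
  have hz : ∀ i p, w i ≠ 0 → |z i p| ≤ A * |S.X n i ω (idx p)| := fun i p hi => by
    rcases p with j | j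
    · simpa [hz_def, design, idx] using mul_le_mul_of_nonneg_right hA (abs_nonneg (S.X n i ω j))
    · simp only [hz_def, design, idx, Sum.elim_inr, id, abs_mul]
      rw [mul_comm]; exact mul_le_mul_of_nonneg_right (hwA i hi) (abs_nonneg _)
  -- The approximation error of the linear predictor is charged to the active intercept coordinates
  -- alone, so its ℓ¹ mass is `s` times the tangent error.
  set η : Fin (S.d n) ⊕ Fin (S.d n) → ℝ :=
    Sum.elim (fun j => if j ∈ S.active n then Ca * (A * h) ^ 2 else 0) fun _ => 0 with hη_def
  have hη0 : ∀ p, 0 ≤ η p := fun p => by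
    rcases p with j | j
    · simp only [hη_def, Sum.elim_inl]; split_ifs <;> positivity
    · simp [hη_def]
  have hηsum : ∑ p, η p = S.s n * (Ca * (A * h) ^ 2) := by
    simp [hη_def, Fintype.sum_sum_type, card_active]
  have hη : ∀ i, w i ≠ 0 → |rb i - S.linPred n i ω| ≤ ∑ p, η p * |z i p| := fun i hi => by
    refine (S.abs_basePred_sub_le (A := A) (h := h) hCa hcoef hcoefC (hU i) (hU k) ?_).trans
      (le_of_eq ?_)
    · have := hwA i hi
      rwa [abs_div, abs_of_pos hh, div_le_iff₀ hh] at this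
    · simp [hη_def, Fintype.sum_sum_type, hz_def, design, ite_mul]
  have hC₂' : ∀ p q, ∑ i, w i * |deriv (deriv (φ i)) (S.linPred n i ω)| * |z i p| * |z i q| ≤
      C * A ^ 2 := fun p q => by
    calc _ ≤ ∑ i, A ^ 2 * (w i * |S.Q2 n i ω * S.X n i ω (idx p) * S.X n i ω (idx q)|) := by
          refine Finset.sum_le_sum fun i _ => ?_
          rcases eq_or_ne (w i) 0 with h0 | h0
          · simp [h0]
          have := mul_le_mul (hz i p h0) (hz i q h0) (abs_nonneg _) (by positivity)
          have h2 := mul_le_mul_of_nonneg_left this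
            (mul_nonneg (hw i) (abs_nonneg (deriv (deriv (φ i)) (S.linPred n i ω))))
          have e : deriv (deriv (φ i)) (S.linPred n i ω) = S.Q2 n i ω := rfl
          rw [e] at h2 ⊢
          rw [abs_mul, abs_mul]
          linarith
      _ ≤ _ := by
          rw [← Finset.mul_sum, mul_comm C]
          exact mul_le_mul_of_nonneg_left (hC₂ _ _) (by positivity)
  have hC₃' : ∀ p q l, ∑ i, w i * m i * |z i p| * |z i q| * |z i l| ≤ C * A ^ 3 := fun p q l => by
    calc _ ≤ ∑ i, A ^ 3 * (w i *
            |S.X n i ω (idx p) * S.X n i ω (idx q) * S.X n i ω (idx l) * m i|) := by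
          refine Finset.sum_le_sum fun i _ => ?_
          rcases eq_or_ne (w i) 0 with h0 | h0
          · simp [h0]
          have h1 := mul_le_mul (hz i p h0) (hz i q h0) (abs_nonneg _) (by positivity)
          have h3 := mul_le_mul h1 (hz i l h0) (abs_nonneg _) (by positivity)
          have h2 := mul_le_mul_of_nonneg_left h3 (mul_nonneg (hw i) (hm0 i))
          rw [abs_mul, abs_mul, abs_mul, abs_of_nonneg (hm0 i)]
          linarith
      _ ≤ _ := by
          rw [← Finset.mul_sum, mul_comm C]
          exact mul_le_mul_of_nonneg_left (hC₃ _ _ _) (by positivity)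
  have hscore : ∀ p, |∑ i, w i * deriv (φ i) (S.linPred n i ω) * z i p| ≤ g := fun p => by
    rcases p with j | j
    · refine le_trans (le_of_eq ?_) (hscore₀ j)
      congr 1; refine Finset.sum_congr rfl fun i _ => ?_
      have e : deriv (φ i) (S.linPred n i ω) = S.Q1 n i ω := rfl
      rw [e]; simp only [hz_def, design, Sum.elim_inl]; ring
    · refine le_trans (le_of_eq ?_) (hscore₁ j)
      congr 1; refine Finset.sum_congr rfl fun i _ => ?_
      have e : deriv (φ i) (S.linPred n i ω) = S.Q1 n i ω := rfl
      rw [e]; simp only [hz_def, design, Sum.elim_inr]; ring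
  have hG := abs_gradient_le (rb := rb) (r := fun i => S.linPred n i ω) hw hφ' hm0 hm hη0 hη hscore hC₂' hC₃'
  rw [hηsum] at hG
  let Gf : (Fin (S.d n) ⊕ Fin (S.d n) → ℝ) → ℝ := fun θ =>
    wLik w φ rb z θ - ∑ p, Λ p * |β₀ p + θ p|
  have hΛ₁ : ∀ p, l ≤ Λ p := by rintro (j | j) <;> simp [Λ, hl₁, hl₂]
  have hΛ₂ : ∀ p, Λ p ≤ b * l := by rintro (j | j) <;> simp [Λ, hlb₁, hlb₂]
  have hsphere : ∀ θ : Fin (S.d n) ⊕ Fin (S.d n) → ℝ, ∑ p, θ p ^ 2 = R ^ 2 → Gf θ < Gf 0 := by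
    intro θ hθ
    have := penalised_lt_center (w := w) (φ := φ) (rb := rb) (r := fun i => S.linPred n i ω) (z := z)
      (m := m) (η := η) (Λ := Λ) (β := β₀) (θ := θ) (T := T) (l₁ := l) (l₂ := b * l) (b := b)
      (C₃ := C * A ^ 3) (ρ := ρ) hw hφ hφ' hneg hm0 hm hη0 hη (by positivity) hC₃' hG hl hΛ₁ hΛ₂
      hb le_rfl (S.trueParam_eq_zero (hU k)) hgl hR hθ ?_ (by rw [hcard]; exact hRl)
      (by rw [hcard, hηsum]; exact hrem)
    · simpa [Gf] using this
    · intro hcone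
      -- The eigenvalue condition is stated for unit vectors, hence the scaling by R⁻¹. The cone
      -- required by the sphere argument has constant 2(1 + b) and so sits inside the one with b +
      -- δ.
      have hv : (R⁻¹ • θ) ∈ S.cone n (b + δ) := by
        constructor
        · simp only [Pi.smul_apply, smul_eq_mul, mul_pow]
          rw [← Finset.mul_sum, hθ, ← mul_pow, inv_mul_cancel₀ hR.ne', one_pow]
        · simp only [Pi.smul_apply, smul_eq_mul, abs_mul, abs_of_pos (inv_pos.2 hR)]
          simp only [← mul_add, ← Finset.mul_sum]
          rw [mul_left_comm]
          refine mul_le_mul_of_nonneg_left ?_ (inv_pos.2 hR).le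
          have e1 : ∑ p, |θ p| = ∑ j, (|θ (Sum.inl j)| + |θ (Sum.inr j)|) := by
            rw [Fintype.sum_sum_type, Finset.sum_add_distrib]
          have e2 : ∑ p ∈ T, |θ p| = ∑ j ∈ S.active n, (|θ (Sum.inl j)| + |θ (Sum.inr j)|) := by
            rw [Finset.sum_disjSum, Finset.sum_add_distrib]
          rw [← e1]
          change _ ≤ 2 * (1 + (b + δ)) * ∑ j ∈ S.active n, (|θ (Sum.inl j)| + |θ (Sum.inr j)|)
          rw [← e2]
          refine hcone.trans (mul_le_mul_of_nonneg_right (by linarith)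
            (Finset.sum_nonneg fun _ _ => abs_nonneg _))
      have h1 := hRE _ hv
      rw [Matrix.neg_mulVec, dotProduct_neg, Matrix.mulVec_smul, smul_dotProduct, dotProduct_smul,
        quad_hess, smul_eq_mul, smul_eq_mul] at h1
      have h2 := mul_le_mul_of_nonneg_right h1 (sq_nonneg R)
      have e : ∀ q : ℝ, -(R⁻¹ * (R⁻¹ * q)) * R ^ 2 = -q := fun q => by
        have := hR.ne'; field_simp
      rw [e] at h2
      change ∑ i, S.kw K h n k ω i * (S.Q2 n i ω * (∑ p, θ p * S.design h n k ω i p) ^ 2) ≤ _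
      linarith
  have hconc : ConcaveOn ℝ univ Gf :=
    (concaveOn_wLik hw fun i => S.concaveOn_logLik hcurv (hY i)).sub
      (convexOn_penalty fun p => hl.le.trans (hΛ₁ p))
  have hcont : Continuous Gf := by
    refine (continuous_wLik fun i => (hφ i).continuous).sub ?_
    fun_prop
  -- The concavity argument runs in the joint Euclidean space, since the plain function space
  -- carries the sup norm; the joint bound then controls each block separately.
  let E := EuclideanSpace ℝ (Fin (S.d n) ⊕ Fin (S.d n))
  have hmain := exists_maximiser_of_concave (E := E) (G := fun θ => Gf θ.ofLp) (R := R)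
    (hconc.comp_linearMap (WithLp.linearEquiv 2 ℝ (Fin (S.d n) ⊕ Fin (S.d n) → ℝ)).toLinearMap)
    (hcont.comp (PiLp.continuous_ofLp 2 _)) hR (fun θ hθ => by
      refine hsphere θ.ofLp ?_
      rw [← hθ, EuclideanSpace.real_norm_sq_eq])
  have hpen := S.penLogLik_eq (K := K) (l₁ := l₁) (l₂ := l₂) hh k ω
  constructor
  · obtain ⟨θ, hθ⟩ := hmain.1
    refine ⟨WithLp.toLp 2 fun j => θ (Sum.inl j) + S.a0 n k ω j,
      WithLp.toLp 2 fun j => θ (Sum.inr j) / h + S.b0 n k ω j, fun α' β' => ?_⟩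
    rw [hpen, hpen]
    have h1 := hθ (WithLp.toLp 2 (Sum.elim (fun j => α' j - S.a0 n k ω j)
      fun j => h * (β' j - S.b0 n k ω j)))
    have e : (Sum.elim (fun j => (WithLp.toLp 2 fun j => θ (Sum.inl j) + S.a0 n k ω j :
          EuclideanSpace ℝ (Fin (S.d n))) j - S.a0 n k ω j)
        (fun j => h * ((WithLp.toLp 2 fun j => θ (Sum.inr j) / h + S.b0 n k ω j :
          EuclideanSpace ℝ (Fin (S.d n))) j - S.b0 n k ω j)) :
        Fin (S.d n) ⊕ Fin (S.d n) → ℝ) = θ.ofLp := by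
      ext p
      rcases p with j | j
      · simp
      · simp; field_simp
    rw [e]
    exact h1
  · intro α β hmax
    have h1 := hmain.2 (WithLp.toLp 2 (Sum.elim (fun j => α j - S.a0 n k ω j)
      fun j => h * (β j - S.b0 n k ω j))) fun θ => by
        have h2 := hmax (WithLp.toLp 2 fun j => θ (Sum.inl j) + S.a0 n k ω j)
          (WithLp.toLp 2 fun j => θ (Sum.inr j) / h + S.b0 n k ω j)
        rw [hpen, hpen] at h2
        have e : (Sum.elim (fun j => (WithLp.toLp 2 fun j => θ (Sum.inl j) + S.a0 n k ω j :
              EuclideanSpace ℝ (Fin (S.d n))) j - S.a0 n k ω j)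
            (fun j => h * ((WithLp.toLp 2 fun j => θ (Sum.inr j) / h + S.b0 n k ω j :
              EuclideanSpace ℝ (Fin (S.d n))) j - S.b0 n k ω j)) :
            Fin (S.d n) ⊕ Fin (S.d n) → ℝ) = θ.ofLp := by
          ext p
          rcases p with j | j
          · simp
          · simp; field_simp
        rw [e] at h2
        exact h2
    have h2 : ‖α - S.a0 n k ω‖ ^ 2 + ‖h • (β - S.b0 n k ω)‖ ^ 2 ≤ R ^ 2 := by
      refine le_trans (le_of_eq ?_) (pow_le_pow_left₀ (norm_nonneg _) h1 2)
      rw [EuclideanSpace.real_norm_sq_eq, EuclideanSpace.real_norm_sq_eq,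
        EuclideanSpace.real_norm_sq_eq, Fintype.sum_sum_type]
      simp
    constructor
    · exact abs_le_of_sq_le_sq' (by nlinarith [sq_nonneg ‖h • (β - S.b0 n k ω)‖]) hR.le |>.2
    · exact abs_le_of_sq_le_sq' (by nlinarith [sq_nonneg ‖α - S.a0 n k ω‖]) hR.le |>.2

end Model

/-! ### An exponential inequality with a random centre -/

open scoped ENNReal

theorem exp_le_one_add_add_sq (x : ℝ) : Real.exp x ≤ 1 + x + x ^ 2 * Real.exp |x| := by
  obtain ⟨ξ, hξ, e⟩ := exists_taylor_second Real.differentiable_exp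
    (by rw [Real.deriv_exp]; exact Real.differentiable_exp) 0 x
  simp only [zero_add, Real.deriv_exp, Real.exp_zero, one_mul, sub_zero] at hξ e
  have h1 : Real.exp ξ ≤ Real.exp |x| := Real.exp_le_exp.2 ((le_abs_self ξ).trans hξ)
  have h2 := mul_le_mul_of_nonneg_right h1 (sq_nonneg x)
  have h3 := mul_nonneg (Real.exp_nonneg ξ) (sq_nonneg x)
  rw [e]; linarith

theorem exp_mul_abs_le {c x : ℝ} (hc : c ≤ 1) :
    Real.exp (c * |x|) ≤ Real.exp 1 + x ^ 2 * Real.exp (c * |x|) := by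
  rcases le_total |x| 1 with h | h
  · have : Real.exp (c * |x|) ≤ Real.exp 1 :=
      Real.exp_le_exp.2 ((mul_le_mul hc h (abs_nonneg _) zero_le_one).trans (by norm_num))
    have := mul_nonneg (sq_nonneg x) (Real.exp_nonneg (c * |x|))
    linarith
  · have h1 : 1 ≤ x ^ 2 := by rw [← sq_abs]; exact one_le_pow₀ h
    have := mul_le_mul_of_nonneg_right h1 (Real.exp_nonneg (c * |x|))
    linarith [Real.exp_nonneg 1]

section Concentration

variable {Ω : Type*} {𝒵 : Type*} [MeasurableSpace Ω] [MeasurableSpace 𝒵] {P : Measure Ω}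

/-- `E[f | V] ≤ C`, in integrated form. -/
def CondLE (P : Measure Ω) (V : Ω → ℝ) (f : Ω → ℝ≥0∞) (C : ℝ≥0∞) : Prop :=
  ∀ p : ℝ → ℝ≥0∞, Measurable p → ∫⁻ ω, f ω * p (V ω) ∂P ≤ C * ∫⁻ ω, p (V ω) ∂P

theorem CondLE.lintegral_le [IsProbabilityMeasure P] {V : Ω → ℝ} {f : Ω → ℝ≥0∞} {C : ℝ≥0∞}
    (h : CondLE P V f C) : ∫⁻ ω, f ω ∂P ≤ C := by
  simpa using h (fun _ => 1) measurable_const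

/-- A product of functions of an independent family, all depending on one distinguished member. -/
theorem lintegral_prod_distinguished_le [IsProbabilityMeasure P] {n : ℕ} {Z : Fin n → Ω → 𝒵}
    (hZ : ∀ i, Measurable (Z i)) (hind : iIndepFun Z P) (k : Fin n) {F : 𝒵 → 𝒵 → ℝ≥0∞}
    (hF : Measurable fun p : 𝒵 × 𝒵 => F p.1 p.2) {D D' : ℝ≥0∞} (hD1 : 1 ≤ D)
    (hD : ∀ i z, ∫⁻ ω, F (Z i ω) z ∂P ≤ D) (hD' : ∫⁻ ω, F (Z k ω) (Z k ω) ∂P ≤ D') :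
    ∫⁻ ω, ∏ i, F (Z i ω) (Z k ω) ∂P ≤ D' * D ^ n := by
  -- Coordinate `k` is split off from the product law. By Tonelli its value is held fixed, and the
  -- other `m` factors are then independent.
  obtain ⟨m, rfl⟩ : ∃ m, n = m + 1 := ⟨n - 1, by have := k.pos; omega⟩
  set μ : Fin (m + 1) → Measure 𝒵 := fun i => P.map (Z i)
  have : ∀ i, IsProbabilityMeasure (μ i) := fun i =>
    Measure.isProbabilityMeasure_map (hZ i).aemeasurable
  have hlaw := (iIndepFun_iff_map_fun_eq_pi_map fun i => (hZ i).aemeasurable).1 hind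
  have hZm : Measurable fun ω i => Z i ω := measurable_pi_lambda _ hZ
  have hF2 : ∀ i, Measurable fun z : Fin (m + 1) → 𝒵 => F (z i) (z k) := fun i =>
    hF.comp (f := fun z : Fin (m + 1) → 𝒵 => (z i, z k))
      ((measurable_pi_apply i).prodMk (measurable_pi_apply k))
  have hF3 : Measurable fun z : Fin (m + 1) → 𝒵 => ∏ i, F (z i) (z k) :=
    Finset.measurable_prod _ fun i _ => hF2 i
  have h1 : ∫⁻ ω, ∏ i, F (Z i ω) (Z k ω) ∂P =
      ∫⁻ z : Fin (m + 1) → 𝒵, ∏ i, F (z i) (z k) ∂(Measure.pi μ) := by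
    rw [← hlaw, lintegral_map hF3 hZm]
  have hmp := measurePreserving_piFinSuccAbove μ k
  have hF4 : Measurable fun p : 𝒵 × (Fin m → 𝒵) => F p.1 p.1 * ∏ j, F (p.2 j) p.1 := by
    refine (hF.comp (measurable_fst.prodMk measurable_fst)).mul ?_
    exact Finset.measurable_prod _ fun j _ =>
      hF.comp (f := fun p : 𝒵 × (Fin m → 𝒵) => (p.2 j, p.1))
        (((measurable_pi_apply j).comp measurable_snd).prodMk measurable_fst)
  have h2 : ∫⁻ z : Fin (m + 1) → 𝒵, ∏ i, F (z i) (z k) ∂(Measure.pi μ) =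
      ∫⁻ p, F p.1 p.1 * ∏ j, F (p.2 j) p.1
        ∂((μ k).prod (Measure.pi fun j => μ (k.succAbove j))) := by
    rw [← hmp.lintegral_comp hF4]
    refine lintegral_congr fun z => ?_
    rw [Fin.prod_univ_succAbove _ k]
    rfl
  rw [h1, h2, lintegral_prod _ hF4.aemeasurable]
  have hFz : ∀ z, Measurable fun y => F y z := fun z =>
    hF.comp (measurable_id.prodMk measurable_const)
  have h3 : ∀ z, ∫⁻ y : Fin m → 𝒵, F z z * ∏ j, F (y j) z
      ∂(Measure.pi fun j => μ (k.succAbove j)) ≤ F z z * D ^ (m + 1) := fun z => by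
    have hm : ∀ j, Measurable fun y : Fin m → 𝒵 => F (y j) z := fun j =>
      (hFz z).comp (measurable_pi_apply j)
    rw [lintegral_const_mul _ (Finset.measurable_prod _ fun j _ => hm j)]
    refine mul_le_mul_right ?_ _
    rw [lintegral_prod_eq_prod_lintegral_of_indepFun Finset.univ
      (fun j (y : Fin m → 𝒵) => F (y j) z)
      (iIndepFun_pi (X := fun _ y => F y z) fun j => (hFz z).aemeasurable)
      hm]
    calc _ ≤ ∏ j : Fin m, D := Finset.prod_le_prod' fun j _ => by
          rw [(measurePreserving_eval (fun j => μ (k.succAbove j)) j).lintegral_comp (hFz z),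
            lintegral_map (hFz z) (hZ _)]
          exact hD _ z
      _ = D ^ m := by simp
      -- Only `m` factors remain after removing the distinguished one; 1 ≤ D allows the rounder
      -- exponent `n`.
      _ ≤ D ^ (m + 1) := pow_le_pow_right₀ hD1 (Nat.le_succ m)
  refine (lintegral_mono h3).trans ?_
  have hFd : Measurable fun z => F z z := hF.comp (measurable_id.prodMk measurable_id)
  rw [lintegral_mul_const _ hFd, lintegral_map hFd (hZ k)]
  exact mul_le_mul_left hD' _

variable [IsProbabilityMeasure P]

theorem CondLE.integrable {V ξ : Ω → ℝ} {c C : ℝ} (hc : 0 ≤ c)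
    (h : CondLE P V (fun ω => ENNReal.ofReal (ξ ω ^ 2 * Real.exp (c * |ξ ω|))) (ENNReal.ofReal C))
    (hξ : Measurable ξ) : Integrable (fun ω => ξ ω ^ 2 * Real.exp (c * |ξ ω|)) P ∧
      Integrable ξ P := by
  have h1 : Integrable (fun ω => ξ ω ^ 2 * Real.exp (c * |ξ ω|)) P := by
    refine ⟨by fun_prop, ?_⟩
    rw [hasFiniteIntegral_iff_ofReal (ae_of_all _ fun ω => by positivity)]
    exact h.lintegral_le.trans_lt ENNReal.ofReal_lt_top
  refine ⟨h1, ((integrable_const (1 : ℝ)).add h1).mono' hξ.aestronglyMeasurable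
    (ae_of_all _ fun ω => ?_)⟩
  have h2 : 1 ≤ Real.exp (c * |ξ ω|) := Real.one_le_exp (by positivity)
  have h3 := mul_le_mul_of_nonneg_left h2 (sq_nonneg (ξ ω))
  simp only [Pi.add_apply, Real.norm_eq_abs]
  nlinarith [sq_nonneg (|ξ ω| - 1), sq_abs (ξ ω)]

/-- Moment generating function of a kernel-weighted variable. -/
theorem lintegral_exp_kernel_le {V ξ : Ω → ℝ} {wt : ℝ → ℝ} {κ h c C Cw β l u : ℝ}
    (hV : Measurable V) (hξ : Measurable ξ) (hwt : Measurable wt) (hκ : ∀ x, |wt x| ≤ κ)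
    (hc : 0 ≤ c) (hC : 0 ≤ C)
    (hmom : CondLE P V (fun ω => ENNReal.ofReal (ξ ω ^ 2 * Real.exp (c * |ξ ω|)))
      (ENNReal.ofReal C))
    (hw : ∫⁻ ω, ENNReal.ofReal |wt ((V ω - u) / h)| ∂P ≤ ENNReal.ofReal (Cw * h))
    (hCw : 0 ≤ Cw * h)
    (hbias : ∫ ω, ξ ω * wt ((V ω - u) / h) ∂P ≤ β * h) (hl : 0 ≤ l) (hlκ : l * κ ≤ c) :
    ∫⁻ ω, ENNReal.ofReal (Real.exp (l * (ξ ω * wt ((V ω - u) / h)))) ∂P ≤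
      ENNReal.ofReal (Real.exp (h * (l * β + l ^ 2 * κ * C * Cw))) := by
  have hκ0 : 0 ≤ κ := (abs_nonneg _).trans (hκ 0)
  obtain ⟨hi1, hi2⟩ := hmom.integrable hc hξ
  set w : Ω → ℝ := fun ω => wt ((V ω - u) / h) with hwdef
  have hwm : Measurable w := hwt.comp ((hV.sub_const u).div_const h)
  set B : Ω → ℝ := fun ω => ξ ω ^ 2 * Real.exp (c * |ξ ω|) with hB
  have hB0 : ∀ ω, 0 ≤ B ω := fun ω => by positivity
  have hξw : Integrable (fun ω => ξ ω * w ω) P :=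
    hi2.mul_bdd hwm.aestronglyMeasurable (ae_of_all _ fun ω => hκ _)
  have hBw : Integrable (fun ω => B ω * |w ω|) P :=
    hi1.mul_bdd (c := κ) hwm.abs.aestronglyMeasurable
      (ae_of_all _ fun ω => by simpa using hκ _)
  -- In the squared weight only one factor is replaced by κ. The remaining |w| integrates to order
  -- `h`, which keeps the whole exponent proportional to `h`.
  have hpt : ∀ ω, Real.exp (l * (ξ ω * w ω)) ≤ 1 + l * (ξ ω * w ω) + l ^ 2 * κ * (B ω * |w ω|) :=
    fun ω => by
      refine (exp_le_one_add_add_sq _).trans (by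
        refine add_le_add_right ?_ _
        have h1 : Real.exp |l * (ξ ω * w ω)| ≤ Real.exp (c * |ξ ω|) := by
          refine Real.exp_le_exp.2 ?_
          rw [abs_mul, abs_mul, abs_of_nonneg hl]
          have := mul_le_mul_of_nonneg_left (hκ ((V ω - u) / h)) (mul_nonneg hl (abs_nonneg (ξ ω)))
          have h2 := mul_le_mul_of_nonneg_right hlκ (abs_nonneg (ξ ω))
          change l * |ξ ω| * |w ω| ≤ _ at this
          linarith
        have h2 : w ω ^ 2 ≤ κ * |w ω| := by
          rw [← sq_abs, sq]; exact mul_le_mul_of_nonneg_right (hκ _) (abs_nonneg _)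
        calc _ = l ^ 2 * (w ω ^ 2 * (ξ ω ^ 2 * Real.exp |l * (ξ ω * w ω)|)) := by ring
          _ ≤ l ^ 2 * (κ * |w ω| * (ξ ω ^ 2 * Real.exp (c * |ξ ω|))) := by
            gcongr
          _ = _ := by simp only [hB]; ring)
  have hI : Integrable (fun ω => 1 + l * (ξ ω * w ω) + l ^ 2 * κ * (B ω * |w ω|)) P :=
    ((integrable_const _).add (hξw.const_mul l)).add (hBw.const_mul _)
  calc _ ≤ ∫⁻ ω, ENNReal.ofReal (1 + l * (ξ ω * w ω) + l ^ 2 * κ * (B ω * |w ω|)) ∂P :=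
        lintegral_mono fun ω => ENNReal.ofReal_le_ofReal (hpt ω)
    _ = ENNReal.ofReal (∫ ω, (1 + l * (ξ ω * w ω) + l ^ 2 * κ * (B ω * |w ω|)) ∂P) :=
        (ofReal_integral_eq_lintegral_ofReal hI
          (ae_of_all _ fun ω => (Real.exp_nonneg _).trans (hpt ω))).symm
    _ ≤ _ := by
        refine ENNReal.ofReal_le_ofReal ?_
        have e0 : ∫ ω, (1 + l * (ξ ω * w ω) + l ^ 2 * κ * (B ω * |w ω|)) ∂P =
            1 + l * ∫ ω, ξ ω * w ω ∂P + l ^ 2 * κ * ∫ ω, B ω * |w ω| ∂P := by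
          have h1 : Integrable (fun ω => 1 + l * (ξ ω * w ω)) P :=
            (integrable_const _).add (hξw.const_mul l)
          rw [integral_add h1 (hBw.const_mul _), integral_add (integrable_const _) (hξw.const_mul l),
            integral_const_mul, integral_const_mul]
          simp
        rw [e0]
        have e1 : ∫ ω, B ω * |w ω| ∂P ≤ C * (Cw * h) := by
          rw [integral_eq_lintegral_of_nonneg_ae (ae_of_all _ fun ω =>
            mul_nonneg (hB0 ω) (abs_nonneg _)) hBw.aestronglyMeasurable]
          refine ENNReal.toReal_le_of_le_ofReal (by positivity) ?_
          -- The conditional moment bound is tested against the kernel weight, itself a function of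
          -- the index variable.
          have h1 := hmom (fun v => ENNReal.ofReal |wt ((v - u) / h)|) (by fun_prop)
          rw [ENNReal.ofReal_mul hC]
          refine le_trans (le_of_eq ?_) (h1.trans (mul_le_mul_right hw _))
          exact lintegral_congr fun ω => ENNReal.ofReal_mul (hB0 ω)
        have e2 : l * ∫ ω, ξ ω * w ω ∂P ≤ l * (β * h) := mul_le_mul_of_nonneg_left hbias hl
        have e3 := mul_le_mul_of_nonneg_left e1 (mul_nonneg (sq_nonneg l) hκ0)
        have e4 := Real.add_one_le_exp (h * (l * β + l ^ 2 * κ * C * Cw))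
        linarith

/-- Chernoff's bound. The factors with i ≠ k have moment generating functions bounded uniformly over
all centres, so the random centre is harmless. The diagonal term needs its own bound and costs only
the constant e + C. -/
theorem kernel_sum_tail_upper {n : ℕ} {Z : Fin n → Ω → 𝒵} (hZ : ∀ i, Measurable (Z i))
    (hind : iIndepFun Z P) (k : Fin n) {V ψ : 𝒵 → ℝ} {wt : ℝ → ℝ} {κ h c C Cw β l T : ℝ}
    (hV : Measurable V) (hψ : Measurable ψ) (hwt : Measurable wt) (hκ : ∀ x, |wt x| ≤ κ)
    (hc : 0 ≤ c) (hc1 : c ≤ 1) (hC : 0 ≤ C) (hh : 0 ≤ h) (hCw : 0 ≤ Cw) (hβ : 0 ≤ β)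
    (hmom : ∀ i, CondLE P (fun ω => V (Z i ω))
      (fun ω => ENNReal.ofReal (ψ (Z i ω) ^ 2 * Real.exp (c * |ψ (Z i ω)|))) (ENNReal.ofReal C))
    (hw : ∀ i u, ∫⁻ ω, ENNReal.ofReal |wt ((V (Z i ω) - u) / h)| ∂P ≤ ENNReal.ofReal (Cw * h))
    (hbias : ∀ i u, ∫ ω, ψ (Z i ω) * wt ((V (Z i ω) - u) / h) ∂P ≤ β * h)
    (hl : 0 ≤ l) (hlκ : l * κ ≤ c) :
    P {ω | T ≤ ∑ i, ψ (Z i ω) * wt ((V (Z i ω) - V (Z k ω)) / h)} ≤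
      ENNReal.ofReal ((Real.exp 1 + C) *
        Real.exp (-(l * T) + n * (h * (l * β + l ^ 2 * κ * C * Cw)))) := by
  have hκ0 : 0 ≤ κ := (abs_nonneg _).trans (hκ 0)
  set F : 𝒵 → 𝒵 → ℝ≥0∞ := fun z z' =>
    ENNReal.ofReal (Real.exp (l * (ψ z * wt ((V z - V z') / h)))) with hFdef
  have hF : Measurable fun p : 𝒵 × 𝒵 => F p.1 p.2 := by
    refine ENNReal.measurable_ofReal.comp (Real.measurable_exp.comp (Measurable.const_mul ?_ l))
    exact (hψ.comp measurable_fst).mul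
      (hwt.comp (((hV.comp measurable_fst).sub (hV.comp measurable_snd)).div_const h))
  set s := h * (l * β + l ^ 2 * κ * C * Cw) with hs
  have hs0 : 0 ≤ s := by positivity
  have hD : ∀ i z, ∫⁻ ω, F (Z i ω) z ∂P ≤ ENNReal.ofReal (Real.exp s) := fun i z =>
    lintegral_exp_kernel_le (hV.comp (hZ i)) (hψ.comp (hZ i)) hwt hκ hc hC (hmom i) (hw i (V z))
      (by positivity) (hbias i (V z)) hl hlκ
  have hD' : ∫⁻ ω, F (Z k ω) (Z k ω) ∂P ≤ ENNReal.ofReal (Real.exp 1 + C) := by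
    have h1 : ∀ ω, F (Z k ω) (Z k ω) ≤ ENNReal.ofReal (Real.exp 1) +
        ENNReal.ofReal (ψ (Z k ω) ^ 2 * Real.exp (c * |ψ (Z k ω)|)) := fun ω => by
      rw [← ENNReal.ofReal_add (Real.exp_nonneg _) (by positivity)]
      refine ENNReal.ofReal_le_ofReal (le_trans (Real.exp_le_exp.2 ?_) (exp_mul_abs_le hc1))
      refine (le_abs_self _).trans ?_
      rw [abs_mul, abs_mul, abs_of_nonneg hl]
      have := mul_le_mul_of_nonneg_left (hκ ((V (Z k ω) - V (Z k ω)) / h))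
        (mul_nonneg hl (abs_nonneg (ψ (Z k ω))))
      have h2 := mul_le_mul_of_nonneg_right hlκ (abs_nonneg (ψ (Z k ω)))
      linarith
    refine (lintegral_mono h1).trans ?_
    rw [lintegral_add_left measurable_const, lintegral_const, measure_univ, mul_one,
      ENNReal.ofReal_add (Real.exp_nonneg _) hC]
    exact add_le_add_right ((hmom k).lintegral_le) _
  have hprod := lintegral_prod_distinguished_le hZ hind k hF
    (D := ENNReal.ofReal (Real.exp s)) (by simpa using Real.one_le_exp hs0) hD hD'
  have hm : Measurable fun ω => ∏ i, F (Z i ω) (Z k ω) :=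
    Finset.measurable_prod _ fun i _ => hF.comp ((hZ i).prodMk (hZ k))
  have hmk := mul_meas_ge_le_lintegral (μ := P) hm (ENNReal.ofReal (Real.exp (l * T)))
  have hsub : {ω | T ≤ ∑ i, ψ (Z i ω) * wt ((V (Z i ω) - V (Z k ω)) / h)} ⊆
      {ω | ENNReal.ofReal (Real.exp (l * T)) ≤ ∏ i, F (Z i ω) (Z k ω)} := fun ω hω => by
    simp only [mem_ofPred_eq, hFdef] at hω ⊢
    rw [← ENNReal.ofReal_prod_of_nonneg fun i _ => Real.exp_nonneg _, ← Real.exp_sum,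
      ← Finset.mul_sum]
    exact ENNReal.ofReal_le_ofReal (Real.exp_le_exp.2 (mul_le_mul_of_nonneg_left hω hl))
  refine (measure_mono hsub).trans ?_
  have hne : ENNReal.ofReal (Real.exp (l * T)) ≠ 0 := by simp [Real.exp_pos]
  have h2 := (ENNReal.mul_le_iff_le_inv hne ENNReal.ofReal_ne_top).1 (hmk.trans hprod)
  refine h2.trans (le_of_eq ?_)
  rw [← ENNReal.ofReal_inv_of_pos (Real.exp_pos _), ← Real.exp_neg,
    ← ENNReal.ofReal_pow (Real.exp_nonneg _), ← ENNReal.ofReal_mul (by positivity),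
    ← ENNReal.ofReal_mul (Real.exp_nonneg _), ← Real.exp_nat_mul, Real.exp_add]
  congr 1; ring

/-- Exponential inequality for a kernel-weighted sum localised at one of the observations. -/
theorem kernel_sum_tail {n : ℕ} {Z : Fin n → Ω → 𝒵} (hZ : ∀ i, Measurable (Z i))
    (hind : iIndepFun Z P) (k : Fin n) {V ψ : 𝒵 → ℝ} {wt : ℝ → ℝ} {κ h c C Cw β r t q : ℝ}
    (hV : Measurable V) (hψ : Measurable ψ) (hwt : Measurable wt) (hκ : ∀ x, |wt x| ≤ κ)
    (hκ0 : 0 < κ) (hc1 : c ≤ 1) (hC : 0 ≤ C) (hh : 0 ≤ h) (hCw : 0 ≤ Cw) (hβ : 0 ≤ β)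
    (hmom : ∀ i, CondLE P (fun ω => V (Z i ω))
      (fun ω => ENNReal.ofReal (ψ (Z i ω) ^ 2 * Real.exp (c * |ψ (Z i ω)|))) (ENNReal.ofReal C))
    (hw : ∀ i u, ∫⁻ ω, ENNReal.ofReal |wt ((V (Z i ω) - u) / h)| ∂P ≤ ENNReal.ofReal (Cw * h))
    (hbias : ∀ i u, |∫ ω, ψ (Z i ω) * wt ((V (Z i ω) - u) / h) ∂P| ≤ β * t * h)
    (hr : 0 ≤ r) (hrc : r ≤ c) (hrt : r ≤ t) :
    P {ω | n * h * ((κ * q + C * Cw + β) * t) ≤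
        |∑ i, ψ (Z i ω) * wt ((V (Z i ω) - V (Z k ω)) / h)|} ≤
      ENNReal.ofReal (2 * (Real.exp 1 + C) * Real.exp (-(n * h * r * t * q))) := by
  have hc : 0 ≤ c := hr.trans hrc
  have ht : 0 ≤ t := hr.trans hrt
  set T := n * h * ((κ * q + C * Cw + β) * t) with hT
  have hexp : -(r / κ * T) + n * (h * (r / κ * (β * t) + (r / κ) ^ 2 * κ * C * Cw)) ≤
      -(n * h * r * t * q) := by
    -- With Chernoff parameter l = r/κ, the β part of the threshold cancels the bias and the C·Cw
    -- part cancels the variance up to a term with factor r − t ≤ 0. The κq part is what remains as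
    -- decay.
    have e : -(r / κ * T) + n * (h * (r / κ * (β * t) + (r / κ) ^ 2 * κ * C * Cw)) =
        -(n * h * r * t * q) + n * h * (r / κ) * (C * Cw) * (r - t) := by
      rw [hT]; field_simp; ring
    rw [e]
    have : n * h * (r / κ) * (C * Cw) * (r - t) ≤ 0 :=
      mul_nonpos_of_nonneg_of_nonpos (by positivity) (by linarith)
    linarith
  have hlκ : r / κ * κ ≤ c := by rwa [div_mul_cancel₀ _ hκ0.ne']
  have hl : 0 ≤ r / κ := by positivity
  have hβt : 0 ≤ β * t := by positivity
  have h1 := kernel_sum_tail_upper (T := T) hZ hind k hV hψ hwt hκ hc hc1 hC hh hCw hβt hmom hw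
    (fun i u => (le_abs_self _).trans (hbias i u)) hl hlκ
  have h2 := kernel_sum_tail_upper (T := T) (ψ := fun z => -ψ z) hZ hind k hV hψ.neg hwt hκ hc hc1
    hC hh hCw hβt (by simpa using hmom) hw
    (fun i u => by
      have := (neg_le_abs _).trans (hbias i u)
      rw [← integral_neg] at this
      simpa only [neg_mul] using this) hl hlκ
  have hsub : {ω | T ≤ |∑ i, ψ (Z i ω) * wt ((V (Z i ω) - V (Z k ω)) / h)|} ⊆
      {ω | T ≤ ∑ i, ψ (Z i ω) * wt ((V (Z i ω) - V (Z k ω)) / h)} ∪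
      {ω | T ≤ ∑ i, -ψ (Z i ω) * wt ((V (Z i ω) - V (Z k ω)) / h)} := fun ω hω => by
    rcases le_abs.1 (show T ≤ _ from hω) with h | h
    · exact Or.inl h
    · right
      simpa only [mem_ofPred_eq, neg_mul, Finset.sum_neg_distrib] using h
  refine (measure_mono hsub).trans ((measure_union_le _ _).trans ((add_le_add h1 h2).trans ?_))
  rw [← ENNReal.ofReal_add (by positivity) (by positivity)]
  refine ENNReal.ofReal_le_ofReal ?_
  have h3 := mul_le_mul_of_nonneg_left (Real.exp_le_exp.2 hexp)
    (show 0 ≤ 2 * (Real.exp 1 + C) by positivity)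
  linarith

end Concentration

/-! ### From conditional moments to exponential moments -/

section Moments

variable {Ω : Type*} [MeasurableSpace Ω] {P : Measure Ω}

/-- The bound passes through pointwise domination by an affine function of a controlled variable;
later uses bound truncated variables, truncation errors and absolute values by powers |ξ|^m. -/
theorem CondLE.affine {V : Ω → ℝ} (hV : Measurable V) {f g : Ω → ℝ} {a b C : ℝ} (ha : 0 ≤ a)
    (hb : 0 ≤ b) (hC : 0 ≤ C) (hg : CondLE P V (fun ω => ENNReal.ofReal (g ω)) (ENNReal.ofReal C))
    (hfg : ∀ᵐ ω ∂P, 0 ≤ g ω ∧ f ω ≤ a + b * g ω) :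
    CondLE P V (fun ω => ENNReal.ofReal (f ω)) (ENNReal.ofReal (a + b * C)) := fun p hp => by
  have hpV : Measurable fun ω => p (V ω) := hp.comp hV
  calc ∫⁻ ω, ENNReal.ofReal (f ω) * p (V ω) ∂P
      ≤ ∫⁻ ω, (ENNReal.ofReal a * p (V ω) +
          ENNReal.ofReal b * (ENNReal.ofReal (g ω) * p (V ω))) ∂P := by
        refine lintegral_mono_ae (hfg.mono fun ω hω => ?_)
        rw [← mul_assoc, ← add_mul, ← ENNReal.ofReal_mul hb,
          ← ENNReal.ofReal_add ha (mul_nonneg hb hω.1)]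
        exact mul_le_mul_left (ENNReal.ofReal_le_ofReal hω.2) _
    _ = ENNReal.ofReal a * ∫⁻ ω, p (V ω) ∂P +
          ENNReal.ofReal b * ∫⁻ ω, ENNReal.ofReal (g ω) * p (V ω) ∂P := by
        rw [lintegral_add_left (hpV.const_mul _), lintegral_const_mul _ hpV,
          lintegral_const_mul' _ _ ENNReal.ofReal_ne_top]
    _ ≤ ENNReal.ofReal a * ∫⁻ ω, p (V ω) ∂P +
          ENNReal.ofReal b * (ENNReal.ofReal C * ∫⁻ ω, p (V ω) ∂P) :=
        add_le_add_right (mul_le_mul_right (hg p hp) _) _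
    _ = _ := by
        rw [← mul_assoc, ← add_mul, ← ENNReal.ofReal_mul hb, ← ENNReal.ofReal_add ha (by positivity)]

theorem CondLE.congr {V : Ω → ℝ} {f g : Ω → ℝ≥0∞} {C : ℝ≥0∞} (h : CondLE P V f C)
    (hfg : f =ᵐ[P] g) : CondLE P V g C := fun p hp => by
  refine le_trans (le_of_eq ?_) (h p hp)
  exact lintegral_congr_ae (hfg.mono fun ω hω => by simp only [hω])

/-- An almost sure bound on a conditional expectation gives the integrated bound. -/
theorem condLE_of_condExp_le [IsProbabilityMeasure P] {V f : Ω → ℝ} {C : ℝ} (hV : Measurable V)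
    (hf0 : ∀ ω, 0 ≤ f ω) (hf : Integrable f P)
    (h : ∀ᵐ ω ∂P, (P[f | MeasurableSpace.comap V inferInstance]) ω ≤ C) :
    CondLE P V (fun ω => ENNReal.ofReal (f ω)) (ENNReal.ofReal C) := fun p hp => by
  have hfm : AEMeasurable (fun ω => ENNReal.ofReal (f ω)) P :=
    hf.aestronglyMeasurable.aemeasurable.ennreal_ofReal
  have hm : MeasurableSpace.comap V inferInstance ≤ (inferInstance : MeasurableSpace Ω) :=
    hV.comap_le
  -- The claim is a comparison of two measures on the line. It can be checked on Borel sets, where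
  -- it is the defining property of conditional expectation.
  have hle : (P.withDensity fun ω => ENNReal.ofReal (f ω)).map V ≤
      ENNReal.ofReal C • P.map V := by
    refine Measure.le_iff.2 fun A hA => ?_
    have hVA : MeasurableSet (V ⁻¹' A) := hV hA
    rw [Measure.map_apply hV hA, withDensity_apply _ hVA, Measure.smul_apply,
      Measure.map_apply hV hA, smul_eq_mul,
      ← ofReal_integral_eq_lintegral_ofReal hf.integrableOn (ae_of_all _ hf0),
      ← setIntegral_condExp hm hf ⟨A, hA, rfl⟩]
    have h1 : ∫ ω in V ⁻¹' A, (P[f | MeasurableSpace.comap V inferInstance]) ω ∂P ≤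
        ∫ _ in V ⁻¹' A, C ∂P :=
      setIntegral_mono_ae integrable_condExp.integrableOn (integrable_const C).integrableOn h
    refine (ENNReal.ofReal_le_ofReal h1).trans ?_
    rw [setIntegral_const, smul_eq_mul, mul_comm, Measure.real]
    rcases le_total 0 C with hC | hC
    · rw [ENNReal.ofReal_mul hC, ENNReal.ofReal_toReal (measure_ne_top _ _)]
    · rw [ENNReal.ofReal_of_nonpos (mul_nonpos_of_nonpos_of_nonneg hC ENNReal.toReal_nonneg)]
      exact zero_le
  have h1 : ∫⁻ v, p v ∂((P.withDensity fun ω => ENNReal.ofReal (f ω)).map V) ≤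
      ∫⁻ v, p v ∂(ENNReal.ofReal C • P.map V) := lintegral_mono' hle le_rfl
  rw [lintegral_map hp hV, lintegral_smul_measure, lintegral_map hp hV, smul_eq_mul] at h1
  refine le_trans (le_of_eq ?_) h1
  exact (lintegral_withDensity_eq_lintegral_mul₀ hfm (hp.comp hV).aemeasurable).symm

/-- Bernstein-type conditional moments give a conditional exponential moment. -/
theorem condLE_exp_of_bernstein {V ξ : Ω → ℝ} {M : ℝ} (hV : Measurable V) (hξ : Measurable ξ)
    (hM : 0 ≤ M)
    (h : ∀ m : ℕ, 2 ≤ m → CondLE P V (fun ω => ENNReal.ofReal (|ξ ω| ^ m))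
      (ENNReal.ofReal (M * m.factorial / 2))) :
    CondLE P V (fun ω => ENNReal.ofReal (ξ ω ^ 2 * Real.exp (1 / 2 * |ξ ω|)))
      (ENNReal.ofReal (8 * M)) := fun p hp => by
  have hexp : ∀ ω, ENNReal.ofReal (ξ ω ^ 2 * Real.exp (1 / 2 * |ξ ω|)) =
      ∑' m : ℕ, ENNReal.ofReal ((1 / 2) ^ m / m.factorial) * ENNReal.ofReal (|ξ ω| ^ (m + 2)) :=
    fun ω => by
      have hs : HasSum (fun m : ℕ => (1 / 2) ^ m / m.factorial * |ξ ω| ^ (m + 2))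
          (ξ ω ^ 2 * Real.exp (1 / 2 * |ξ ω|)) := by
        have h1 := (NormedSpace.exp_series_hasSum_exp' (𝕂 := ℝ) (1 / 2 * |ξ ω|)).mul_left (ξ ω ^ 2)
        rw [← Real.exp_eq_exp_ℝ] at h1
        refine h1.congr_fun fun m => ?_
        rw [← sq_abs, smul_eq_mul, mul_pow, pow_add]
        ring
      rw [← hs.tsum_eq, ENNReal.ofReal_tsum_of_nonneg (fun m => by positivity) hs.summable]
      exact tsum_congr fun m => ENNReal.ofReal_mul (by positivity)
  have hterm : ∀ m : ℕ, ENNReal.ofReal ((1 / 2) ^ m / m.factorial) *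
      ENNReal.ofReal (M * (m + 2).factorial / 2) =
        ENNReal.ofReal (M * ((m + 2).choose 2 * (1 / 2) ^ m)) := fun m => by
    rw [← ENNReal.ofReal_mul (by positivity)]
    congr 1
    have h1 : ((m + 2).choose 2 : ℝ) * (2 * m.factorial) = (m + 2).factorial := by
      have := Nat.add_choose_mul_factorial_mul_factorial m 2
      rw [Nat.factorial_two] at this
      rw [← this]; push_cast; ring
    have h2 : (m.factorial : ℝ) ≠ 0 := by positivity
    rw [← h1]; field_simp
  have hpV : Measurable fun ω => p (V ω) := hp.comp hV
  -- The exponential series of x² exp(|x|/2) pairs 2^{−m}/m! with the moment of order m + 2, leaving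
  -- binom(m + 2, 2) 2^{−m}. Its sum is (1 − 1/2)^{−3} = 8.
  have hsum : HasSum (fun m : ℕ => M * ((m + 2).choose 2 * (1 / 2 : ℝ) ^ m)) (8 * M) := by
    have h1 := (summable_choose_mul_geometric_of_norm_lt_one (R := ℝ) 2
      (r := 1 / 2) (by norm_num)).hasSum
    rw [tsum_choose_mul_geometric_of_norm_lt_one 2 (by norm_num)] at h1
    have h2 := h1.mul_left M
    have e : M * (1 / (1 - 1 / 2 : ℝ) ^ (2 + 1)) = 8 * M := by norm_num [mul_comm]
    rw [e] at h2
    exact h2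
  calc _ = ∫⁻ ω, ∑' m : ℕ, ENNReal.ofReal ((1 / 2) ^ m / m.factorial) *
          (ENNReal.ofReal (|ξ ω| ^ (m + 2)) * p (V ω)) ∂P := by
        refine lintegral_congr fun ω => ?_
        simp only [hexp, ← ENNReal.tsum_mul_right, mul_assoc]
    _ = ∑' m : ℕ, ENNReal.ofReal ((1 / 2) ^ m / m.factorial) *
          ∫⁻ ω, ENNReal.ofReal (|ξ ω| ^ (m + 2)) * p (V ω) ∂P := by
        rw [lintegral_tsum fun m => by fun_prop]
        exact tsum_congr fun m => lintegral_const_mul' _ _ ENNReal.ofReal_ne_top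
    _ ≤ ∑' m : ℕ, ENNReal.ofReal (M * ((m + 2).choose 2 * (1 / 2) ^ m)) *
          ∫⁻ ω, p (V ω) ∂P := by
        refine ENNReal.tsum_le_tsum fun m => ?_
        rw [← hterm, mul_assoc]
        exact mul_le_mul_right (h (m + 2) (by omega) p hp) _
    _ = _ := by
        rw [ENNReal.tsum_mul_right, ← hsum.tsum_eq,
          ENNReal.ofReal_tsum_of_nonneg (fun m => by positivity) hsum.summable]

/-- Truncation of `x` at level `B`. -/
noncomputable def trunc (B x : ℝ) : ℝ := if |x| ≤ B then x else 0

theorem measurable_trunc (B : ℝ) : Measurable (trunc B) :=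
  Measurable.ite (measurableSet_le measurable_abs measurable_const) measurable_id measurable_const

theorem abs_trunc_le {B : ℝ} (hB : 0 ≤ B) (x : ℝ) : |trunc B x| ≤ B := by
  unfold trunc; split_ifs with h
  · exact h
  · simpa using hB

theorem sq_trunc_le {m : ℝ} (hm : 2 ≤ m) (B x : ℝ) : trunc B x ^ 2 ≤ 1 + |x| ^ m := by
  have h0 : 0 ≤ |x| ^ m := Real.rpow_nonneg (abs_nonneg _) _
  have h1 : x ^ 2 ≤ 1 + |x| ^ m := by
    rw [← sq_abs]
    rcases le_total |x| 1 with h | h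
    · have := pow_le_one₀ (n := 2) (abs_nonneg x) h; linarith
    · have : |x| ^ (2 : ℝ) ≤ |x| ^ m := Real.rpow_le_rpow_of_exponent_le h hm
      rw [Real.rpow_two] at this; linarith
  unfold trunc; split_ifs
  · exact h1
  · simp only [ne_eq, OfNat.ofNat_ne_zero, not_false_eq_true, zero_pow]; linarith

/-- The error vanishes up to level `B`; beyond it, |x| = |x|^{1−m}|x|^m and the first factor is
decreasing. -/
theorem abs_sub_trunc_le {m B : ℝ} (hm : 1 ≤ m) (hB : 0 < B) (x : ℝ) :
    |x - trunc B x| ≤ B ^ (1 - m) * |x| ^ m := by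
  unfold trunc; split_ifs with h
  · simp only [sub_self, abs_zero]; positivity
  · rw [not_le] at h
    have hx : 0 < |x| := hB.trans h
    rw [sub_zero]
    have h1 : |x| ^ (1 - m) ≤ B ^ (1 - m) :=
      Real.rpow_le_rpow_of_nonpos hB h.le (by linarith)
    calc |x| = |x| ^ (1 - m) * |x| ^ m := by
          rw [← Real.rpow_add hx]; simp
      _ ≤ _ := mul_le_mul_of_nonneg_right h1 (Real.rpow_nonneg hx.le _)

/-- Truncation at `B` makes the exponential of rate B⁻¹ at most e, so the resulting constant does
not depend on `B`. -/
theorem condLE_exp_trunc {V ξ : Ω → ℝ} {m C B : ℝ} (hV : Measurable V) (hm : 2 ≤ m) (hC : 0 ≤ C)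
    (hB : 0 < B) (h : CondLE P V (fun ω => ENNReal.ofReal (|ξ ω| ^ m)) (ENNReal.ofReal C)) :
    CondLE P V (fun ω => ENNReal.ofReal
      (trunc B (ξ ω) ^ 2 * Real.exp (B⁻¹ * |trunc B (ξ ω)|)))
      (ENNReal.ofReal (Real.exp 1 + Real.exp 1 * C)) := by
  refine h.affine hV (Real.exp_nonneg 1) (Real.exp_nonneg 1) hC (ae_of_all _ fun ω => ⟨?_, ?_⟩)
  · positivity
  · have h1 : Real.exp (B⁻¹ * |trunc B (ξ ω)|) ≤ Real.exp 1 := by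
      refine Real.exp_le_exp.2 ?_
      rw [inv_mul_le_iff₀ hB, mul_one]; exact abs_trunc_le hB.le _
    calc _ ≤ (1 + |ξ ω| ^ m) * Real.exp 1 :=
          mul_le_mul (sq_trunc_le hm B _) h1 (Real.exp_nonneg _) (by positivity)
      _ = _ := by ring

theorem abs_integral_mul_weight_le {V ξ : Ω → ℝ} {wt : ℝ → ℝ} {D Cw h u : ℝ} (hD : 0 ≤ D)
    (hCw : 0 ≤ Cw * h) (hwt : Measurable wt)
    (hξ : CondLE P V (fun ω => ENNReal.ofReal |ξ ω|) (ENNReal.ofReal D))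
    (hw : ∫⁻ ω, ENNReal.ofReal |wt ((V ω - u) / h)| ∂P ≤ ENNReal.ofReal (Cw * h)) :
    |∫ ω, ξ ω * wt ((V ω - u) / h) ∂P| ≤ D * (Cw * h) := by
  rw [← Real.norm_eq_abs, ← ENNReal.ofReal_le_ofReal_iff (by positivity)]
  rw [ofReal_norm]
  refine (enorm_integral_le_lintegral_enorm _).trans ?_
  have h1 := hξ (fun v => ENNReal.ofReal |wt ((v - u) / h)|) (by fun_prop)
  rw [ENNReal.ofReal_mul hD]
  refine le_trans (le_of_eq ?_) (h1.trans (mul_le_mul_right hw _))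
  refine lintegral_congr fun ω => ?_
  rw [enorm_mul, Real.enorm_eq_ofReal_abs, Real.enorm_eq_ofReal_abs]

/-- Markov's inequality for absolute moments. -/
theorem measure_abs_gt_le [IsProbabilityMeasure P] {V ξ : Ω → ℝ} {m C B : ℝ} (hξ : Measurable ξ)
    (hm : 0 < m) (hB : 0 < B)
    (h : CondLE P V (fun ω => ENNReal.ofReal (|ξ ω| ^ m)) (ENNReal.ofReal C)) :
    P {ω | B < |ξ ω|} ≤ ENNReal.ofReal (C * B⁻¹ ^ m) := by
  have h1 := mul_meas_ge_le_lintegral (μ := P)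
    (f := fun ω => ENNReal.ofReal (|ξ ω| ^ m)) (by fun_prop) (ENNReal.ofReal (B ^ m))
  have hsub : {ω | B < |ξ ω|} ⊆ {ω | ENNReal.ofReal (B ^ m) ≤ ENNReal.ofReal (|ξ ω| ^ m)} :=
    fun ω hω => ENNReal.ofReal_le_ofReal (Real.rpow_le_rpow hB.le (le_of_lt hω) hm.le)
  refine (measure_mono hsub).trans ?_
  have hpos : 0 < B ^ m := Real.rpow_pos_of_pos hB m
  have h2 := (ENNReal.mul_le_iff_le_inv (by simpa using hpos) ENNReal.ofReal_ne_top).1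
    (h1.trans h.lintegral_le)
  refine h2.trans (le_of_eq ?_)
  rw [← ENNReal.ofReal_inv_of_pos hpos, ← ENNReal.ofReal_mul (by positivity),
    Real.inv_rpow hB.le, mul_comm]

end Moments

/-! ### Uniform bounds for kernel means -/

/-- A kernel-weighted mean localised at the `k`-th observation. -/
noncomputable def kernelMean {Ω 𝒵 : Type*} {n : ℕ} (Z : Fin n → Ω → 𝒵) (V : 𝒵 → ℝ) (wt : ℝ → ℝ)
    (h : ℝ) (ψ : 𝒵 → ℝ) (k : Fin n) (ω : Ω) : ℝ :=
  ∑ i, 1 / (n : ℝ) * (1 / h * wt ((V (Z i ω) - V (Z k ω)) / h)) * ψ (Z i ω)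

theorem kernelMean_eq {Ω 𝒵 : Type*} {n : ℕ} (Z : Fin n → Ω → 𝒵) (V : 𝒵 → ℝ) (wt : ℝ → ℝ)
    (h : ℝ) (ψ : 𝒵 → ℝ) (k : Fin n) (ω : Ω) :
    kernelMean Z V wt h ψ k ω =
      (∑ i, ψ (Z i ω) * wt ((V (Z i ω) - V (Z k ω)) / h)) / (n * h) := by
  unfold kernelMean
  rw [Finset.sum_div]
  refine Finset.sum_congr rfl fun i _ => ?_
  rw [div_mul_eq_div_div]
  ring

theorem measure_exists_le {Ω α : Type*} [MeasurableSpace Ω] {P : Measure Ω} [Fintype α]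
    (s : α → Set Ω) {b : ℝ} (hs : ∀ a, P (s a) ≤ ENNReal.ofReal b) :
    P {ω | ∃ a, ω ∈ s a} ≤ ENNReal.ofReal (Fintype.card α * b) := by
  have e : {ω | ∃ a, ω ∈ s a} = ⋃ a, s a := by ext ω; simp
  rw [e]
  refine (measure_iUnion_fintype_le P s).trans ((Finset.sum_le_sum fun a _ => hs a).trans ?_)
  rw [Finset.sum_const, Finset.card_univ, nsmul_eq_mul, ENNReal.ofReal_mul (Nat.cast_nonneg _),
    ENNReal.ofReal_natCast]

section Arrays

variable {Ω : ℕ → Type*} [∀ n, MeasurableSpace (Ω n)] {P : ∀ n, Measure (Ω n)}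
  {𝒵 : ℕ → Type*} [∀ n, MeasurableSpace (𝒵 n)]

/-- Row-wise independent observations `Z n i` with index variable `V n (Z n i)`, and a bounded
weight function whose rescaled absolute moments are of the order of the bandwidth. -/
structure IsKernelArray (P : ∀ n, Measure (Ω n)) (Z : ∀ n, Fin n → Ω n → 𝒵 n)
    (V : ∀ n, 𝒵 n → ℝ) (h : ℕ → ℝ) (wt : ℝ → ℝ) (κ Cw : ℝ) : Prop where
  measurable_obs : ∀ n i, Measurable (Z n i)
  indep : ∀ n, iIndepFun (Z n) (P n)
  measurable_index : ∀ n, Measurable (V n)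
  measurable_weight : Measurable wt
  abs_weight_le : ∀ x, |wt x| ≤ κ
  bound_pos : 0 < κ
  moment_nonneg : 0 ≤ Cw
  bandwidth_pos : ∀ᶠ n in atTop, 0 < h n
  weight_moment : ∀ n i u, 0 < h n →
    ∫⁻ ω, ENNReal.ofReal |wt ((V n (Z n i ω) - u) / h n)| ∂(P n) ≤ ENNReal.ofReal (Cw * h n)

variable [∀ n, IsProbabilityMeasure (P n)] {ι : ℕ → Type*} [∀ n, Fintype (ι n)]
  {Z : ∀ n, Fin n → Ω n → 𝒵 n} {V : ∀ n, 𝒵 n → ℝ} {h : ℕ → ℝ} {wt : ℝ → ℝ} {κ Cw : ℝ}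

/-- Union bound of the exponential inequality over the n·|ι| pairs of localisation point and
function. The sequence `r` is the Chernoff scale: it may exceed neither the available exponential
rate `c` nor the target level `t`. -/
theorem IsKernelArray.tendsto_measure_kernelMean (hA : IsKernelArray P Z V h wt κ Cw)
    {ψ : ∀ n, ι n → 𝒵 n → ℝ} (hψ : ∀ n j, Measurable (ψ n j)) {C β q : ℝ} {c r t : ℕ → ℝ}
    (hC : 0 ≤ C) (hβ : 0 ≤ β)
    (hmom : ∀ᶠ n in atTop, ∀ i j, CondLE (P n) (fun ω => V n (Z n i ω))
      (fun ω => ENNReal.ofReal (ψ n j (Z n i ω) ^ 2 * Real.exp (c n * |ψ n j (Z n i ω)|)))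
      (ENNReal.ofReal C))
    (hbias : ∀ᶠ n in atTop, ∀ i j u,
      |∫ ω, ψ n j (Z n i ω) * wt ((V n (Z n i ω) - u) / h n) ∂(P n)| ≤ β * t n * h n)
    (hrc : ∀ᶠ n in atTop, 0 ≤ r n ∧ r n ≤ c n ∧ r n ≤ t n ∧ c n ≤ 1)
    (hrate : Tendsto (fun n : ℕ => (n : ℝ) * Fintype.card (ι n) *
      Real.exp (-(n * h n * r n * t n * q))) atTop (𝓝 0)) :
    Tendsto (fun n => P n {ω | ∃ k j, (κ * q + C * Cw + β) * t n <
      |kernelMean (Z n) (V n) wt (h n) (ψ n j) k ω|}) atTop (𝓝 0) := by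
  have hlim : Tendsto (fun n : ℕ => ENNReal.ofReal (2 * (Real.exp 1 + C) *
      ((n : ℝ) * Fintype.card (ι n) * Real.exp (-(n * h n * r n * t n * q))))) atTop (𝓝 0) := by
    have := ENNReal.tendsto_ofReal (hrate.const_mul (2 * (Real.exp 1 + C)))
    simpa using this
  refine tendsto_of_tendsto_of_tendsto_of_le_of_le' tendsto_const_nhds hlim
    (Eventually.of_forall fun n => zero_le) ?_
  filter_upwards [hmom, hbias, hrc, hA.bandwidth_pos, eventually_gt_atTop 0] with
    n hmom hbias ⟨hr, hrc, hrt, hc1⟩ hh hn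
  have hnh : 0 < (n : ℝ) * h n := by positivity
  have hb : ∀ p : Fin n × ι n, P n {ω | n * h n * ((κ * q + C * Cw + β) * t n) ≤
      |∑ i, ψ n p.2 (Z n i ω) * wt ((V n (Z n i ω) - V n (Z n p.1 ω)) / h n)|} ≤
      ENNReal.ofReal (2 * (Real.exp 1 + C) * Real.exp (-(n * h n * r n * t n * q))) := fun p =>
    kernel_sum_tail (hA.measurable_obs n) (hA.indep n) p.1 (hA.measurable_index n) (hψ n p.2)
      hA.measurable_weight hA.abs_weight_le hA.bound_pos hc1 hC hh.le hA.moment_nonneg hβ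
      (fun i => hmom i p.2) (fun i u => hA.weight_moment n i u hh) (fun i u => hbias i p.2 u)
      hr hrc hrt
  have hex := measure_exists_le _ hb
  have hcard : (Fintype.card (Fin n × ι n) : ℝ) *
      (2 * (Real.exp 1 + C) * Real.exp (-(n * h n * r n * t n * q))) = 2 * (Real.exp 1 + C) *
      ((n : ℝ) * Fintype.card (ι n) * Real.exp (-(n * h n * r n * t n * q))) := by
    rw [Fintype.card_prod, Fintype.card_fin, Nat.cast_mul]; ring
  rw [hcard] at hex
  refine le_trans (measure_mono ?_) hex
  intro ω hω
  obtain ⟨k, j, hkj⟩ := hω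
  refine ⟨(k, j), ?_⟩
  rw [kernelMean_eq, abs_div, abs_of_pos hnh, lt_div_iff₀ hnh, mul_comm] at hkj
  exact hkj.le

/-- Uniform rate for kernel means under conditional exponential moments. -/
theorem IsKernelArray.exists_bound_of_exp_moment (hA : IsKernelArray P Z V h wt κ Cw)
    {ψ : ∀ n, ι n → 𝒵 n → ℝ} (hψ : ∀ n j, Measurable (ψ n j)) {C β : ℝ} {t : ℕ → ℝ}
    (hC : 0 ≤ C) (hβ : 0 ≤ β)
    (hmom : ∀ n i j, CondLE (P n) (fun ω => V n (Z n i ω))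
      (fun ω => ENNReal.ofReal (ψ n j (Z n i ω) ^ 2 * Real.exp (1 / 2 * |ψ n j (Z n i ω)|)))
      (ENNReal.ofReal C))
    (hbias : ∀ᶠ n in atTop, ∀ i j u,
      |∫ ω, ψ n j (Z n i ω) * wt ((V n (Z n i ω) - u) / h n) ∂(P n)| ≤ β * t n * h n)
    (ht : ∀ᶠ n in atTop, 0 ≤ t n ∧ t n ≤ 1)
    (hrate : ∃ q, Tendsto (fun n : ℕ => (n : ℝ) * Fintype.card (ι n) *
      Real.exp (-(n * h n * (t n / 2) * t n * q))) atTop (𝓝 0)) :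
    ∃ A, Tendsto (fun n => P n {ω | ∃ k j, A * t n <
      |kernelMean (Z n) (V n) wt (h n) (ψ n j) k ω|}) atTop (𝓝 0) := by
  obtain ⟨q, hq⟩ := hrate
  -- Since t ≤ 1, the scale t/2 lies below both the rate 1/2 and `t`.
  refine ⟨_, hA.tendsto_measure_kernelMean (c := fun _ => 1 / 2) (r := fun n => t n / 2) hψ hC hβ
    (Eventually.of_forall hmom) hbias ?_ hq⟩
  filter_upwards [ht] with n hn
  refine ⟨by linarith [hn.1], by linarith [hn.2], by linarith [hn.1], by norm_num⟩

/-- Uniform rate for kernel means under polynomial conditional moments. -/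
theorem IsKernelArray.exists_bound_of_poly_moment (hA : IsKernelArray P Z V h wt κ Cw)
    {ψ : ∀ n, ι n → 𝒵 n → ℝ} (hψ : ∀ n j, Measurable (ψ n j)) {m C β : ℝ} {t ρ : ℕ → ℝ}
    (hm : 2 ≤ m) (hC : 0 ≤ C) (hβ : 0 ≤ β)
    (hmom : ∀ n i j, CondLE (P n) (fun ω => V n (Z n i ω))
      (fun ω => ENNReal.ofReal (|ψ n j (Z n i ω)| ^ m)) (ENNReal.ofReal C))
    (hbias : ∀ᶠ n in atTop, ∀ i j u,
      |∫ ω, ψ n j (Z n i ω) * wt ((V n (Z n i ω) - u) / h n) ∂(P n)| ≤ β * t n * h n)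
    (hρ : ∀ᶠ n in atTop, 0 < ρ n ∧ ρ n ≤ 1 ∧ ρ n ≤ t n)
    (htrunc : Tendsto (fun n : ℕ => (n : ℝ) * Fintype.card (ι n) * ρ n ^ m) atTop (𝓝 0))
    (hrate : ∃ q, Tendsto (fun n : ℕ => (n : ℝ) * Fintype.card (ι n) *
      Real.exp (-(n * h n * ρ n * t n * q))) atTop (𝓝 0)) :
    ∃ A, Tendsto (fun n => P n {ω | ∃ k j, A * t n <
      |kernelMean (Z n) (V n) wt (h n) (ψ n j) k ω|}) atTop (𝓝 0) := by
  obtain ⟨q, hq⟩ := hrate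
  have hVm : ∀ n i, Measurable fun ω => V n (Z n i ω) := fun n i =>
    (hA.measurable_index n).comp (hA.measurable_obs n i)
  have hψm : ∀ n i j, Measurable fun ω => ψ n j (Z n i ω) := fun n i j =>
    (hψ n j).comp (hA.measurable_obs n i)
  have hint : ∀ n i j, Integrable (fun ω => ψ n j (Z n i ω)) (P n) := fun n i j => by
    have h1 := (hmom n i j).lintegral_le
    have h2 : Integrable (fun ω => |ψ n j (Z n i ω)| ^ m) (P n) := by
      refine ⟨((hψm n i j).abs.pow_const m).aestronglyMeasurable, ?_⟩
      rw [hasFiniteIntegral_iff_ofReal (ae_of_all _ fun ω => by positivity)]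
      exact h1.trans_lt ENNReal.ofReal_lt_top
    refine ((integrable_const (1 : ℝ)).add h2).mono' (hψm n i j).aestronglyMeasurable
      (ae_of_all _ fun ω => ?_)
    have h3 := abs_sub_trunc_le (m := m) (by linarith) one_pos (ψ n j (Z n i ω))
    have h4 := abs_trunc_le zero_le_one (ψ n j (Z n i ω))
    have h5 := abs_sub_abs_le_abs_sub (ψ n j (Z n i ω)) (trunc 1 (ψ n j (Z n i ω)))
    simp only [Real.one_rpow, one_mul, Pi.add_apply, Real.norm_eq_abs] at *
    linarith
  have hC' : 0 ≤ Real.exp 1 + Real.exp 1 * C := by positivity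
  have hβ' : 0 ≤ β + C * Cw := add_nonneg hβ (mul_nonneg hC hA.moment_nonneg)
  -- Truncating at 1/ρ gives exponential moments at rate ρ, so rate and Chernoff scale are both ρ.
  have hmain := hA.tendsto_measure_kernelMean (q := q) (c := ρ) (r := ρ) (t := t)
    (ψ := fun n j z => trunc (ρ n)⁻¹ (ψ n j z))
    (fun n j => (measurable_trunc _).comp (hψ n j)) hC' hβ' ?_ ?_ ?_ hq
  rotate_left
  · filter_upwards [hρ] with n hn i j
    have := condLE_exp_trunc (hVm n i) hm hC (inv_pos.2 hn.1) (hmom n i j)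
    rwa [inv_inv] at this
  · filter_upwards [hbias, hρ, hA.bandwidth_pos] with n hbias hn hh i j u
    have hB : 0 < (ρ n)⁻¹ := inv_pos.2 hn.1
    have hwm : Measurable fun ω => wt ((V n (Z n i ω) - u) / h n) :=
      hA.measurable_weight.comp (((hVm n i).sub_const u).div_const _)
    have htm : Measurable fun ω => trunc (ρ n)⁻¹ (ψ n j (Z n i ω)) :=
      (measurable_trunc _).comp (hψm n i j)
    have hti : Integrable (fun ω => trunc (ρ n)⁻¹ (ψ n j (Z n i ω))) (P n) :=
      (integrable_const (ρ n)⁻¹).mono' htm.aestronglyMeasurable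
        (ae_of_all _ fun ω => abs_trunc_le hB.le _)
    have h1 : Integrable (fun ω => ψ n j (Z n i ω) * wt ((V n (Z n i ω) - u) / h n)) (P n) :=
      (hint n i j).mul_bdd hwm.aestronglyMeasurable (ae_of_all _ fun ω => hA.abs_weight_le _)
    have h2 : Integrable (fun ω => trunc (ρ n)⁻¹ (ψ n j (Z n i ω)) *
        wt ((V n (Z n i ω) - u) / h n)) (P n) :=
      hti.mul_bdd hwm.aestronglyMeasurable (ae_of_all _ fun ω => hA.abs_weight_le _)
    -- The truncation bias is of order ρ^{m−1}, at most ρ ≤ t because m ≥ 2 and ρ ≤ 1; it only adds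
    -- C·Cw to the bias constant.
    have hpow : (ρ n)⁻¹ ^ (1 - m) ≤ t n := by
      rw [Real.inv_rpow hn.1.le, ← Real.rpow_neg hn.1.le, neg_sub]
      refine le_trans ?_ hn.2.2
      have := Real.rpow_le_rpow_of_exponent_ge hn.1 hn.2.1 (show (1 : ℝ) ≤ m - 1 by linarith)
      rwa [Real.rpow_one] at this
    have hp0 : 0 ≤ (ρ n)⁻¹ ^ (1 - m) := by positivity
    have hd := (hmom n i j).affine (hVm n i) (f := fun ω =>
        |ψ n j (Z n i ω) - trunc (ρ n)⁻¹ (ψ n j (Z n i ω))|) le_rfl hp0 hC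
      (ae_of_all _ fun ω => ⟨by positivity, by
        rw [zero_add]; exact abs_sub_trunc_le (by linarith) hB _⟩)
    rw [zero_add] at hd
    have hCwh : 0 ≤ Cw * h n := mul_nonneg hA.moment_nonneg hh.le
    have h3 := abs_integral_mul_weight_le (mul_nonneg hp0 hC) hCwh hA.measurable_weight hd
      (hA.weight_moment n i u hh)
    have e : ∫ ω, trunc (ρ n)⁻¹ (ψ n j (Z n i ω)) * wt ((V n (Z n i ω) - u) / h n) ∂(P n) =
        ∫ ω, ψ n j (Z n i ω) * wt ((V n (Z n i ω) - u) / h n) ∂(P n) -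
        ∫ ω, (ψ n j (Z n i ω) - trunc (ρ n)⁻¹ (ψ n j (Z n i ω))) *
          wt ((V n (Z n i ω) - u) / h n) ∂(P n) := by
      simp only [sub_mul]
      rw [integral_sub h1 h2]; ring
    rw [e]
    refine (abs_sub _ _).trans ((add_le_add (hbias i j u) h3).trans ?_)
    have h4 := mul_le_mul_of_nonneg_right hpow (mul_nonneg hC hCwh)
    linarith
  · filter_upwards [hρ] with n hn
    exact ⟨hn.1.le, le_rfl, hn.2.2, hn.2.1⟩
  refine ⟨κ * q + (Real.exp 1 + Real.exp 1 * C) * Cw + (β + C * Cw), ?_⟩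
  have hlim : Tendsto (fun n : ℕ => ENNReal.ofReal (C * ((n : ℝ) * Fintype.card (ι n) * ρ n ^ m)))
      atTop (𝓝 0) := by
    simpa using ENNReal.tendsto_ofReal (htrunc.const_mul C)
  have hsum := hlim.add hmain
  rw [add_zero] at hsum
  refine tendsto_of_tendsto_of_tendsto_of_le_of_le' tendsto_const_nhds hsum
    (Eventually.of_forall fun n => zero_le) ?_
  filter_upwards [hρ] with n hn
  have hB : 0 < (ρ n)⁻¹ := inv_pos.2 hn.1
  -- Markov and a union bound: with probability tending to one no variable is truncated, and then
  -- the truncated and original kernel means coincide.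
  have h1 : P n {ω | ∃ p : Fin n × ι n, ω ∈ {ω | (ρ n)⁻¹ < |ψ n p.2 (Z n p.1 ω)|}} ≤
      ENNReal.ofReal (C * ((n : ℝ) * Fintype.card (ι n) * ρ n ^ m)) := by
    have hb : ∀ p : Fin n × ι n, P n {ω | (ρ n)⁻¹ < |ψ n p.2 (Z n p.1 ω)|} ≤
        ENNReal.ofReal (C * (ρ n)⁻¹⁻¹ ^ m) := fun p =>
      measure_abs_gt_le (hψm n p.1 p.2) (by linarith) hB (hmom n p.1 p.2)
    refine (measure_exists_le _ hb).trans (le_of_eq ?_)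
    congr 1
    rw [Fintype.card_prod, Fintype.card_fin, inv_inv, Nat.cast_mul]; ring
  refine le_trans ?_ (add_le_add_left h1 _)
  refine le_trans (measure_mono ?_) (measure_union_le _ _)
  rintro ω ⟨k, j, hkj⟩
  by_cases hω : ∃ p : Fin n × ι n, (ρ n)⁻¹ < |ψ n p.2 (Z n p.1 ω)|
  · exact Or.inl hω
  · right
    push Not at hω
    refine ⟨k, j, ?_⟩
    have e : kernelMean (Z n) (V n) wt (h n) (fun z => trunc (ρ n)⁻¹ (ψ n j z)) k ω =
        kernelMean (Z n) (V n) wt (h n) (ψ n j) k ω := by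
      unfold kernelMean
      refine Finset.sum_congr rfl fun i _ => ?_
      simp only [trunc, if_pos (hω (i, j))]
    rw [e]
    exact hkj

end Arrays

/-! ### Measurability and moments of the model variables -/

/-- A measurable version of the partial derivative in the first variable. -/
noncomputable def fderivFst (f : ℝ × ℝ → ℝ) (p : ℝ × ℝ) : ℝ :=
  limsup (fun k : ℕ => (f (p.1 + 1 / ((k : ℝ) + 1), p.2) - f p) / (1 / ((k : ℝ) + 1))) atTop

theorem measurable_fderivFst {f : ℝ × ℝ → ℝ} (hf : Measurable f) : Measurable (fderivFst f) := by
  refine Measurable.limsup fun k => ?_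
  refine Measurable.div_const (Measurable.sub (hf.comp ?_) hf) _
  exact (measurable_fst.add_const _).prodMk measurable_snd

theorem fderivFst_eq {f : ℝ × ℝ → ℝ} {s y f' : ℝ} (h : HasDerivAt (fun t => f (t, y)) f' s) :
    fderivFst f (s, y) = f' := by
  have h1 := h.tendsto_slope_zero_right
  have h2 : Tendsto (fun k : ℕ => 1 / ((k : ℝ) + 1)) atTop (𝓝[>] 0) :=
    tendsto_nhdsWithin_iff.2 ⟨tendsto_one_div_add_atTop_nhds_zero_nat,
      Eventually.of_forall fun k => by simp only [mem_Ioi]; positivity⟩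
  refine ((h1.comp h2).congr fun k => ?_).limsup_eq
  exact (div_eq_inv_mul _ _).symm

namespace Model

variable {Ω : ℕ → Type*} [∀ n, MeasurableSpace (Ω n)] {P : ∀ n, Measure (Ω n)} (S : Model P)

/-- A measurable version of `q₁`. -/
noncomputable def q1m : ℝ × ℝ → ℝ := fderivFst fun p => logLik S.ℓ S.g p.1 p.2

/-- A measurable version of `q₂`. -/
noncomputable def q2m : ℝ × ℝ → ℝ := fderivFst S.q1m

theorem measurable_q1m : Measurable S.q1m := measurable_fderivFst S.logLik_measurable

theorem measurable_q2m : Measurable S.q2m := measurable_fderivFst S.measurable_q1m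

theorem q1m_eq {y : ℝ} (hy : y ∈ S.yRange) (s : ℝ) : S.q1m (s, y) = q1 S.ℓ S.g s y :=
  fderivFst_eq (S.logLik_differentiable y hy s).hasDerivAt

theorem q2m_eq {y : ℝ} (hy : y ∈ S.yRange) (s : ℝ) : S.q2m (s, y) = q2 S.ℓ S.g s y := by
  refine fderivFst_eq ?_
  have : (fun t => S.q1m (t, y)) = fun t => q1 S.ℓ S.g t y := funext fun t => S.q1m_eq hy t
  rw [this]
  exact (S.q1_differentiable y hy s).hasDerivAt

/-- The `i`-th observation `(U_i, X_i, y_i)`. -/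
def obs (n : ℕ) (i : Fin n) (ω : Ω n) : ℝ × (Fin (S.d n) → ℝ) × ℝ :=
  (S.U n i ω, S.X n i ω, S.Y n i ω)

theorem measurable_obs (n : ℕ) (i : Fin n) : Measurable (S.obs n i) :=
  (S.U_measurable n i).prodMk ((S.X_measurable n i).prodMk (S.Y_measurable n i))

/-- The linear predictor as a measurable function of the observation. -/
noncomputable def linPredFun (n : ℕ) (z : ℝ × (Fin (S.d n) → ℝ) × ℝ) : ℝ :=
  ∑ j, (Icc (0 : ℝ) 1).indicator (S.a n j) z.1 * z.2.1 j

theorem measurable_linPredFun (hcoef : S.CoefficientCondition) (n : ℕ) :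
    Measurable (S.linPredFun n) := by
  classical
  refine Finset.measurable_fun_sum _ fun j _ => Measurable.mul ?_ (by fun_prop)
  refine Measurable.comp (g := (Icc (0 : ℝ) 1).indicator (S.a n j)) ?_ measurable_fst
  -- The coefficients are assumed continuous only on [0, 1]; cutting them off outside that interval
  -- makes them Borel.
  rw [← piecewise_eq_indicator]
  exact ContinuousOn.measurable_piecewise (hcoef.1 n j).continuousOn continuousOn_const
    measurableSet_Icc

/-- The variables `Q_{i1} x_{ij}`. -/
noncomputable def scoreFun (n : ℕ) (j : Fin (S.d n)) (z : ℝ × (Fin (S.d n) → ℝ) × ℝ) : ℝ :=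
  S.q1m (S.linPredFun n z, z.2.2) * z.2.1 j

/-- The variables `|Q_{i2} x_{ij} x_{ij'}|`. -/
noncomputable def hessFun (n : ℕ) (p : Fin (S.d n) × Fin (S.d n))
    (z : ℝ × (Fin (S.d n) → ℝ) × ℝ) : ℝ :=
  |S.q2m (S.linPredFun n z, z.2.2) * z.2.1 p.1 * z.2.1 p.2|

/-- The variables `|x_{ij} x_{ij'} x_{ij''} M_i|`. -/
noncomputable def lipFun (M : ∀ n, (Fin (S.d n) → ℝ) × ℝ × ℝ → ℝ) (n : ℕ)
    (p : Fin (S.d n) × Fin (S.d n) × Fin (S.d n)) (z : ℝ × (Fin (S.d n) → ℝ) × ℝ) : ℝ :=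
  |z.2.1 p.1 * z.2.1 p.2.1 * z.2.1 p.2.2 * M n (z.2.1, z.1, z.2.2)|

theorem measurable_scoreFun (hcoef : S.CoefficientCondition) (n : ℕ) (j : Fin (S.d n)) :
    Measurable (S.scoreFun n j) :=
  (S.measurable_q1m.comp ((S.measurable_linPredFun hcoef n).prodMk (by fun_prop))).mul
    (by fun_prop)

theorem measurable_hessFun (hcoef : S.CoefficientCondition) (n : ℕ)
    (p : Fin (S.d n) × Fin (S.d n)) : Measurable (S.hessFun n p) :=
  (((S.measurable_q2m.comp ((S.measurable_linPredFun hcoef n).prodMk (by fun_prop))).mul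
    (by fun_prop)).mul (by fun_prop)).abs

theorem measurable_lipFun {M : ∀ n, (Fin (S.d n) → ℝ) × ℝ × ℝ → ℝ} {n : ℕ}
    (hM : Measurable (M n)) (p : Fin (S.d n) × Fin (S.d n) × Fin (S.d n)) :
    Measurable (S.lipFun M n p) := by
  refine Measurable.abs (Measurable.mul (by fun_prop) (hM.comp (by fun_prop)))

theorem linPredFun_obs {n : ℕ} {i : Fin n} {ω : Ω n} (hU : S.U n i ω ∈ Icc (0 : ℝ) 1) :
    S.linPredFun n (S.obs n i ω) = S.linPred n i ω := by
  simp [linPredFun, linPred, obs, indicator_of_mem hU]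

theorem scoreFun_obs {n : ℕ} {i : Fin n} {ω : Ω n} (hU : S.U n i ω ∈ Icc (0 : ℝ) 1)
    (hY : S.Y n i ω ∈ S.yRange) (j : Fin (S.d n)) :
    S.scoreFun n j (S.obs n i ω) = S.Q1 n i ω * S.X n i ω j := by
  rw [scoreFun, S.linPredFun_obs hU]
  exact congrArg (· * _) (S.q1m_eq hY _)

theorem hessFun_obs {n : ℕ} {i : Fin n} {ω : Ω n} (hU : S.U n i ω ∈ Icc (0 : ℝ) 1)
    (hY : S.Y n i ω ∈ S.yRange) (p : Fin (S.d n) × Fin (S.d n)) :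
    S.hessFun n p (S.obs n i ω) = |S.Q2 n i ω * S.X n i ω p.1 * S.X n i ω p.2| := by
  rw [hessFun, S.linPredFun_obs hU]
  exact congrArg (fun x => |x * _ * _|) (S.q2m_eq hY _)

theorem map_U_le {C : ℝ} (hC : ∀ u ∈ Icc (0 : ℝ) 1, S.fU u ≤ C) (n : ℕ) (i : Fin n) :
    (P n).map (S.U n i) ≤ ENNReal.ofReal C • volume := by
  rw [S.U_law]
  refine le_trans (withDensity_mono (g := fun _ => ENNReal.ofReal C) ?_) ?_
  · exact (ae_restrict_mem measurableSet_Icc).mono fun u hu => ENNReal.ofReal_le_ofReal (hC u hu)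
  · rw [withDensity_const]
    exact Measure.le_iff'.2 fun A => mul_le_mul_right (Measure.restrict_le_self A) _

theorem ae_U_mem (n : ℕ) (i : Fin n) : ∀ᵐ ω ∂(P n), S.U n i ω ∈ Icc (0 : ℝ) 1 := by
  have h : ∀ᵐ u ∂((P n).map (S.U n i)), u ∈ Icc (0 : ℝ) 1 := by
    rw [S.U_law]
    exact (withDensity_absolutelyContinuous _ _).ae_le (ae_restrict_mem measurableSet_Icc)
  exact ae_of_ae_map (S.U_measurable n i).aemeasurable h

/-- The kernel array of the observations. -/
theorem exists_isKernelArray (hdens : S.DensityCondition) {wt : ℝ → ℝ} (hwt : Continuous wt)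
    (hsupp : HasCompactSupport wt) {h : ℕ → ℝ} (hh : ∀ᶠ n in atTop, 0 < h n) :
    ∃ κ Cw, IsKernelArray P S.obs (fun _ z => z.1) h wt κ Cw := by
  obtain ⟨-, c, C, hc, hC⟩ := hdens
  have hC0 : 0 ≤ C := hc.le.trans ((hC 0 (by simp)).1.trans (hC 0 (by simp)).2)
  obtain ⟨κ, hκ⟩ := hsupp.exists_bound_of_continuous hwt
  have hint : Integrable (fun x => |wt x|) := (hwt.integrable_of_hasCompactSupport hsupp).abs
  -- The maximum with 1 makes the weight bound positive. The moment constant is the density bound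
  -- times the L¹ norm of the weight, the factor `h` coming from rescaling.
  refine ⟨max κ 1, C * ∫ x, |wt x|, ⟨S.measurable_obs, S.indep, fun n => measurable_fst,
    hwt.measurable, fun x => (hκ x).trans (le_max_left _ _), by positivity,
    mul_nonneg hC0 (integral_nonneg fun x => abs_nonneg _), hh, fun n i u hn => ?_⟩⟩
  have hm : Measurable fun v => ENNReal.ofReal |wt ((v - u) / h n)| := by
    have := hwt.measurable; fun_prop
  have hint2 : Integrable (fun v => |wt ((v - u) / h n)|) :=
    (hint.comp_div hn.ne').comp_sub_right u
  calc ∫⁻ ω, ENNReal.ofReal |wt ((S.U n i ω - u) / h n)| ∂(P n)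
      = ∫⁻ v, ENNReal.ofReal |wt ((v - u) / h n)| ∂((P n).map (S.U n i)) :=
        (lintegral_map hm (S.U_measurable n i)).symm
    _ ≤ ∫⁻ v, ENNReal.ofReal |wt ((v - u) / h n)| ∂(ENNReal.ofReal C • volume) :=
        lintegral_mono' (S.map_U_le (fun u hu => (hC u hu).2) n i) le_rfl
    _ = ENNReal.ofReal C * ENNReal.ofReal (∫ v, |wt ((v - u) / h n)|) := by
        rw [lintegral_smul_measure, smul_eq_mul,
          ofReal_integral_eq_lintegral_ofReal hint2 (ae_of_all _ fun v => abs_nonneg _)]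
    _ = _ := by
        rw [integral_sub_right_eq_self (fun v => |wt (v / h n)|) u,
          Measure.integral_comp_div (fun v => |wt v|), abs_of_pos hn, smul_eq_mul,
          ← ENNReal.ofReal_mul hC0]
        congr 1; ring

theorem lipFun_obs (M : ∀ n, (Fin (S.d n) → ℝ) × ℝ × ℝ → ℝ) (n : ℕ) (i : Fin n) (ω : Ω n)
    (p : Fin (S.d n) × Fin (S.d n) × Fin (S.d n)) : S.lipFun M n p (S.obs n i ω) =
      |S.X n i ω p.1 * S.X n i ω p.2.1 * S.X n i ω p.2.2 *
        M n (S.X n i ω, S.U n i ω, S.Y n i ω)| := rfl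

variable [∀ n, IsProbabilityMeasure (P n)]

/-- The hypothesis bounds a sum of two conditional moments; the other one is nonnegative and can be
dropped. The measurable version agrees almost surely with the original variable. -/
theorem condLE_score {m C : ℝ} (h : S.ScoreMomentBound m C) (n : ℕ) (i : Fin n)
    (j : Fin (S.d n)) : CondLE (P n) (fun ω => (S.obs n i ω).1)
      (fun ω => ENNReal.ofReal (|S.scoreFun n j (S.obs n i ω)| ^ m)) (ENNReal.ofReal C) := by
  obtain ⟨h1, h2, h3⟩ := h n i j j j
  have h0 : 0 ≤ᵐ[P n] S.condU n i fun ω => |S.Q2 n i ω * S.X n i ω j * S.X n i ω j| ^ m :=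
    condExp_nonneg (ae_of_all _ fun ω => by positivity)
  refine (condLE_of_condExp_le (S.U_measurable n i) (fun ω => by positivity) h1 (C := C) ?_).congr ?_
  · filter_upwards [h0, h3] with ω a b
    simp only [condU, Pi.zero_apply] at a b ⊢
    linarith
  · filter_upwards [S.ae_U_mem n i, S.Y_mem n i] with ω hU hY
    rw [S.scoreFun_obs hU hY]

theorem condLE_hess {m C : ℝ} (h : S.ScoreMomentBound m C) (n : ℕ) (i : Fin n)
    (p : Fin (S.d n) × Fin (S.d n)) : CondLE (P n) (fun ω => (S.obs n i ω).1)
      (fun ω => ENNReal.ofReal (|S.hessFun n p (S.obs n i ω)| ^ m)) (ENNReal.ofReal C) := by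
  obtain ⟨h1, h2, h3⟩ := h n i p.1 p.1 p.2
  have h0 : 0 ≤ᵐ[P n] S.condU n i fun ω => |S.Q1 n i ω * S.X n i ω p.1| ^ m :=
    condExp_nonneg (ae_of_all _ fun ω => by positivity)
  refine (condLE_of_condExp_le (S.U_measurable n i) (fun ω => by positivity) h2 (C := C) ?_).congr ?_
  · filter_upwards [h0, h3] with ω a b
    simp only [condU, Pi.zero_apply] at a b ⊢
    linarith
  · filter_upwards [S.ae_U_mem n i, S.Y_mem n i] with ω hU hY
    rw [S.hessFun_obs hU hY, abs_abs]

theorem condLE_lip {M : ∀ n, (Fin (S.d n) → ℝ) × ℝ × ℝ → ℝ} {m C : ℝ}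
    (h : S.LipMomentBound M m C) (n : ℕ) (i : Fin n)
    (p : Fin (S.d n) × Fin (S.d n) × Fin (S.d n)) : CondLE (P n) (fun ω => (S.obs n i ω).1)
      (fun ω => ENNReal.ofReal (|S.lipFun M n p (S.obs n i ω)| ^ m)) (ENNReal.ofReal C) := by
  obtain ⟨h1, h2⟩ := h n i p.1 p.2.1 p.2.2
  refine (condLE_of_condExp_le (S.U_measurable n i) (fun ω => by positivity) h1 h2).congr
    (ae_of_all _ fun ω => ?_)
  simp only [lipFun_obs, abs_abs]

/-- The score variables are uncorrelated with functions of the index variable. -/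
theorem integral_score_mul_eq_zero (hscore : S.ScoreCondition) {m C : ℝ} (hm : 1 ≤ m)
    (h : S.ScoreMomentBound m C) {w : ℝ → ℝ} (hw : Measurable w) {κ : ℝ} (hκ : ∀ x, |w x| ≤ κ)
    (n : ℕ) (i : Fin n) (j : Fin (S.d n)) :
    ∫ ω, S.scoreFun n j (S.obs n i ω) * w (S.U n i ω) ∂(P n) = 0 := by
  obtain ⟨hQ, hQ0, -⟩ := hscore n i
  have hXm : Measurable fun ω => S.X n i ω j := (measurable_pi_apply j).comp (S.X_measurable n i)
  have hQX : Integrable (fun ω => S.Q1 n i ω * S.X n i ω j) (P n) := by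
    refine ((integrable_const (1 : ℝ)).add (h n i j j j).1).mono'
      (hQ.aestronglyMeasurable.mul hXm.aestronglyMeasurable) (ae_of_all _ fun ω => ?_)
    simp only [Pi.add_apply, Real.norm_eq_abs]
    set x := |S.Q1 n i ω * S.X n i ω j|
    have hx : 0 ≤ x := abs_nonneg _
    rcases le_total x 1 with h1 | h1
    · have : 0 ≤ x ^ m := by positivity
      linarith
    · have := Real.rpow_le_rpow_of_exponent_le h1 hm
      rw [Real.rpow_one] at this; linarith
  set G : MeasurableSpace (Ω n) :=
    MeasurableSpace.comap (fun ω => (S.X n i ω, S.U n i ω)) inferInstance with hG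
  have hGle := ((S.X_measurable n i).prodMk (S.U_measurable n i)).comap_le
  rw [← hG] at hGle
  have hmeas : StronglyMeasurable[G] fun ω => S.X n i ω j * w (S.U n i ω) := by
    have h1 : Measurable fun p : (Fin (S.d n) → ℝ) × ℝ => p.1 j * w p.2 := by fun_prop
    have h2 : Measurable[G] fun ω => (S.X n i ω, S.U n i ω) := comap_measurable _
    exact (h1.comp h2).stronglyMeasurable
  have hprod : Integrable (S.Q1 n i * fun ω => S.X n i ω j * w (S.U n i ω)) (P n) := by
    have := hQX.mul_bdd (g := fun ω => w (S.U n i ω)) (c := κ)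
      (hw.comp (S.U_measurable n i)).aestronglyMeasurable (ae_of_all _ fun ω => hκ _)
    refine this.congr (ae_of_all _ fun ω => ?_)
    simp only [Pi.mul_apply]; ring
  -- The covariate times the weight is measurable with respect to (X, U), so it comes out of the
  -- conditional expectation and multiplies a score of conditional mean zero.
  have h1 := condExp_mul_of_stronglyMeasurable_right (m := G) (μ := P n) hmeas hprod hQ
  have h2 : ∫ ω, (S.Q1 n i * fun ω => S.X n i ω j * w (S.U n i ω)) ω ∂(P n) = 0 := by
    rw [← integral_condExp hGle, integral_congr_ae h1]
    refine integral_eq_zero_of_ae ?_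
    filter_upwards [hQ0] with ω hω
    simp only [Pi.mul_apply, hω, Pi.zero_apply, zero_mul]
  rw [← h2]
  refine integral_congr_ae ?_
  filter_upwards [S.ae_U_mem n i, S.Y_mem n i] with ω hU hY
  rw [S.scoreFun_obs hU hY]
  simp only [Pi.mul_apply]; ring

end Model

/-! ### From kernel means to the rate of convergence -/

namespace Model

variable {Ω : ℕ → Type*} [∀ n, MeasurableSpace (Ω n)] {P : ∀ n, Measure (Ω n)} (S : Model P)

/-- The error bound at all localisation points, once the random quantities are controlled. -/
theorem maxError_le {K : ℝ → ℝ} {h lam1 lam2 : ℕ → ℝ} {n : ℕ} {ω : Ω n}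
    {M : ∀ n, (Fin (S.d n) → ℝ) × ℝ × ℝ → ℝ}
    {atil btil : ∀ n, Fin n → Ω n → EuclideanSpace ℝ (Fin (S.d n))}
    {A Ca δ ρ t A₀ A₁ C R : ℝ}
    (hest : S.IsPrelimEstimator K h lam1 lam2 atil btil)
    (hh : 0 < h n) (hl₁ : 0 < lam1 n) (hl₂ : 0 < lam2 n)
    (hcurv : S.NegCurvature) (hY : ∀ i, S.Y n i ω ∈ S.yRange)
    (hU : ∀ i, S.U n i ω ∈ Icc (0 : ℝ) 1) (hM0 : ∀ z, 0 < M n z)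
    (hM : ∀ i t, |q2 S.ℓ S.g (S.linPred n i ω + t) (S.Y n i ω) -
      q2 S.ℓ S.g (S.linPred n i ω) (S.Y n i ω)| ≤ M n (S.X n i ω, S.U n i ω, S.Y n i ω) * |t|)
    (hK0 : ∀ x, 0 ≤ K x) (hA : 1 ≤ A) (hKA : ∀ x, A < |x| → K x = 0)
    (hCa : 0 ≤ Ca) (hcoef : ∀ j, ContDiffOn ℝ 2 (S.a n j) (Icc 0 1))
    (hcoefC : ∀ j, ∀ u ∈ Icc (0 : ℝ) 1, |iteratedDerivWithin 2 (S.a n j) (Icc 0 1) u| ≤ Ca)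
    (hscore₀ : ∀ k j, |kernelMean (S.obs n) Prod.fst K (h n) (S.scoreFun n j) k ω| ≤ A₀ * t)
    (hscore₁ : ∀ k j, |kernelMean (S.obs n) Prod.fst (fun x => x * K x) (h n)
      (S.scoreFun n j) k ω| ≤ A₁ * t) (hC0 : 0 ≤ C)
    (hC₂ : ∀ k p, |kernelMean (S.obs n) Prod.fst K (h n) (S.hessFun n p) k ω| ≤ C)
    (hC₃ : ∀ k p, |kernelMean (S.obs n) Prod.fst K (h n) (S.lipFun M n p) k ω| ≤ C)
    (hδ : 0 ≤ δ)
    (hRE : ∀ u ∈ Icc (0 : ℝ) 1,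
      ∀ v ∈ S.cone n (max (lam1 n / lam2 n) (lam2 n / lam1 n) + δ),
        ρ ≤ v ⬝ᵥ (-(S.hess K (h n) n ω u)).mulVec v)
    (hR : 0 < R)
    (hgl : max (A₀ * t) (A₁ * t) + C * A ^ 2 * (S.s n * (Ca * (A * h n) ^ 2)) +
      C * A ^ 3 * (S.s n * (Ca * (A * h n) ^ 2)) * (S.s n * (Ca * (A * h n) ^ 2)) ≤
        min (lam1 n) (lam2 n) / 2)
    (hRl : (1 + 2 * max (lam1 n / lam2 n) (lam2 n / lam1 n)) * min (lam1 n) (lam2 n) *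
      √(2 * S.s n) < ρ * R / 4)
    (hrem : C * A ^ 3 * (S.s n * (Ca * (A * h n) ^ 2) +
      2 * (1 + max (lam1 n / lam2 n) (lam2 n / lam1 n)) * (√(2 * S.s n) * R)) *
      (2 * (1 + max (lam1 n / lam2 n) (lam2 n / lam1 n))) ^ 2 * (2 * S.s n) ≤ ρ / 2) :
    |S.maxError h atil btil n ω| ≤ 2 * R := by
  set l := min (lam1 n) (lam2 n)
  set b := max (lam1 n / lam2 n) (lam2 n / lam1 n) with hbdef
  have hl : 0 < l := lt_min hl₁ hl₂
  have hb0 : 0 ≤ b := le_max_of_le_left (by positivity)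
  -- The larger ratio times the smaller tuning parameter is the larger one, so both penalty weights
  -- lie between `l` and `b * l`.
  have hlb : lam1 n ≤ b * l ∧ lam2 n ≤ b * l := by
    have h1 : lam1 n ≤ b * lam2 n := (div_le_iff₀ hl₂).1 (le_max_left _ _)
    have h2 : lam2 n ≤ b * lam1 n := (div_le_iff₀ hl₁).1 (le_max_right _ _)
    have hb1 : 1 ≤ b := by
      rcases le_total (lam1 n) (lam2 n) with h | h
      · exact le_max_of_le_right ((one_le_div hl₁).2 h)
      · exact le_max_of_le_left ((one_le_div hl₂).2 h)
    have h3 : lam1 n ≤ b * lam1 n := le_mul_of_one_le_left hl₁.le hb1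
    have h4 : lam2 n ≤ b * lam2 n := le_mul_of_one_le_left hl₂.le hb1
    rcases min_choice (lam1 n) (lam2 n) with h | h
    · exact ⟨by simpa only [l, h] using h3, by simpa only [l, h] using h2⟩
    · exact ⟨by simpa only [l, h] using h1, by simpa only [l, h] using h4⟩
  have herr : ∀ k, ‖atil n k ω - S.a0 n k ω‖ ≤ R ∧ ‖h n • (btil n k ω - S.b0 n k ω)‖ ≤ R := by
    intro k
    have hmain := S.norm_error_le (K := K) (k := k) (δ := δ) (R := R) (C := C)
      (m := fun i => M n (S.X n i ω, S.U n i ω, S.Y n i ω)) hh hl (min_le_left _ _)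
      (min_le_right _ _) hlb.1 hlb.2 hcurv hY hU (fun i => (hM0 _).le) hM hK0 hA hKA hCa hcoef
      hcoefC (g := max (A₀ * t) (A₁ * t)) ?_ ?_ hC0 ?_ ?_ hb0 (hRE _ (hU k)) hδ hR hgl hRl hrem
    · exact hmain.2 _ _ (hest n k ω hmain.1)
    · intro j
      refine le_trans (le_of_eq ?_) ((hscore₀ k j).trans (le_max_left _ _))
      congr 1
      refine Finset.sum_congr rfl fun i _ => ?_
      rw [S.scoreFun_obs (hU i) (hY i)]; rfl
    · intro j
      refine le_trans (le_of_eq ?_) ((hscore₁ k j).trans (le_max_right _ _))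
      congr 1
      refine Finset.sum_congr rfl fun i _ => ?_
      rw [S.scoreFun_obs (hU i) (hY i)]
      simp only [kw, obs]; ring
    · intro j j'
      refine le_trans (le_of_eq ?_) ((le_abs_self _).trans (hC₂ k (j, j')))
      refine Finset.sum_congr rfl fun i _ => ?_
      rw [S.hessFun_obs (hU i) (hY i)]; rfl
    · intro j j' j''
      exact le_trans (le_of_eq rfl) ((le_abs_self _).trans (hC₃ k (j, j', j'')))
  -- A real supremum over an empty family is 0, so nonnegativity of `R` covers n = 0.
  have h1 : (⨆ k : Fin n, ‖atil n k ω - S.a0 n k ω‖) ≤ R :=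
    Real.iSup_le (fun k => (herr k).1) hR.le
  have h2 : (⨆ k : Fin n, ‖h n • (btil n k ω - S.b0 n k ω)‖) ≤ R :=
    Real.iSup_le (fun k => (herr k).2) hR.le
  have h3 : 0 ≤ ⨆ k : Fin n, ‖atil n k ω - S.a0 n k ω‖ := Real.iSup_nonneg fun _ => norm_nonneg _
  have h4 : 0 ≤ ⨆ k : Fin n, ‖h n • (btil n k ω - S.b0 n k ω)‖ :=
    Real.iSup_nonneg fun _ => norm_nonneg _
  rw [maxError, abs_of_nonneg (add_nonneg h3 h4)]
  linarith

/-- The rate of convergence follows from uniform control of the kernel means. -/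
theorem isBigOP_maxError {K : ℝ → ℝ} {h lam1 lam2 t : ℕ → ℝ}
    {M : ∀ n, (Fin (S.d n) → ℝ) × ℝ × ℝ → ℝ}
    {atil btil : ∀ n, Fin n → Ω n → EuclideanSpace ℝ (Fin (S.d n))}
    {A₀ A₁ A₂ A₃ : ℝ}
    (hlam1 : ∀ n, 0 < lam1 n) (hlam2 : ∀ n, 0 < lam2 n)
    (hest : S.IsPrelimEstimator K h lam1 lam2 atil btil) (hK : IsKernel K)
    (hcurv : S.NegCurvature) (hRE : S.RestrictedEigenvalue K h lam1 lam2)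
    (hcoef : S.CoefficientCondition) (hM : S.IsLipModulus M)
    (hh : ∀ᶠ n in atTop, 0 < h n)
    (hsh : (fun n => (S.s n : ℝ) * h n ^ 2) =o[atTop] lam1) (hprop : Propto lam1 lam2)
    (hs2 : Tendsto (fun n => (S.s n : ℝ) ^ 2 * lam1 n) atTop (𝓝 0)) (ht : t =o[atTop] lam1)
    (hE₀ : Tendsto (fun n => P n {ω | ∃ k j, A₀ * t n <
      |kernelMean (S.obs n) Prod.fst K (h n) (S.scoreFun n j) k ω|}) atTop (𝓝 0))
    (hE₁ : Tendsto (fun n => P n {ω | ∃ k j, A₁ * t n <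
      |kernelMean (S.obs n) Prod.fst (fun x => x * K x) (h n) (S.scoreFun n j) k ω|}) atTop (𝓝 0))
    (hE₂ : Tendsto (fun n => P n {ω | ∃ k p, A₂ * 1 <
      |kernelMean (S.obs n) Prod.fst K (h n) (S.hessFun n p) k ω|}) atTop (𝓝 0))
    (hE₃ : Tendsto (fun n => P n {ω | ∃ k p, A₃ * 1 <
      |kernelMean (S.obs n) Prod.fst K (h n) (S.lipFun M n p) k ω|}) atTop (𝓝 0)) :
    IsBigOP P (S.maxError h atil btil) fun n => √(S.s n) * lam1 n := by
  obtain ⟨-, -, hK0, -, hKs⟩ := hK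
  obtain ⟨ρ, ρ₂, δ, hρ, -, hδ, hRE⟩ := hRE
  obtain ⟨hcoef, Ca, hCa⟩ := hcoef
  obtain ⟨c₁, c₂, hc₁, hc₁₂, hprop⟩ := hprop
  have hc₂ : 0 < c₂ := hc₁.trans_le hc₁₂
  obtain ⟨A, hA, hKA⟩ : ∃ A : ℝ, 1 ≤ A ∧ ∀ x, A < |x| → K x = 0 := by
    obtain ⟨A, hA⟩ := hKs.isCompact.isBounded.subset_closedBall 0
    refine ⟨max A 1, le_max_right _ _, fun x hx => ?_⟩
    by_contra hne
    have := hA (subset_tsupport K hne)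
    rw [mem_closedBall_zero_iff, Real.norm_eq_abs] at this
    exact absurd hx (not_lt.2 (this.trans (le_max_left _ _)))
  set C := max (max A₂ A₃) 0 with hCdef
  have hC0 : 0 ≤ C := le_max_right _ _
  have hCa0 : 0 ≤ |Ca| := abs_nonneg _
  set bm := max c₂ c₁⁻¹ with hbm
  have hbm0 : 0 < bm := lt_max_of_lt_left hc₂
  -- With R = 2K₀√s λ₁ the curvature side ρR/4 is twice an upper bound for the penalty side, using
  -- √(2s) ≤ 2√s; this gives the strict inequality on the sphere.
  set K₀ := 8 * (1 + 2 * bm) / ρ with hK₀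
  have hK₀0 : 0 < K₀ := by positivity
  have hs1 : ∀ n, (1 : ℝ) ≤ S.s n := fun n => by exact_mod_cast S.s_pos n
  have hlam0 : Tendsto lam1 atTop (𝓝 0) := by
    refine squeeze_zero (fun n => (hlam1 n).le) (fun n => ?_) hs2
    exact le_mul_of_one_le_left (hlam1 n).le (one_le_pow₀ (hs1 n))
  have he : (fun n => (S.s n : ℝ) * (|Ca| * (A * h n) ^ 2)) =o[atTop] lam1 := by
    refine (hsh.const_mul_left (|Ca| * A ^ 2)).congr_left fun n => ?_
    ring
  have he0 : Tendsto (fun n => (S.s n : ℝ) * (|Ca| * (A * h n) ^ 2)) atTop (𝓝 0) :=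
    he.trans_tendsto hlam0
  -- Score, linear bias and quadratic bias are all o(λ₁), and λ₁ ∝ λ₂ makes the smaller tuning
  -- parameter comparable to λ₁.
  have hgrad : ∀ᶠ n in atTop, max (A₀ * t n) (A₁ * t n) +
      C * A ^ 2 * (S.s n * (|Ca| * (A * h n) ^ 2)) +
      C * A ^ 3 * (S.s n * (|Ca| * (A * h n) ^ 2)) * (S.s n * (|Ca| * (A * h n) ^ 2)) ≤
        min (lam1 n) (lam2 n) / 2 := by
    have h1 : (fun n => |A₀| * |t n| + |A₁| * |t n| +
        C * A ^ 2 * (S.s n * (|Ca| * (A * h n) ^ 2)) +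
        C * A ^ 3 * (S.s n * (|Ca| * (A * h n) ^ 2)) * (S.s n * (|Ca| * (A * h n) ^ 2))) =o[atTop]
        lam1 := by
      refine (((ht.abs_left.const_mul_left _).add (ht.abs_left.const_mul_left _)).add
        (he.const_mul_left _)).add ?_
      have := (he.const_mul_left (C * A ^ 3)).mul_isBigO (he0.isBigO_one ℝ)
      simpa using this
    have hcpos : 0 < (min 1 c₂⁻¹) / 2 := by positivity
    filter_upwards [h1.bound hcpos, hprop] with n h1 h2
    have h3 : min 1 c₂⁻¹ * lam1 n ≤ min (lam1 n) (lam2 n) := by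
      refine le_min ?_ ?_
      · exact mul_le_of_le_one_left (hlam1 n).le (min_le_left _ _)
      · refine (mul_le_mul_of_nonneg_right (min_le_right _ _) (hlam1 n).le).trans ?_
        rw [inv_mul_le_iff₀ hc₂]; exact h2.2
    rw [Real.norm_eq_abs, Real.norm_of_nonneg (hlam1 n).le] at h1
    have h4 := (le_abs_self _).trans h1
    have h5 : max (A₀ * t n) (A₁ * t n) ≤ |A₀| * |t n| + |A₁| * |t n| := by
      rw [← abs_mul, ← abs_mul]
      refine max_le ?_ ?_
      · linarith [le_abs_self (A₀ * t n), abs_nonneg (A₁ * t n)]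
      · linarith [le_abs_self (A₁ * t n), abs_nonneg (A₀ * t n)]
    linarith
  have hb : ∀ᶠ n in atTop, max (lam1 n / lam2 n) (lam2 n / lam1 n) ≤ bm := by
    filter_upwards [hprop] with n hn
    refine max_le_max ((div_le_iff₀ (hlam2 n)).2 hn.2) ?_
    rw [div_le_iff₀ (hlam1 n), inv_mul_eq_div, le_div_iff₀ hc₁, mul_comm]
    exact hn.1
  have hsqrt : ∀ n, √(2 * S.s n) ≤ 2 * √(S.s n) := fun n => by
    rw [Real.sqrt_mul (by norm_num)]
    refine mul_le_mul_of_nonneg_right ?_ (Real.sqrt_nonneg _)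
    rw [Real.sqrt_le_left (by norm_num)]; norm_num
  have hss : ∀ n, 0 < √(S.s n : ℝ) := fun n => Real.sqrt_pos.2 (by linarith [hs1 n])
  have hRl : ∀ᶠ n in atTop, (1 + 2 * max (lam1 n / lam2 n) (lam2 n / lam1 n)) *
      min (lam1 n) (lam2 n) * √(2 * S.s n) < ρ * (2 * K₀ * (√(S.s n) * lam1 n)) / 4 := by
    filter_upwards [hb] with n hn
    have h0 : 0 < min (lam1 n) (lam2 n) := lt_min (hlam1 n) (hlam2 n)
    have hm0 : 0 ≤ max (lam1 n / lam2 n) (lam2 n / lam1 n) :=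
      le_max_of_le_left (div_pos (hlam1 n) (hlam2 n)).le
    have e : ρ * (2 * K₀ * (√(S.s n) * lam1 n)) / 4 =
        2 * ((1 + 2 * bm) * lam1 n * (2 * √(S.s n))) := by
      rw [hK₀]; field_simp; ring
    rw [e]
    have hpos : 0 < (1 + 2 * bm) * lam1 n * (2 * √(S.s n)) := by
      have := hlam1 n; have := hss n; positivity
    refine lt_of_le_of_lt ?_ (by linarith : (1 + 2 * bm) * lam1 n * (2 * √(S.s n)) < _)
    have := hsqrt n
    have := min_le_left (lam1 n) (lam2 n)
    have := hlam1 n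
    gcongr
  -- Bias mass and the ℓ¹ radius √s·R are both O(s λ₁); the further factor `s` produces s²λ₁, which
  -- tends to zero.
  have hrem : ∀ᶠ n in atTop, C * A ^ 3 * (S.s n * (|Ca| * (A * h n) ^ 2) +
      2 * (1 + max (lam1 n / lam2 n) (lam2 n / lam1 n)) *
        (√(2 * S.s n) * (2 * K₀ * (√(S.s n) * lam1 n)))) *
      (2 * (1 + max (lam1 n / lam2 n) (lam2 n / lam1 n))) ^ 2 * (2 * S.s n) ≤ ρ / 2 := by
    have hlim : Tendsto (fun n => C * A ^ 3 * (1 + 2 * (1 + bm) * (4 * K₀)) *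
        (2 * (1 + bm)) ^ 2 * 2 * ((S.s n : ℝ) ^ 2 * lam1 n)) atTop (𝓝 0) := by
      simpa using hs2.const_mul (C * A ^ 3 * (1 + 2 * (1 + bm) * (4 * K₀)) *
        (2 * (1 + bm)) ^ 2 * 2)
    filter_upwards [hb, he.bound one_pos, hlim.eventually_le_const (half_pos hρ)] with n hn he hlim
    refine le_trans ?_ hlim
    rw [one_mul, Real.norm_of_nonneg (hlam1 n).le] at he
    have he' := (le_abs_self _).trans he
    have hm0 : 0 ≤ max (lam1 n / lam2 n) (lam2 n / lam1 n) :=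
      le_max_of_le_left (div_pos (hlam1 n) (hlam2 n)).le
    have hl := hlam1 n
    have hs := hs1 n
    have h1 : √(2 * S.s n) * (2 * K₀ * (√(S.s n) * lam1 n)) ≤ 4 * K₀ * (S.s n * lam1 n) := by
      calc _ ≤ (2 * √(S.s n)) * (2 * K₀ * (√(S.s n) * lam1 n)) :=
            mul_le_mul_of_nonneg_right (hsqrt n) (by positivity)
        _ = 4 * K₀ * ((√(S.s n)) ^ 2 * lam1 n) := by ring
        _ = _ := by rw [Real.sq_sqrt (by linarith)]
    have h2 : S.s n * (|Ca| * (A * h n) ^ 2) +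
        2 * (1 + max (lam1 n / lam2 n) (lam2 n / lam1 n)) *
          (√(2 * S.s n) * (2 * K₀ * (√(S.s n) * lam1 n))) ≤
        (1 + 2 * (1 + bm) * (4 * K₀)) * (S.s n * lam1 n) := by
      have h3 : lam1 n ≤ S.s n * lam1 n := le_mul_of_one_le_left hl.le hs
      have h4 : 2 * (1 + max (lam1 n / lam2 n) (lam2 n / lam1 n)) *
          (√(2 * S.s n) * (2 * K₀ * (√(S.s n) * lam1 n))) ≤
          2 * (1 + bm) * (4 * K₀ * (S.s n * lam1 n)) := by gcongr
      linarith
    calc _ ≤ C * A ^ 3 * ((1 + 2 * (1 + bm) * (4 * K₀)) * (S.s n * lam1 n)) *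
          (2 * (1 + bm)) ^ 2 * (2 * S.s n) := by gcongr
      _ = _ := by ring
  set R : ℕ → ℝ := fun n => 2 * K₀ * (√(S.s n) * lam1 n) with hRdef
  have hnull : ∀ n, P n {ω | ¬ ∀ i, S.Y n i ω ∈ S.yRange ∧ S.U n i ω ∈ Icc (0 : ℝ) 1 ∧
      ∀ t : ℝ, |q2 S.ℓ S.g (S.linPred n i ω + t) (S.Y n i ω) -
        q2 S.ℓ S.g (S.linPred n i ω) (S.Y n i ω)| ≤
          M n (S.X n i ω, S.U n i ω, S.Y n i ω) * |t|} = 0 := fun n => by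
    refine ae_iff.1 (ae_all_iff.2 fun i => ?_)
    filter_upwards [S.Y_mem n i, S.ae_U_mem n i, (hM n).2.2 i] with ω h1 h2 h3
    exact ⟨h1, h2, h3⟩
  intro ε hε
  refine ⟨2 * (2 * K₀), by positivity, ?_⟩
  -- Outside five events of vanishing probability and a null set the deterministic bound applies, so
  -- the same constant works for every ε.
  have hsum := (((hRE.add hE₀).add hE₁).add hE₂).add hE₃
  simp only [add_zero] at hsum
  have hev := hsum.eventually (Iic_mem_nhds (ENNReal.ofReal_pos.2 hε))
  filter_upwards [hev, hh, hgrad, hRl, hrem] with n hev hh hgrad hRl hrem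
  refine le_trans ?_ hev
  have hu := fun (s₁ s₂ : Set (Ω n)) => measure_union_le (μ := P n) s₁ s₂
  refine le_trans ?_ ((hu _ _).trans (add_le_add_left ((hu _ _).trans (add_le_add_left
    ((hu _ _).trans (add_le_add_left (hu _ _) _)) _)) _))
  rw [← add_zero (P n (_ ∪ _)), ← hnull n]
  refine le_trans (measure_mono ?_) (hu _ _)
  intro ω hω
  by_contra hcon
  simp only [mem_union, mem_ofPred_eq, not_or, not_not, not_exists, not_lt] at hcon hω
  obtain ⟨⟨⟨⟨⟨g1, g2⟩, g3⟩, g4⟩, g5⟩, g6⟩ := hcon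
  have hRpos : 0 < R n := by have := hlam1 n; have := hss n; simp only [hRdef]; positivity
  have := S.maxError_le hest hh (hlam1 n) (hlam2 n) hcurv (fun i => (g6 i).1) (fun i => (g6 i).2.1)
    ((hM n).2.1) (fun i => (g6 i).2.2) hK0 hA hKA hCa0 (hcoef n)
    (fun j u hu => (hCa n j u hu).trans (le_abs_self _)) g2 g3 hC0
    (fun k p => (g4 k p).trans (by rw [mul_one]; exact (le_max_left _ _).trans (le_max_left _ _)))
    (fun k p => (g5 k p).trans (by rw [mul_one]; exact (le_max_right _ _).trans (le_max_left _ _)))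
    hδ.le (fun u hu v hv => (g1 u hu v hv).1) hRpos hgrad hRl hrem
  simp only [hRdef] at this
  linarith

end Model

/-! ### Rates for the union bound -/

section Rates

/-- Elementary properties of a bandwidth of polynomial order. -/
theorem bandwidth_props {h : ℕ → ℝ} {δ₁ : ℝ} (hδ0 : 0 < δ₁) (hδ1 : δ₁ < 1)
    (hh : Propto h fun n => (n : ℝ) ^ (-δ₁)) :
    (∀ᶠ n in atTop, 0 < h n) ∧ Tendsto (fun n => Real.log (h n)⁻¹) atTop atTop ∧
      (∃ c, 0 < c ∧ ∀ᶠ n : ℕ in atTop, c * (n : ℝ) ^ (1 - δ₁) ≤ n * h n) ∧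
      Tendsto (fun n : ℕ => n * h n) atTop atTop := by
  obtain ⟨c₁, c₂, hc₁, hc₁₂, hh⟩ := hh
  have hpos : ∀ᶠ n in atTop, 0 < h n := by
    filter_upwards [hh, eventually_gt_atTop 0] with n hn h0
    have : (0 : ℝ) < n := by exact_mod_cast h0
    exact lt_of_lt_of_le (by positivity) hn.1
  have hlim : Tendsto h atTop (𝓝 0) := by
    have h1 : Tendsto (fun n : ℕ => c₂ * (n : ℝ) ^ (-δ₁)) atTop (𝓝 0) := by
      simpa using ((tendsto_rpow_neg_atTop hδ0).comp tendsto_natCast_atTop_atTop).const_mul c₂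
    exact tendsto_of_tendsto_of_tendsto_of_le_of_le' tendsto_const_nhds h1
      (hpos.mono fun n hn => hn.le) (hh.mono fun n hn => hn.2)
  have hlow : ∀ᶠ n : ℕ in atTop, c₁ * (n : ℝ) ^ (1 - δ₁) ≤ n * h n := by
    filter_upwards [hh, eventually_gt_atTop 0] with n hn h0
    have h0' : (0 : ℝ) < n := by exact_mod_cast h0
    have e : c₁ * (n : ℝ) ^ (1 - δ₁) = n * (c₁ * (n : ℝ) ^ (-δ₁)) := by
      rw [sub_eq_add_neg, Real.rpow_add h0', Real.rpow_one]; ring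
    rw [e]
    exact mul_le_mul_of_nonneg_left hn.1 h0'.le
  refine ⟨hpos, ?_, ⟨c₁, hc₁, hlow⟩, ?_⟩
  · refine Real.tendsto_log_atTop.comp (tendsto_inv_nhdsGT_zero.comp ?_)
    exact tendsto_nhdsWithin_iff.2 ⟨hlim, hpos⟩
  · refine tendsto_atTop_mono' _ hlow ?_
    exact ((tendsto_rpow_atTop (by linarith)).comp tendsto_natCast_atTop_atTop).const_mul_atTop hc₁

theorem tendsto_rate_of_le {d card : ℕ → ℕ} {G H : ℕ → ℝ} {q : ℝ} (hq : 0 ≤ q)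
    (hcard : ∀ n, card n ≤ d n ^ 3)
    (hG : Tendsto (fun n : ℕ => (n : ℝ) * (d n : ℝ) ^ 3 * Real.exp (-(G n * q))) atTop (𝓝 0))
    (hle : ∀ᶠ n in atTop, G n ≤ H n) :
    Tendsto (fun n : ℕ => (n : ℝ) * card n * Real.exp (-(H n * q))) atTop (𝓝 0) := by
  refine tendsto_of_tendsto_of_tendsto_of_le_of_le' tendsto_const_nhds hG
    (Eventually.of_forall fun n => by positivity) ?_
  filter_upwards [hle] with n hn
  have h1 : (card n : ℝ) ≤ (d n : ℝ) ^ 3 := by exact_mod_cast hcard n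
  have h2 : Real.exp (-(H n * q)) ≤ Real.exp (-(G n * q)) :=
    Real.exp_le_exp.2 (neg_le_neg (mul_le_mul_of_nonneg_right hn hq))
  gcongr

theorem exists_rate_poly {d : ℕ → ℕ} {h : ℕ → ℝ} {δ₁ τ₁ : ℝ} (hδ0 : 0 < δ₁) (hτ : 0 ≤ τ₁)
    (hh : Propto h fun n => (n : ℝ) ^ (-δ₁))
    (hd : Propto (fun n => (d n : ℝ)) fun n => (n : ℝ) ^ τ₁) :
    ∃ q, 0 ≤ q ∧ Tendsto (fun n : ℕ => (n : ℝ) * (d n : ℝ) ^ 3 *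
      Real.exp (-(Real.log (h n)⁻¹ * q))) atTop (𝓝 0) := by
  obtain ⟨c₁, c₂, hc₁, hc₁₂, hh⟩ := hh
  obtain ⟨e₁, e₂, he₁, he₁₂, hd⟩ := hd
  have hc₂ : 0 < c₂ := hc₁.trans_le hc₁₂
  have he₂ : 0 < e₂ := he₁.trans_le he₁₂
  -- The exponential equals h^q, at most a constant times n^{−δ₁q}; this `q` turns n·d³·h^q into
  -- order n^{−1}.
  set q := (2 + 3 * τ₁) / δ₁ with hq
  have hq0 : 0 ≤ q := by positivity
  refine ⟨q, hq0, ?_⟩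
  have hlim : Tendsto (fun n : ℕ => e₂ ^ 3 * c₂ ^ q * (n : ℝ)⁻¹) atTop (𝓝 0) := by
    simpa using (tendsto_inv_atTop_zero.comp tendsto_natCast_atTop_atTop).const_mul
      (e₂ ^ 3 * c₂ ^ q)
  refine tendsto_of_tendsto_of_tendsto_of_le_of_le' tendsto_const_nhds hlim
    (Eventually.of_forall fun n => by positivity) ?_
  filter_upwards [hh, hd, eventually_gt_atTop 0] with n hhn hdn h0
  have hn : (0 : ℝ) < n := by exact_mod_cast h0
  have hhpos : 0 < h n := lt_of_lt_of_le (by positivity) hhn.1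
  have h1 : Real.exp (-(Real.log (h n)⁻¹ * q)) = h n ^ q := by
    rw [Real.rpow_def_of_pos hhpos, Real.log_inv]; congr 1; ring
  rw [h1]
  calc (n : ℝ) * (d n : ℝ) ^ 3 * h n ^ q
      ≤ n * (e₂ * (n : ℝ) ^ τ₁) ^ 3 * (c₂ * (n : ℝ) ^ (-δ₁)) ^ q := by
        have := hdn.2; have := hhn.2
        gcongr
    _ = e₂ ^ 3 * c₂ ^ q * ((n : ℝ) ^ (1 : ℝ) * (n : ℝ) ^ (τ₁ * (3 : ℕ)) * (n : ℝ) ^ (-δ₁ * q)) := by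
        rw [mul_pow, Real.mul_rpow hc₂.le (by positivity), ← Real.rpow_mul hn.le,
          Real.rpow_mul_natCast hn.le, Real.rpow_one]
        ring
    _ = e₂ ^ 3 * c₂ ^ q * (n : ℝ)⁻¹ := by
        rw [← Real.rpow_add hn, ← Real.rpow_add hn, ← Real.rpow_neg_one]
        congr 2
        rw [hq]; push_cast; field_simp; ring

/-- With y = nh, d³ contributes 3y^{τ₂} ≤ 3y^{1−τ₃} to the exponent against −4y^{1−τ₃}. What is left
is at most exp(−y^{1−τ₃}), and since y grows at least like a power of `n` this beats the factor `n`.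
-/
theorem tendsto_rate_exp {d : ℕ → ℕ} {h : ℕ → ℝ} {δ₁ τ₂ τ₃ c : ℝ} (hδ1 : δ₁ < 1)
    (hτ : τ₂ < 1 - τ₃) (hτ₃ : τ₃ < 1) (hc : 0 < c)
    (hlow : ∀ᶠ n : ℕ in atTop, c * (n : ℝ) ^ (1 - δ₁) ≤ n * h n)
    (hnh : Tendsto (fun n : ℕ => n * h n) atTop atTop)
    (hd : Propto (fun n => (d n : ℝ)) fun n => Real.exp ((n * h n) ^ τ₂)) :
    Tendsto (fun n : ℕ => (n : ℝ) * (d n : ℝ) ^ 3 *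
      Real.exp (-((n * h n) ^ (1 - τ₃) / 2 * 8))) atTop (𝓝 0) := by
  obtain ⟨e₁, e₂, he₁, he₁₂, hd⟩ := hd
  have he₂ : 0 < e₂ := he₁.trans_le he₁₂
  have hs : 0 < 1 - τ₃ := by linarith
  have ha : 0 < (1 - δ₁) * (1 - τ₃) := mul_pos (by linarith) hs
  have hlim : Tendsto (fun n : ℕ => e₂ ^ 3 *
      (((n : ℝ) ^ ((1 - δ₁) * (1 - τ₃))) ^ ((1 - δ₁) * (1 - τ₃))⁻¹ *
        Real.exp (-(c ^ (1 - τ₃)) * (n : ℝ) ^ ((1 - δ₁) * (1 - τ₃))))) atTop (𝓝 0) := by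
    have h1 := (tendsto_rpow_mul_exp_neg_mul_atTop_nhds_zero ((1 - δ₁) * (1 - τ₃))⁻¹
      (c ^ (1 - τ₃)) (by positivity)).comp ((tendsto_rpow_atTop ha).comp tendsto_natCast_atTop_atTop)
    simpa using h1.const_mul (e₂ ^ 3)
  refine tendsto_of_tendsto_of_tendsto_of_le_of_le' tendsto_const_nhds hlim
    (Eventually.of_forall fun n => by positivity) ?_
  filter_upwards [hlow, hd, hnh.eventually_ge_atTop 1] with n hlow hd hy
  have hn : (0 : ℝ) ≤ n := Nat.cast_nonneg n
  set y := (n : ℝ) * h n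
  have h1 : y ^ τ₂ ≤ y ^ (1 - τ₃) := Real.rpow_le_rpow_of_exponent_le hy hτ.le
  have h2 : c ^ (1 - τ₃) * (n : ℝ) ^ ((1 - δ₁) * (1 - τ₃)) ≤ y ^ (1 - τ₃) := by
    rw [Real.rpow_mul hn, ← Real.mul_rpow hc.le (by positivity)]
    exact Real.rpow_le_rpow (by positivity) hlow hs.le
  rw [← Real.rpow_mul hn, mul_inv_cancel₀ ha.ne', Real.rpow_one]
  calc (n : ℝ) * (d n : ℝ) ^ 3 * Real.exp (-(y ^ (1 - τ₃) / 2 * 8))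
      ≤ n * (e₂ * Real.exp (y ^ τ₂)) ^ 3 * Real.exp (-(y ^ (1 - τ₃) / 2 * 8)) := by
        have := hd.2
        gcongr
    _ = e₂ ^ 3 * (n * Real.exp (3 * y ^ τ₂ + -(y ^ (1 - τ₃) / 2 * 8))) := by
        rw [mul_pow, ← Real.exp_nat_mul, Real.exp_add]; push_cast; ring
    _ ≤ _ := by
        gcongr
        linarith

end Rates

theorem CondLE.mono {Ω : Type*} [MeasurableSpace Ω] {P : Measure Ω} {V : Ω → ℝ} {f : Ω → ℝ≥0∞}
    {C C' : ℝ≥0∞} (h : CondLE P V f C) (hC : C ≤ C') : CondLE P V f C' := fun p hp =>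
  (h p hp).trans (mul_le_mul_left hC _)

/-- Since |x| ≤ 1 + |x|^m, uncentred variables have kernel expectations of order `h`. This is the
bias bound at level t = 1, which suffices for quantities that need only stay bounded. -/
theorem IsKernelArray.abs_integral_le {Ω : ℕ → Type*} [∀ n, MeasurableSpace (Ω n)]
    {P : ∀ n, Measure (Ω n)} {𝒵 : ℕ → Type*} [∀ n, MeasurableSpace (𝒵 n)] {ι : ℕ → Type*}
    {Z : ∀ n, Fin n → Ω n → 𝒵 n} {V : ∀ n, 𝒵 n → ℝ} {h : ℕ → ℝ} {wt : ℝ → ℝ} {κ Cw : ℝ}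
    (hA : IsKernelArray P Z V h wt κ Cw) {ψ : ∀ n, ι n → 𝒵 n → ℝ} {m C : ℝ} (hm : 1 ≤ m)
    (hC : 0 ≤ C) (hmom : ∀ n i j, CondLE (P n) (fun ω => V n (Z n i ω))
      (fun ω => ENNReal.ofReal (|ψ n j (Z n i ω)| ^ m)) (ENNReal.ofReal C)) :
    ∀ᶠ n in atTop, ∀ i j u,
      |∫ ω, ψ n j (Z n i ω) * wt ((V n (Z n i ω) - u) / h n) ∂(P n)| ≤ (1 + C) * Cw * 1 * h n := by
  filter_upwards [hA.bandwidth_pos] with n hn i j u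
  have h1 := (hmom n i j).affine ((hA.measurable_index n).comp (hA.measurable_obs n i))
    (f := fun ω => |ψ n j (Z n i ω)|) zero_le_one zero_le_one hC
    (ae_of_all _ fun ω => ⟨by positivity, by
      rcases le_total |ψ n j (Z n i ω)| 1 with h1 | h1
      · have : 0 ≤ |ψ n j (Z n i ω)| ^ m := by positivity
        linarith
      · have := Real.rpow_le_rpow_of_exponent_le h1 hm
        rw [Real.rpow_one] at this; linarith⟩)
  have h2 := abs_integral_mul_weight_le (by positivity) (mul_nonneg hA.moment_nonneg hn.le)
    hA.measurable_weight h1 (hA.weight_moment n i u hn)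
  exact h2.trans (le_of_eq (by ring))

/-! ### The polynomial and exponential regimes -/

namespace Model

variable {Ω : ℕ → Type*} [∀ n, MeasurableSpace (Ω n)] {P : ∀ n, Measure (Ω n)} (S : Model P)

theorem one_le_d (n : ℕ) : 1 ≤ S.d n := (S.s_pos n).trans (S.s_le n)

/-- The separate consequences of the tuning condition. -/
theorem tuning_props {h lam1 lam2 : ℕ → ℝ} {κ : ℝ} (hlam1 : ∀ n, 0 < lam1 n)
    (hT : S.TuningCondition h lam1 lam2 κ) :
    (fun n => (S.s n : ℝ) * h n ^ 2) =o[atTop] lam1 ∧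
    (fun n : ℕ => (Real.log (h n)⁻¹ / (n * h n)) ^ κ) =o[atTop] lam1 ∧
    Tendsto (fun n => (S.s n : ℝ) ^ 2 * lam1 n) atTop (𝓝 0) ∧ Tendsto lam1 atTop (𝓝 0) := by
  obtain ⟨⟨δ₁, hδ0, hδ1, hh⟩, hsum, -, hlim⟩ := hT
  obtain ⟨hpos, hL, -, -⟩ := bandwidth_props hδ0 hδ1 hh
  have hx : ∀ᶠ n : ℕ in atTop, 0 ≤ (Real.log (h n)⁻¹ / (n * h n)) ^ κ := by
    filter_upwards [hpos, hL.eventually_ge_atTop 0] with n h1 h2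
    exact Real.rpow_nonneg (by positivity) _
  have hs2 : Tendsto (fun n => (S.s n : ℝ) ^ 2 * lam1 n) atTop (𝓝 0) := by
    refine squeeze_zero (fun n => mul_nonneg (by positivity) (hlam1 n).le) (fun n => ?_) hlim
    exact le_add_of_nonneg_left (by positivity)
  refine ⟨(Asymptotics.IsBigO.of_bound 1 ?_).trans_isLittleO hsum,
    (Asymptotics.IsBigO.of_bound 1 ?_).trans_isLittleO hsum, hs2, ?_⟩
  · filter_upwards [hx] with n hn
    rw [one_mul, Real.norm_of_nonneg (by positivity), Real.norm_of_nonneg (by positivity)]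
    exact le_add_of_nonneg_right hn
  · filter_upwards [hx] with n hn
    rw [one_mul, Real.norm_of_nonneg hn, Real.norm_of_nonneg (by positivity)]
    exact le_add_of_nonneg_left (by positivity)
  · refine squeeze_zero (fun n => (hlam1 n).le) (fun n => ?_) hs2
    have : (1 : ℝ) ≤ S.s n := by exact_mod_cast S.s_pos n
    exact le_mul_of_one_le_left (hlam1 n).le (one_le_pow₀ this)

theorem card_le_cube (n : ℕ) : Fintype.card (Fin (S.d n)) ≤ S.d n ^ 3 := by
  rw [Fintype.card_fin]
  exact Nat.le_self_pow (by norm_num) _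

theorem card_prod_le_cube (n : ℕ) :
    Fintype.card (Fin (S.d n) × Fin (S.d n)) ≤ S.d n ^ 3 := by
  rw [Fintype.card_prod, Fintype.card_fin, ← sq]
  exact Nat.pow_le_pow_right (S.one_le_d n) (by norm_num)

theorem card_triple_le_cube (n : ℕ) :
    Fintype.card (Fin (S.d n) × Fin (S.d n) × Fin (S.d n)) ≤ S.d n ^ 3 := by
  rw [Fintype.card_prod, Fintype.card_prod, Fintype.card_fin]
  exact le_of_eq (by ring)

variable [∀ n, IsProbabilityMeasure (P n)]

theorem score_bias_eq_zero (hscore : S.ScoreCondition) {m C : ℝ} (hm : 1 ≤ m)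
    (hmom : S.ScoreMomentBound m C) {h t : ℕ → ℝ} {wt : ℝ → ℝ} {κ Cw : ℝ}
    (hA : IsKernelArray P S.obs (fun _ => Prod.fst) h wt κ Cw) :
    ∀ᶠ n in atTop, ∀ i j u, |∫ ω, S.scoreFun n j (S.obs n i ω) *
      wt (((S.obs n i ω).1 - u) / h n) ∂(P n)| ≤ 0 * t n * h n := by
  refine Eventually.of_forall fun n i j u => ?_
  have hw : Measurable fun v => wt ((v - u) / h n) :=
    hA.measurable_weight.comp ((measurable_id.sub_const u).div_const _)
  have := S.integral_score_mul_eq_zero hscore hm hmom hw (κ := κ)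
    (fun x => hA.abs_weight_le _) n i j
  rw [zero_mul, zero_mul]
  exact (abs_eq_zero.2 this).le

/-- The scale ρ satisfies nh·ρ² = log h⁻¹, so the exponential inequality yields powers of `h`,
enough against a polynomial number of events. Scores, weighted by K(x) and x·K(x) for the two design
blocks, are controlled at level ρ; Hessian and Lipschitz variables only at level 1. -/
theorem isBigOP_of_polyRegime {K : ℝ → ℝ} {h lam1 lam2 : ℕ → ℝ} (hlam1 : ∀ n, 0 < lam1 n)
    (hlam2 : ∀ n, 0 < lam2 n) {atil btil : ∀ n, Fin n → Ω n → EuclideanSpace ℝ (Fin (S.d n))}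
    (hest : S.IsPrelimEstimator K h lam1 lam2 atil btil) (hK : IsKernel K)
    (hscore : S.ScoreCondition) (hcurv : S.NegCurvature)
    (hRE : S.RestrictedEigenvalue K h lam1 lam2) (hdens : S.DensityCondition)
    (hcoef : S.CoefficientCondition) {m τ₁ : ℝ} (hm : 2 < m) (hτ : 0 ≤ τ₁)
    (hmom : S.PolyMoments m) (hreg : S.PolyRegime h lam1 lam2 m τ₁) :
    IsBigOP P (S.maxError h atil btil) fun n => √(S.s n) * lam1 n := by
  obtain ⟨⟨C₁, hC₁⟩, M, hM, C₂, hC₂⟩ := hmom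
  obtain ⟨hd, hX, hT⟩ := hreg
  obtain ⟨hsh, hx, hs2, hlam0⟩ := S.tuning_props hlam1 hT
  obtain ⟨⟨δ₁, hδ0, hδ1, hh⟩, -, hprop, -⟩ := hT
  obtain ⟨hpos, hL, -, -⟩ := bandwidth_props hδ0 hδ1 hh
  set ρ : ℕ → ℝ := fun n => (Real.log (h n)⁻¹ / (n * h n)) ^ (1 / 2 : ℝ) with hρdef
  have hρ0 : Tendsto ρ atTop (𝓝 0) := hx.trans_tendsto hlam0
  have hρ : ∀ᶠ n in atTop, 0 < ρ n ∧ ρ n ≤ 1 ∧ (n : ℝ) * h n * ρ n * ρ n = Real.log (h n)⁻¹ := by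
    filter_upwards [hpos, hL.eventually_gt_atTop 0, hρ0.eventually_le_const one_pos,
      eventually_gt_atTop 0] with n h1 h2 h3 h4
    have hn : (0 : ℝ) < n := by exact_mod_cast h4
    have hx0 : 0 < Real.log (h n)⁻¹ / (n * h n) := by positivity
    refine ⟨Real.rpow_pos_of_pos hx0 _, h3, ?_⟩
    have : ρ n * ρ n = Real.log (h n)⁻¹ / (n * h n) := by
      simp only [hρdef]
      rw [← Real.rpow_add hx0]; norm_num
    rw [mul_assoc, this]; field_simp
  obtain ⟨q, hq, hrate⟩ := exists_rate_poly hδ0 hτ hh hd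
  have hle₁ : ∀ᶠ n : ℕ in atTop, Real.log (h n)⁻¹ ≤ n * h n * ρ n * ρ n :=
    hρ.mono fun n hn => hn.2.2.ge
  have hle₂ : ∀ᶠ n : ℕ in atTop, Real.log (h n)⁻¹ ≤ n * h n * ρ n * 1 := by
    filter_upwards [hρ, hpos] with n hn hh
    rw [← hn.2.2]
    have := hn.1
    exact mul_le_mul_of_nonneg_left hn.2.1 (by positivity)
  -- This is the rate condition raised to the power −m/2.
  have htrunc : Tendsto (fun n : ℕ => (n : ℝ) * (S.d n : ℝ) ^ 3 * ρ n ^ m) atTop (𝓝 0) := by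
    have h1 := (tendsto_rpow_neg_atTop (show 0 < m / 2 by linarith)).comp hX
    refine h1.congr' ?_
    filter_upwards [hpos, hL.eventually_gt_atTop 0, eventually_gt_atTop 0] with n h1 h2 h4
    have hn : (0 : ℝ) < n := by exact_mod_cast h4
    have hd0 : (0 : ℝ) < S.d n := by exact_mod_cast S.one_le_d n
    have hx0 : 0 < Real.log (h n)⁻¹ / (n * h n) := by positivity
    have hN : (0 : ℝ) < n * (S.d n : ℝ) ^ 3 := by positivity
    have e : (n : ℝ) * h n / (((n : ℝ) * (S.d n : ℝ) ^ 3) ^ (2 / m) * Real.log (h n)⁻¹) =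
        (((n : ℝ) * (S.d n : ℝ) ^ 3) ^ (2 / m) * (Real.log (h n)⁻¹ / (n * h n)))⁻¹ := by
      field_simp
    simp only [Function.comp_apply, hρdef]
    rw [e, Real.rpow_neg (by positivity), Real.inv_rpow (by positivity), inv_inv,
      Real.mul_rpow (by positivity) hx0.le, ← Real.rpow_mul hN.le, ← Real.rpow_mul hx0.le]
    have e2 : 2 / m * (m / 2) = 1 := by field_simp
    rw [e2, Real.rpow_one]
    congr 2; ring
  have htr : ∀ card : ℕ → ℕ, (∀ n, card n ≤ S.d n ^ 3) →
      Tendsto (fun n : ℕ => (n : ℝ) * card n * ρ n ^ m) atTop (𝓝 0) := fun card hcard => by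
    refine tendsto_of_tendsto_of_tendsto_of_le_of_le' tendsto_const_nhds htrunc ?_ ?_
    · filter_upwards [hρ] with n hn
      have := hn.1
      positivity
    · filter_upwards [hρ] with n hn
      have := hn.1
      have h1 : (card n : ℝ) ≤ (S.d n : ℝ) ^ 3 := by exact_mod_cast hcard n
      gcongr
  obtain ⟨κ, Cw, hA⟩ := S.exists_isKernelArray hdens hK.1 hK.2.2.2.2 hpos
  obtain ⟨κ', Cw', hA'⟩ := S.exists_isKernelArray hdens (wt := fun x => x * K x)
    (continuous_id.mul hK.1) (hK.2.2.2.2.mul_left (f := fun x => x)) hpos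
  have hD₁ : 0 ≤ max C₁ 0 := le_max_right _ _
  have hD₂ : 0 ≤ max C₂ 0 := le_max_right _ _
  have hs := fun n i j => (S.condLE_score hC₁ n i j).mono
    (ENNReal.ofReal_le_ofReal (le_max_left C₁ 0))
  have hH := fun n i j => (S.condLE_hess hC₁ n i j).mono
    (ENNReal.ofReal_le_ofReal (le_max_left C₁ 0))
  have hLip := fun n i j => (S.condLE_lip hC₂ n i j).mono
    (ENNReal.ofReal_le_ofReal (le_max_left C₂ 0))
  have hρt₁ : ∀ᶠ n in atTop, 0 < ρ n ∧ ρ n ≤ 1 ∧ ρ n ≤ ρ n :=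
    hρ.mono fun n hn => ⟨hn.1, hn.2.1, le_rfl⟩
  have hρt₂ : ∀ᶠ n in atTop, 0 < ρ n ∧ ρ n ≤ 1 ∧ ρ n ≤ 1 :=
    hρ.mono fun n hn => ⟨hn.1, hn.2.1, hn.2.1⟩
  have hm1 : 1 ≤ m := by linarith
  obtain ⟨A₀, hE₀⟩ := hA.exists_bound_of_poly_moment (S.measurable_scoreFun hcoef) (t := ρ) hm.le
    hD₁ le_rfl hs (S.score_bias_eq_zero hscore hm1 hC₁ hA) hρt₁ (htr _ S.card_le_cube)
    ⟨q, tendsto_rate_of_le hq S.card_le_cube hrate hle₁⟩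
  obtain ⟨A₁, hE₁⟩ := hA'.exists_bound_of_poly_moment (S.measurable_scoreFun hcoef) (t := ρ) hm.le
    hD₁ le_rfl hs (S.score_bias_eq_zero hscore hm1 hC₁ hA') hρt₁ (htr _ S.card_le_cube)
    ⟨q, tendsto_rate_of_le hq S.card_le_cube hrate hle₁⟩
  have hβ : ∀ C : ℝ, 0 ≤ C → 0 ≤ (1 + C) * Cw := fun C hC =>
    mul_nonneg (by linarith) hA.moment_nonneg
  obtain ⟨A₂, hE₂⟩ := hA.exists_bound_of_poly_moment (S.measurable_hessFun hcoef)
    (t := fun _ => 1) hm.le hD₁ (hβ _ hD₁) hH (hA.abs_integral_le hm1 hD₁ hH) hρt₂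
    (htr _ S.card_prod_le_cube) ⟨q, tendsto_rate_of_le hq S.card_prod_le_cube hrate hle₂⟩
  obtain ⟨A₃, hE₃⟩ := hA.exists_bound_of_poly_moment
    (fun n => S.measurable_lipFun (hM n).1) (t := fun _ => 1) hm.le hD₂ (hβ _ hD₂) hLip
    (hA.abs_integral_le hm1 hD₂ hLip) hρt₂
    (htr _ S.card_triple_le_cube) ⟨q, tendsto_rate_of_le hq S.card_triple_le_cube hrate hle₂⟩
  exact S.isBigOP_maxError hlam1 hlam2 hest hK hcurv hRE hcoef hM hpos hsh hprop hs2 hx hE₀ hE₁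
    hE₂ hE₃

/-- Exponential moments make truncation unnecessary. The level `t` is larger than in the polynomial
case, so that the exponent nh·t² outgrows the logarithm of the number of covariates. -/
theorem isBigOP_of_expRegime {K : ℝ → ℝ} {h lam1 lam2 : ℕ → ℝ} (hlam1 : ∀ n, 0 < lam1 n)
    (hlam2 : ∀ n, 0 < lam2 n) {atil btil : ∀ n, Fin n → Ω n → EuclideanSpace ℝ (Fin (S.d n))}
    (hest : S.IsPrelimEstimator K h lam1 lam2 atil btil) (hK : IsKernel K)
    (hscore : S.ScoreCondition) (hcurv : S.NegCurvature)
    (hRE : S.RestrictedEigenvalue K h lam1 lam2) (hdens : S.DensityCondition)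
    (hcoef : S.CoefficientCondition) {τ₂ τ₃ : ℝ} (hτ₃ : 0 < τ₃) (hτ₃' : τ₃ < 1)
    (hτ : τ₂ < 1 - τ₃) (hmom : S.BernsteinMoments) (hreg : S.ExpRegime h lam1 lam2 τ₂ τ₃) :
    IsBigOP P (S.maxError h atil btil) fun n => √(S.s n) * lam1 n := by
  obtain ⟨⟨M₀, hM₀, hC₁⟩, M, hM, M₁, hM₁, hC₂⟩ := hmom
  obtain ⟨hd, hT⟩ := hreg
  obtain ⟨hsh, hx, hs2, hlam0⟩ := S.tuning_props hlam1 hT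
  obtain ⟨⟨δ₁, hδ0, hδ1, hh⟩, -, hprop, -⟩ := hT
  obtain ⟨hpos, hL, ⟨c, hc, hlow⟩, hnh⟩ := bandwidth_props hδ0 hδ1 hh
  set t : ℕ → ℝ := fun n => (Real.log (h n)⁻¹ / (n * h n)) ^ (τ₃ / 2) with htdef
  have ht0 : Tendsto t atTop (𝓝 0) := hx.trans_tendsto hlam0
  have ht : ∀ᶠ n in atTop, 0 ≤ t n ∧ t n ≤ 1 := by
    filter_upwards [hpos, hL.eventually_gt_atTop 0, ht0.eventually_le_const one_pos] with n h1 h2 h3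
    exact ⟨Real.rpow_nonneg (by positivity) _, h3⟩
  have hrate := tendsto_rate_exp hδ1 hτ hτ₃' hc hlow hnh hd
  -- Here nh·t² = (nh)^{1−τ₃}(log h⁻¹)^{τ₃}, and the logarithm is eventually at least 1.
  have hle₁ : ∀ᶠ n : ℕ in atTop, ((n : ℝ) * h n) ^ (1 - τ₃) / 2 ≤ n * h n * (t n / 2) * t n := by
    filter_upwards [hL.eventually_ge_atTop 1, hnh.eventually_ge_atTop 1] with n h1 h2
    have hy : 0 < (n : ℝ) * h n := by linarith
    have hx0 : 0 < Real.log (h n)⁻¹ / (n * h n) := div_pos (by linarith) hy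
    have e : t n * t n = (Real.log (h n)⁻¹) ^ τ₃ / ((n : ℝ) * h n) ^ τ₃ := by
      simp only [htdef]
      rw [← Real.rpow_add hx0, add_halves, Real.div_rpow (by linarith) hy.le]
    have e2 : (n : ℝ) * h n * (t n / 2) * t n =
        ((n : ℝ) * h n) ^ (1 - τ₃) / 2 * (Real.log (h n)⁻¹) ^ τ₃ := by
      rw [Real.rpow_sub hy, Real.rpow_one]
      calc _ = (n : ℝ) * h n / 2 * (t n * t n) := by ring
        _ = _ := by rw [e]; ring
    rw [e2]
    exact le_mul_of_one_le_right (by positivity) (Real.one_le_rpow h1 hτ₃.le)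
  have hle₂ : ∀ᶠ n : ℕ in atTop, ((n : ℝ) * h n) ^ (1 - τ₃) / 2 ≤ n * h n * (1 / 2) * 1 := by
    filter_upwards [hnh.eventually_ge_atTop 1] with n h2
    have := Real.rpow_le_rpow_of_exponent_le h2 (show 1 - τ₃ ≤ 1 by linarith)
    rw [Real.rpow_one] at this
    linarith
  obtain ⟨κ, Cw, hA⟩ := S.exists_isKernelArray hdens hK.1 hK.2.2.2.2 hpos
  obtain ⟨κ', Cw', hA'⟩ := S.exists_isKernelArray hdens (wt := fun x => x * K x)
    (continuous_id.mul hK.1) (hK.2.2.2.2.mul_left (f := fun x => x)) hpos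
  have hs := fun n i j => condLE_exp_of_bernstein (S.U_measurable n i)
    ((S.measurable_scoreFun hcoef n j).comp (S.measurable_obs n i)) hM₀.le fun m hm => by
      have := S.condLE_score (hC₁ m hm) n i j
      simp only [Real.rpow_natCast] at this
      exact this
  have hH := fun n i j => condLE_exp_of_bernstein (S.U_measurable n i)
    ((S.measurable_hessFun hcoef n j).comp (S.measurable_obs n i)) hM₀.le fun m hm => by
      have := S.condLE_hess (hC₁ m hm) n i j
      simp only [Real.rpow_natCast] at this
      exact this
  have hLip := fun n i j => condLE_exp_of_bernstein (S.U_measurable n i)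
    ((S.measurable_lipFun (hM n).1 j).comp (S.measurable_obs n i)) hM₁.le fun m hm => by
      have := S.condLE_lip (hC₂ m hm) n i j
      simp only [Real.rpow_natCast] at this
      exact this
  have hD₁ : 0 ≤ M₀ * (2 : ℕ).factorial / 2 := by positivity
  have hD₂ : 0 ≤ M₁ * (2 : ℕ).factorial / 2 := by positivity
  have h2 : (1 : ℝ) ≤ (2 : ℕ) := by norm_num
  have ht1 : ∀ᶠ _ : ℕ in atTop, (0 : ℝ) ≤ 1 ∧ (1 : ℝ) ≤ 1 :=
    Eventually.of_forall fun _ => ⟨zero_le_one, le_rfl⟩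
  have h8 : (0 : ℝ) ≤ 8 := by norm_num
  obtain ⟨A₀, hE₀⟩ := hA.exists_bound_of_exp_moment (S.measurable_scoreFun hcoef) (t := t)
    (by positivity) le_rfl hs (S.score_bias_eq_zero hscore h2 (hC₁ 2 le_rfl) hA) ht
    ⟨8, tendsto_rate_of_le h8 S.card_le_cube hrate hle₁⟩
  obtain ⟨A₁, hE₁⟩ := hA'.exists_bound_of_exp_moment (S.measurable_scoreFun hcoef) (t := t)
    (by positivity) le_rfl hs (S.score_bias_eq_zero hscore h2 (hC₁ 2 le_rfl) hA') ht
    ⟨8, tendsto_rate_of_le h8 S.card_le_cube hrate hle₁⟩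
  have hβ : ∀ C : ℝ, 0 ≤ C → 0 ≤ (1 + C) * Cw := fun C hC =>
    mul_nonneg (by linarith) hA.moment_nonneg
  obtain ⟨A₂, hE₂⟩ := hA.exists_bound_of_exp_moment (S.measurable_hessFun hcoef)
    (t := fun _ => 1) (by positivity) (hβ _ hD₁) hH
    (hA.abs_integral_le h2 hD₁ (S.condLE_hess (hC₁ 2 le_rfl))) ht1
    ⟨8, tendsto_rate_of_le h8 S.card_prod_le_cube hrate hle₂⟩
  obtain ⟨A₃, hE₃⟩ := hA.exists_bound_of_exp_moment
    (fun n => S.measurable_lipFun (hM n).1) (t := fun _ => 1) (by positivity) (hβ _ hD₂) hLip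
    (hA.abs_integral_le h2 hD₂ (S.condLE_lip (hC₂ 2 le_rfl))) ht1
    ⟨8, tendsto_rate_of_le h8 S.card_triple_le_cube hrate hle₂⟩
  exact S.isBigOP_maxError hlam1 hlam2 hest hK hcurv hRE hcoef hM hpos hsh hprop hs2 hx hE₀ hE₁
    hE₂ hE₃

end Model

end GSVCM

theorem proposition3p1 {Ω : ℕ → Type*} [∀ n, MeasurableSpace (Ω n)] (P : ∀ n, Measure (Ω n))
    [∀ n, IsProbabilityMeasure (P n)] (S : GSVCM.Model P)
    (K : ℝ → ℝ) (h lam1 lam2 : ℕ → ℝ)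
    (hlam1 : ∀ n, 0 < lam1 n) (hlam2 : ∀ n, 0 < lam2 n)
    (atil btil : ∀ n, Fin n → Ω n → EuclideanSpace ℝ (Fin (S.d n)))
    (hest : S.IsPrelimEstimator K h lam1 lam2 atil btil)
    (hK : GSVCM.IsKernel K)
    (hscore : S.ScoreCondition)
    (hcurv : S.NegCurvature)
    (hRE : S.RestrictedEigenvalue K h lam1 lam2)
    (hdens : S.DensityCondition)
    (hcoef : S.CoefficientCondition) :
    (∀ m0 τ₁ : ℝ, 2 < m0 → 0 ≤ τ₁ → S.PolyMoments m0 → S.PolyRegime h lam1 lam2 m0 τ₁ →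
      GSVCM.IsBigOP P (S.maxError h atil btil) fun n => √(S.s n) * lam1 n) ∧
    (∀ τ₂ τ₃ : ℝ, 0 < τ₃ → τ₃ < 1 → 0 ≤ τ₂ → τ₂ < 1 - τ₃ → S.BernsteinMoments →
      S.ExpRegime h lam1 lam2 τ₂ τ₃ →
      GSVCM.IsBigOP P (S.maxError h atil btil) fun n => √(S.s n) * lam1 n) := by
  exact ⟨fun m0 τ₁ hm hτ hmom hreg => S.isBigOP_of_polyRegime hlam1 hlam2 hest hK hscore hcurv hRE
      hdens hcoef hm hτ hmom hreg,
    fun τ₂ τ₃ hτ₃ hτ₃' _ hτ hmom hreg => S.isBigOP_of_expRegime hlam1 hlam2 hest hK hscore hcurv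
      hRE hdens hcoef hτ₃ hτ₃' hτ hmom hreg⟩
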